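/- Let $k$ be a commutative ring, $A$ a $k$-algebra and $H$ a Hopf algebra over $k$ with a weak action $(h,a)\mapsto a^h$ on $A$, that is, a bilinear map with $(ab)^h=a^{h^{(1)}}b^{h^{(2)}}$, $1^h=\epsilon(h)1$ and $a^1=a$. Let $f\colon H\otimes H\to A$ be a $k$-linear map such that $A\otimes H$ with the product $(a\# h)(b\# l)=a\,b^{h^{(1)}}f(h^{(2)},l^{(1)})\# h^{(3)}l^{(2)}$ is associative with identity $1\# 1$, and let $E=A\#_f H$ be this crossed product. Assume that $f$ is convolution invertible and write $(1\# h)^{-1}=f^{-1}(S_H(h^{(2)}),h^{(3)})\# S_H(h^{(1)})$, where $S_H$ is the antipode of $H$. Let $S\subseteq A$ be a separable $k$-subalgebra such that $s^h\in S$ and $f(h,l)\in S$ for all $h,l\in H$ and $s\in S$, and let $M$ be an $E$-bimodule (with $k$ acting centrally). Put $\widetilde A=A/S$ and let $M\otimes_S\widetilde A^{r}\otimes_S$ be the cyclic tensor product over $S$ of $M$ and $r$ copies of $\widetilde A$ (for $r=0$ it is $M/[S,M]$). These modules form a chain complex $(M\otimes_S\widetilde A^{*}\otimes_S,b_*)$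 with the Hochschild boundary $$b(m\otimes a_1\otimes\cdots\otimes a_r)=ma_1\otimes a_2\otimes\cdots\otimes a_r+\sum_{i=1}^{r-1}(-1)^i m\otimes a_1\otimes\cdots\otimes a_ia_{i+1}\otimes\cdots\otimes a_r+(-1)^r a_rm\otimes a_1\otimes\cdots\otimes a_{r-1}.$$ Then the formula $$h\cdot(m\otimes_S a_1\otimes_S\cdots\otimes_S a_r\otimes_S)=(1\# h^{(r+2)})\,m\,(1\# h^{(1)})^{-1}\otimes_S a_1^{h^{(2)}}\otimes_S\cdots\otimes_S a_r^{h^{(r+1)}}\otimes_S$$ makes $(M\otimes_S\widetilde A^{*}\otimes_S,b_*)$ a chain complex of left $H$-modules, and the Hochschild homology of $E$ with coefficients in $M$ (the homology of the normalized complex $(M\otimes(E/k)^{\otimes *},b_*)$) is the homology of $H$ with coefficients in this complex: for every $n\ge 0$, $$\operatorname{H}_n(E,M)\cong\operatorname{H}_n\bigl(H,(M\otimes_S\widetilde A^{*}\otimes_S,b_*)\bigr)$$ as $k$-modules. Here, for a chain complex $(C_*,\partial)$ of left $H$-modules, $\operatorname{H}_*(H,C_*)$ is the homology of the total complex of the double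 complex $C_r\otimes(H/k)^{\otimes s}$ ($r,s\ge0$) whose differentials are $\partial\otimes\mathrm{id}$ and $(-1)^r$ times $$c\otimes h_1\otimes\cdots\otimes h_s\mapsto\epsilon(h_1)c\otimes h_2\otimes\cdots\otimes h_s+\sum_{i=1}^{s-1}(-1)^i c\otimes h_1\otimes\cdots\otimes h_ih_{i+1}\otimes\cdots\otimes h_s+(-1)^s h_sc\otimes h_1\otimes\cdots\otimes h_{s-1}.$$ -/

import Mathlib

open scoped TensorProduct

noncomputable section

universe u v w

/-- A `B`-bimodule structure on the `k`-module `M` (with `k` acting centrally), given by the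
left multiplications `l b m = b m` and the right multiplications `r b m = m b`. -/
structure BimoduleData (k B M : Type*) [CommRing k] [Ring B] [Algebra k B]
    [AddCommGroup M] [Module k M] where
  /-- Left multiplication. -/
  l : B →ₗ[k] Module.End k M
  /-- Right multiplication. -/
  r : B →ₗ[k] Module.End k M
  l_one : l 1 = LinearMap.id
  r_one : r 1 = LinearMap.id
  l_mul : ∀ b c m, l (b * c) m = l b (l c m)
  r_mul : ∀ b c m, r (b * c) m = r c (r b m)
  l_r : ∀ b c m, l b (r c m) = r c (l b m)

namespace BimoduleData

variable {k B M : Type*} [CommRing k] [Ring B] [Algebra k B] [AddCommGroup M] [Module k M]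

/-- Restriction of a bimodule structure along an algebra map. -/
def restrict {A : Type*} [Ring A] [Algebra k A] (P : BimoduleData k B M) (φ : A →ₐ[k] B) :
    BimoduleData k A M where
  l := P.l ∘ₗ φ.toLinearMap
  r := P.r ∘ₗ φ.toLinearMap
  l_one := by simp [P.l_one]
  r_one := by simp [P.r_one]
  l_mul b c m := by simp [P.l_mul]
  r_mul b c m := by simp [P.r_mul]
  l_r b c m := by simp [P.l_r]

/-- The bimodule structure of a bimodule in the usual type class form. -/
def ofModule [Module B M] [Module Bᵐᵒᵖ M] [IsScalarTower k B M] [IsScalarTower k Bᵐᵒᵖ M]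
    [SMulCommClass B Bᵐᵒᵖ M] : BimoduleData k B M where
  l := (Algebra.lsmul k k M).toLinearMap
  r := (Algebra.lsmul k k M).toLinearMap ∘ₗ (MulOpposite.opLinearEquiv k).toLinearMap
  l_one := by ext; simp
  r_one := by ext; simp
  l_mul b c m := by simp
  r_mul b c m := by simp
  l_r b c m := by simp [smul_comm]

/-- A left `H`-module, made into an `H`-bimodule through the trivial right action
`n h = ε(h) n`. -/
def ofAction {H : Type*} [Ring H] [Bialgebra k H] (ρ : H →ₐ[k] Module.End k M) :
    BimoduleData k H M where
  l := ρ.toLinearMap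
  r := (Algebra.linearMap k (Module.End k M)) ∘ₗ Coalgebra.counit
  l_one := map_one ρ
  r_one := by
    rw [LinearMap.comp_apply, Bialgebra.counit_one, Algebra.linearMap_apply, map_one]
    rfl
  l_mul b c m := by simp
  r_mul b c m := by
    simp only [LinearMap.comp_apply, Bialgebra.counit_mul, Algebra.linearMap_apply,
      Module.algebraMap_end_apply, mul_smul]
    exact smul_comm _ _ _
  l_r b c m := by
    simp only [LinearMap.comp_apply, Algebra.linearMap_apply, Module.algebraMap_end_apply, map_smul]

end BimoduleData

namespace RelChains

variable {k B M : Type*} [CommRing k] [Ring B] [Algebra k B] [AddCommGroup M] [Module k M]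

/-- Word part of the `j`-th Hochschild face of `x₀ ⊗ a` where `a = (a₀, …, aₙ)`: `j = 0` drops `a₀`,
`j = n + 1` drops `aₙ`, and `0 < j < n + 1` replaces `a_{j-1}, a_j` by their product. -/
def faceWord {n : ℕ} (j : Fin (n + 2)) (a : Fin (n + 1) → B) (i : Fin n) : B :=
  if (i : ℕ) + 1 < j then a i.castSucc
  else if (i : ℕ) + 1 = j then a i.castSucc * a i.succ
  else a i.succ

/-- Coefficient part of the `j`-th Hochschild face of `m ⊗ (a₀, …, aₙ)`: it is `m a₀` for `j = 0`,
`aₙ m` for `j = n + 1`, and `m` otherwise. -/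
def faceEnd (P : BimoduleData k B M) {n : ℕ} (j : Fin (n + 2)) (a : Fin (n + 1) → B) :
    M →ₗ[k] M :=
  if (j : ℕ) = 0 then P.r (a 0) else if (j : ℕ) = n + 1 then P.l (a (Fin.last n)) else LinearMap.id

theorem face_update (P : BimoduleData k B M) {n : ℕ} (j : Fin (n + 2)) (a : Fin (n + 1) → B)
    (p : Fin (n + 1)) :
    ((∀ x, faceWord j (Function.update a p x) = faceWord j a) ∧
      ∃ g : B →ₗ[k] Module.End k M, ∀ x, faceEnd P j (Function.update a p x) = g x) ∨
    ((∀ x, faceEnd P j (Function.update a p x) = faceEnd P j a) ∧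
      ∃ (q : Fin n) (g : B →ₗ[k] B), ∀ x,
        faceWord j (Function.update a p x) = Function.update (faceWord j a) q (g x)) := by
  obtain ⟨j, hj⟩ := j
  obtain ⟨p, hp⟩ := p
  rcases Nat.eq_zero_or_pos j with h0 | h0
  · subst h0
    rcases Nat.eq_zero_or_pos p with hp0 | hp0
    · subst hp0
      left
      refine ⟨fun x => ?_, P.r, fun x => ?_⟩
      · funext i
        simp [faceWord, Function.update_apply, Fin.ext_iff]
      · simp [faceEnd, Function.update_apply, Fin.ext_iff]
    · right
      refine ⟨fun x => ?_, ⟨p - 1, by omega⟩, LinearMap.id, fun x => ?_⟩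
      · simp [faceEnd, Function.update_apply, Fin.ext_iff, hp0.ne]
      · funext i
        have : (i : ℕ) + 1 = p ↔ (i : ℕ) = p - 1 := by omega
        simp [faceWord, Function.update_apply, Fin.ext_iff, this]
  rcases Nat.lt_or_ge n j with hjn | hjn
  · obtain rfl : j = n + 1 := by omega
    rcases eq_or_ne p n with hpn | hpn
    · subst hpn
      left
      refine ⟨fun x => ?_, P.l, fun x => ?_⟩
      · funext i
        have := i.2
        have h2 : (i : ℕ) ≠ p := by omega
        simp [faceWord, Function.update_apply, Fin.ext_iff, h2]
      · simp [faceEnd, Function.update_apply, Fin.ext_iff]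
    · right
      refine ⟨fun x => ?_, ⟨p, by omega⟩, LinearMap.id, fun x => ?_⟩
      · simp [faceEnd, Function.update_apply, Fin.ext_iff, hpn.symm]
      · funext i
        have := i.2
        simp [faceWord, Function.update_apply, Fin.ext_iff]
  · right
    have hE : ∀ x, faceEnd P ⟨j, hj⟩ (Function.update a ⟨p, hp⟩ x) = faceEnd P ⟨j, hj⟩ a := by
      intro x
      have h1 : j ≠ 0 := by omega
      have h2 : j ≠ n + 1 := by omega
      simp [faceEnd, h1, h2]
    refine ⟨hE, ?_⟩
    rcases lt_trichotomy (p + 1) j with h | h | h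
    · refine ⟨⟨p, by omega⟩, LinearMap.id, fun x => ?_⟩
      funext ⟨i, hi⟩
      simp only [faceWord, Function.update_apply, Fin.ext_iff, Fin.val_castSucc, Fin.val_succ]
      split_ifs <;> first | omega | rfl
    · refine ⟨⟨p, by omega⟩, LinearMap.mulRight k (a ⟨p + 1, by omega⟩), fun x => ?_⟩
      funext ⟨i, hi⟩
      simp only [faceWord, Function.update_apply, Fin.ext_iff, Fin.val_castSucc, Fin.val_succ,
        LinearMap.mulRight_apply]
      split_ifs <;> first | omega | rfl | skip
      all_goals subst_vars; rfl
    · rcases Nat.lt_or_ge j p with hjp | hjp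
      · refine ⟨⟨p - 1, by omega⟩, LinearMap.id, fun x => ?_⟩
        funext ⟨i, hi⟩
        simp only [faceWord, Function.update_apply, Fin.ext_iff, Fin.val_castSucc, Fin.val_succ]
        split_ifs <;> first | omega | rfl
      · obtain rfl : j = p := by omega
        refine ⟨⟨j - 1, by omega⟩, LinearMap.mulLeft k (a ⟨j - 1, by omega⟩), fun x => ?_⟩
        funext ⟨i, hi⟩
        simp only [faceWord, Function.update_apply, Fin.ext_iff, Fin.val_castSucc, Fin.val_succ,
          LinearMap.mulLeft_apply]
        split_ifs <;> first | omega | rfl | skip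
        all_goals subst_vars; rfl

/-- The `k`-module `M ⊗ B ⊗ ⋯ ⊗ B` (`n` factors `B`, tensor products over `k`). -/
abbrev Chains (k B M : Type*) [CommRing k] [Ring B] [Algebra k B] [AddCommGroup M] [Module k M]
    (n : ℕ) := M ⊗[k] (⨂[k] _ : Fin n, B)

/-- The elementary tensor `m ⊗ a₀ ⊗ ⋯ ⊗ a_{n-1}`. -/
def elem {n : ℕ} (m : M) (a : Fin n → B) : Chains k B M n := m ⊗ₜ[k] PiTensorProduct.tprod k a

/-- The `j`-th Hochschild face as a multilinear map of the word. -/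
def faceMultilinear (P : BimoduleData k B M) {n : ℕ} (j : Fin (n + 2)) :
    MultilinearMap k (fun _ : Fin (n + 1) => B) (M →ₗ[k] Chains k B M n) where
  toFun a := (TensorProduct.mk k M _).flip (PiTensorProduct.tprod k (faceWord j a)) ∘ₗ faceEnd P j a
  map_update_add' a p x y := by
    rename_i inst
    obtain rfl : inst = instDecidableEqFin _ := Subsingleton.elim _ _
    rcases face_update P j a p with ⟨h1, g, h2⟩ | ⟨h1, q, g, h2⟩
    · simp only [h1, h2, map_add, LinearMap.comp_add]
    · simp only [h1, h2, map_add, MultilinearMap.map_update_add, LinearMap.add_comp]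
  map_update_smul' a p c x := by
    rename_i inst
    obtain rfl : inst = instDecidableEqFin _ := Subsingleton.elim _ _
    rcases face_update P j a p with ⟨h1, g, h2⟩ | ⟨h1, q, g, h2⟩
    · simp only [h1, h2, map_smul, LinearMap.comp_smul]
    · simp only [h1, h2, map_smul, MultilinearMap.map_update_smul, LinearMap.smul_comp]

/-- The `j`-th Hochschild face `M ⊗ B^{n+1} → M ⊗ B^n`. -/
def face (P : BimoduleData k B M) {n : ℕ} (j : Fin (n + 2)) :
    Chains k B M (n + 1) →ₗ[k] Chains k B M n :=
  TensorProduct.lift (PiTensorProduct.lift (faceMultilinear P j)).flip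

theorem face_elem (P : BimoduleData k B M) {n : ℕ} (j : Fin (n + 2)) (m : M)
    (a : Fin (n + 1) → B) : face P j (elem (k := k) m a) = elem (faceEnd P j a m) (faceWord j a) := by
  simp [face, elem, faceMultilinear]

/-- The Hochschild boundary `b(m ⊗ a₀ ⊗ ⋯ ⊗ aₙ) = m a₀ ⊗ a₁ ⊗ ⋯ ⊗ aₙ
+ ∑ (-1)^j m ⊗ a₀ ⊗ ⋯ ⊗ a_{j-1} a_j ⊗ ⋯ ⊗ aₙ + (-1)^{n+1} aₙ m ⊗ a₀ ⊗ ⋯ ⊗ a_{n-1}`. -/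
def boundary (P : BimoduleData k B M) (n : ℕ) : Chains k B M (n + 1) →ₗ[k] Chains k B M n :=
  ∑ j : Fin (n + 2), (-1 : k) ^ (j : ℕ) • face P j

theorem chains_ext {n : ℕ} {N : Type*} [AddCommGroup N] [Module k N]
    {φ ψ : Chains k B M n →ₗ[k] N} (h : ∀ m a, φ (elem m a) = ψ (elem m a)) : φ = ψ := by
  ext m a
  exact h m a

theorem face_face (P : BimoduleData k B M) {n : ℕ} (i : Fin (n + 2)) (j : Fin (n + 2))
    (h : i ≤ j) :
    face P i ∘ₗ face P j.succ = face P j ∘ₗ face P i.castSucc := by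
  refine chains_ext fun m a => ?_
  obtain ⟨i, hi⟩ := i
  obtain ⟨j, hj⟩ := j
  simp only [Fin.mk_le_mk] at h
  simp only [LinearMap.comp_apply, face_elem]
  congr 1
  · rcases Nat.eq_zero_or_pos i with rfl | hi0
    · rcases Nat.eq_zero_or_pos j with rfl | hj0
      · simp [faceEnd, faceWord, P.r_mul]
      · rcases eq_or_ne j (n + 1) with rfl | hjn
        · simp [faceEnd, faceWord, P.l_r]
        · simp [faceEnd, faceWord, hj0.ne', hjn, hj0]
    · rcases eq_or_ne i (n + 1) with rfl | hin
      · obtain rfl : j = n + 1 := by omega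
        simp [faceEnd, faceWord, P.l_mul]
      · have h1 : i ≠ n + 2 := by omega
        have h2 : ¬ n + 1 < i := by omega
        rcases eq_or_ne j (n + 1) with rfl | hjn
        · simp [faceEnd, faceWord, hi0.ne', hin, hin.symm, h1, h2]
        · have h3 : j ≠ 0 := by omega
          simp [faceEnd, hi0.ne', h1, h3, hjn, hin]
  · funext ⟨q, hq⟩
    simp only [faceWord, Fin.val_castSucc, Fin.val_succ]
    split_ifs <;> first | omega | rfl | simp [mul_assoc]


theorem alternating_sum_eq_zero {N : Type*} [AddCommGroup N] [Module k N] {n : ℕ}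
    (g : Fin (n + 2) → Fin (n + 3) → N) (hg : ∀ i j, i ≤ j → g i j.succ = g j i.castSucc) :
    ∑ i : Fin (n + 2), (-1 : k) ^ (i : ℕ) • ∑ j : Fin (n + 3), (-1 : k) ^ (j : ℕ) • g i j = 0 := by
  simp only [Finset.smul_sum, smul_smul, ← Finset.sum_product']
  let Q := Fin (n + 2) × Fin (n + 3)
  let T : Finset Q := {ij : Q | (ij.2 : ℕ) ≤ (ij.1 : ℕ)}
  rw [Finset.univ_product_univ, ← Finset.sum_add_sum_compl T, ← eq_neg_iff_add_eq_zero,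
    ← Finset.sum_neg_distrib]
  let φ : ∀ ij : Q, ij ∈ T → Q := fun ij hij =>
    (Fin.castLT ij.2 (lt_of_le_of_lt (Finset.mem_filter.mp hij).right (Fin.is_lt ij.1)), ij.1.succ)
  apply Finset.sum_bij φ
  · intro ij hij
    simp_rw [T, φ, Finset.compl_filter, Finset.mem_filter_univ, Fin.val_succ,
      Fin.val_castLT] at hij ⊢
    lia
  · rintro ⟨i, j⟩ hij ⟨i', j'⟩ hij' h
    rw [Prod.mk_inj]
    exact ⟨by simpa [φ] using! congr_arg Prod.snd h,
      by simpa [φ, Fin.castSucc_castLT] using! congr_arg Fin.castSucc (congr_arg Prod.fst h)⟩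
  · rintro ⟨i', j'⟩ hij'
    simp_rw [T, Finset.compl_filter, Finset.mem_filter_univ, not_le] at hij'
    refine ⟨(j'.pred <| ?_, Fin.castSucc i'), ?_, ?_⟩
    · rintro rfl
      simp only [Fin.val_zero, not_lt_zero] at hij'
    · simpa [T] using! Nat.le_sub_one_of_lt hij'
    · simp only [φ, Fin.castLT_castSucc, Fin.succ_pred]
  · rintro ⟨i, j⟩ hij
    have hij' : (j : ℕ) ≤ i := by simpa [T] using! hij
    rw [← neg_smul]
    congr 1
    · simp only [φ, Fin.val_succ, pow_add, pow_one, mul_neg, neg_neg, mul_one, Fin.val_castLT]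
      apply mul_comm
    · simp only [φ]
      rw [hg _ _ (by simpa [Fin.le_def] using hij')]
      rfl

theorem boundary_comp (P : BimoduleData k B M) (n : ℕ) :
    boundary P n ∘ₗ boundary P (n + 1) = 0 := by
  refine LinearMap.ext fun x => ?_
  have := alternating_sum_eq_zero (k := k) (fun i j => face P i (face P j x)) fun i j h =>
    LinearMap.congr_fun (face_face P i j h) x
  simpa [boundary, LinearMap.sum_apply, map_sum] using this

/-- Think of `m ⊗ a₀ ⊗ ⋯ ⊗ a_{n-1}` as a cyclic word with letters `x₀ = m`, `x_{i+1} = a_i`.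
`afterEnd` and `afterWord` give the cyclic word in which `x_j` is replaced by `x_j s`. -/
def afterWord (j : ℕ) (s : B) {n : ℕ} (a : Fin n → B) (i : Fin n) : B :=
  if (i : ℕ) + 1 = j then a i * s else a i

/-- See `afterWord`. -/
def afterEnd (P : BimoduleData k B M) (j : ℕ) (s : B) : M →ₗ[k] M :=
  if j = 0 then P.r s else LinearMap.id

/-- `beforeEnd` and `beforeWord` give the cyclic word in which the letter cyclically following
`x_j` is replaced by its product with `s` on the left (the letter following `x_n` is `x₀ = m`). -/
def beforeWord (j : ℕ) (s : B) {n : ℕ} (a : Fin n → B) (i : Fin n) : B :=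
  if (i : ℕ) = j then s * a i else a i

/-- See `beforeWord`. -/
def beforeEnd (P : BimoduleData k B M) (n j : ℕ) (s : B) : M →ₗ[k] M :=
  if j = n then P.l s else LinearMap.id

/-- The relations which define the cyclic tensor product `M ⊗_S (B/S) ⊗_S ⋯ ⊗_S (B/S) ⊗_S` as a
quotient of `M ⊗ B ⊗ ⋯ ⊗ B`: scalars from `S` may be moved across each of the `n + 1` tensor signs
(the last one closing the cycle), and a tensor with a letter in `S` vanishes.
For `n = 0` this is the span of the `m s - s m`. -/
def relations (P : BimoduleData k B M) (S : Subalgebra k B) (n : ℕ) :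
    Submodule k (Chains k B M n) :=
  Submodule.span k
    ({x | ∃ (j : Fin (n + 1)) (s : S) (m : M) (a : Fin n → B),
        x = elem (afterEnd P j s m) (afterWord j (s : B) a) -
          elem (beforeEnd P n j s m) (beforeWord j (s : B) a)} ∪
     {x | ∃ (m : M) (a : Fin n → B), (∃ i, a i ∈ S) ∧ x = elem m a})

theorem balance_mem (P : BimoduleData k B M) (S : Subalgebra k B) {n : ℕ} (j : ℕ) (hj : j < n + 1)
    (s : B) (hs : s ∈ S) (m : M) (a : Fin n → B) :
    elem (afterEnd P j s m) (afterWord j s a) -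
      elem (beforeEnd P n j s m) (beforeWord j s a) ∈ relations P S n :=
  Submodule.subset_span (Or.inl ⟨⟨j, hj⟩, ⟨s, hs⟩, m, a, rfl⟩)

theorem degenerate_mem (P : BimoduleData k B M) (S : Subalgebra k B) {n : ℕ} (m : M)
    (a : Fin n → B) (i : Fin n) (h : a i ∈ S) : elem m a ∈ relations P S n :=
  Submodule.subset_span (Or.inr ⟨m, a, ⟨i, h⟩, rfl⟩)

theorem face_balance (P : BimoduleData k B M) (S : Subalgebra k B) {n : ℕ} (i : Fin (n + 2))
    (j : ℕ) (hj : j < n + 2) (s : B) (hs : s ∈ S) (m : M) (a : Fin (n + 1) → B) :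
    face P i (elem (afterEnd P j s m) (afterWord j s a)) -
      face P i (elem (beforeEnd P (n + 1) j s m) (beforeWord j s a)) ∈ relations P S n := by
  obtain ⟨i, hi⟩ := i
  simp only [face_elem]
  rcases lt_trichotomy j i with h | h | h
  · convert balance_mem P S j (by omega) s hs (faceEnd P ⟨i, hi⟩ a m) (faceWord ⟨i, hi⟩ a) using 3
    · have h1 : i ≠ 0 := by omega
      rcases eq_or_ne i (n + 1) with rfl | hin
      · rcases Nat.eq_zero_or_pos j with rfl | hj0
        · by_cases hn : n = 0 <;> simp [faceEnd, afterEnd, afterWord, P.l_r]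
        · simp [faceEnd, afterEnd, afterWord, hj0.ne', h.ne']
      · simp [faceEnd, h1, hin]
    · funext ⟨q, hq⟩
      simp only [faceWord, afterWord, Fin.val_castSucc, Fin.val_succ]
      split_ifs <;> first | omega | rfl | simp [mul_assoc]
    · have h1 : i ≠ 0 := by omega
      have h2 : j ≠ n + 1 := by omega
      rcases eq_or_ne i (n + 1) with rfl | hin
      · by_cases hjn : j = n
        · simp [faceEnd, beforeEnd, beforeWord, hjn, P.l_mul]
        · simp [faceEnd, beforeEnd, beforeWord, h2, hjn, Ne.symm hjn]
      · have h3 : j ≠ n := by omega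
        simp [faceEnd, beforeEnd, h1, h2, h3, hin]
    · funext ⟨q, hq⟩
      simp only [faceWord, beforeWord, Fin.val_castSucc, Fin.val_succ]
      split_ifs <;> first | omega | rfl | simp [mul_assoc]
  · subst h
    rw [sub_eq_zero_of_eq]
    · exact Submodule.zero_mem _
    congr 1
    · rcases Nat.eq_zero_or_pos j with rfl | hj0
      · simp [faceEnd, afterEnd, beforeEnd, afterWord, beforeWord, P.r_mul]
      · rcases eq_or_ne j (n + 1) with rfl | hjn
        · simp [faceEnd, afterEnd, beforeEnd, afterWord, beforeWord, P.l_mul]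
        · simp [faceEnd, afterEnd, beforeEnd, hj0.ne', hjn]
    · funext ⟨q, hq⟩
      simp only [faceWord, beforeWord, afterWord, Fin.val_castSucc, Fin.val_succ]
      split_ifs <;> first | omega | rfl | simp [mul_assoc]
  · obtain ⟨j, rfl⟩ : ∃ t, j = t + 1 := ⟨j - 1, by omega⟩
    have h1 : i ≠ n + 1 := by omega
    convert balance_mem P S j (by omega) s hs (faceEnd P ⟨i, hi⟩ a m) (faceWord ⟨i, hi⟩ a) using 3
    · rcases Nat.eq_zero_or_pos i with rfl | hi0
      · rcases Nat.eq_zero_or_pos j with rfl | hj0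
        · simp [faceEnd, afterEnd, afterWord, P.r_mul]
        · simp [faceEnd, afterEnd, afterWord, hj0.ne']
      · have h2 : j ≠ 0 := by omega
        simp [faceEnd, afterEnd, h1, h2, hi0.ne']
    · funext ⟨q, hq⟩
      simp only [faceWord, afterWord, Fin.val_castSucc, Fin.val_succ]
      split_ifs <;> first | omega | rfl | simp [mul_assoc]
    · rcases Nat.eq_zero_or_pos i with rfl | hi0
      · rcases eq_or_ne j n with rfl | hjn
        · simp [faceEnd, beforeEnd, beforeWord, P.l_r]
        · simp [faceEnd, beforeEnd, beforeWord, hjn]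
      · by_cases h2 : j = n <;> simp [faceEnd, beforeEnd, h1, h2, hi0.ne']
    · funext ⟨q, hq⟩
      simp only [faceWord, beforeWord, Fin.val_castSucc, Fin.val_succ]
      split_ifs <;> first | omega | rfl | simp [mul_assoc]

theorem boundary_relations (P : BimoduleData k B M) (S : Subalgebra k B) (n : ℕ) :
    relations P S (n + 1) ≤ (relations P S n).comap (boundary P n) := by
  refine Submodule.span_le.2 ?_
  rintro x (⟨j, s, m, a, rfl⟩ | ⟨m, a, ⟨p, hp⟩, rfl⟩)
  · simp only [boundary, SetLike.mem_coe, Submodule.mem_comap, LinearMap.sum_apply,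
      LinearMap.smul_apply]
    refine Submodule.sum_mem _ fun i _ => Submodule.smul_mem _ _ ?_
    rw [map_sub]
    exact face_balance P S i j j.2 s s.2 m a
  · simp only [boundary, SetLike.mem_coe, Submodule.mem_comap, LinearMap.sum_apply,
      LinearMap.smul_apply]
    rw [← Submodule.Quotient.mk_eq_zero, ← Submodule.mkQ_apply, map_sum,
      Finset.sum_eq_add p.castSucc p.succ (by simp [Fin.ext_iff])]
    · have key : face P p.castSucc (elem m a) - face P p.succ (elem m a) ∈ relations P S n := by
        convert balance_mem P S p p.2 (a p) hp m (fun i => a (p.succAbove i)) using 1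
        rw [face_elem, face_elem]
        congr 2
        · obtain ⟨p, hq⟩ := p
          rcases Nat.eq_zero_or_pos p with rfl | h0
          · simp [faceEnd, afterEnd]
          · have : p ≠ n + 1 := by omega
            simp [faceEnd, afterEnd, h0.ne', this]
        · funext ⟨q, hq⟩
          obtain ⟨p, hp'⟩ := p
          simp only [faceWord, afterWord, Fin.succAbove, Fin.lt_def, Fin.val_castSucc]
          split_ifs <;> first | omega | rfl | skip
          all_goals subst_vars; rfl
        · obtain ⟨p, hq⟩ := p
          rcases eq_or_ne p n with rfl | h0
          · simp [faceEnd, beforeEnd, Fin.last]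
          · simp [faceEnd, beforeEnd, h0]
        · funext ⟨q, hq⟩
          obtain ⟨p, hp'⟩ := p
          simp only [faceWord, beforeWord, Fin.succAbove, Fin.lt_def, Fin.val_castSucc,
            Fin.val_succ]
          split_ifs <;> first | omega | rfl | skip
          all_goals subst_vars; rfl
      rw [map_smul, map_smul, Fin.val_castSucc, Fin.val_succ, pow_succ, mul_neg_one, neg_smul,
        ← sub_eq_add_neg, ← smul_sub, ← map_sub, Submodule.mkQ_apply,
        (Submodule.Quotient.mk_eq_zero _).2 key, smul_zero]
    · rintro ⟨i, hi⟩ - ⟨h1, h2⟩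
      obtain ⟨p, hp'⟩ := p
      simp only [ne_eq, Fin.ext_iff, Fin.val_castSucc, Fin.val_succ] at h1 h2
      rw [map_smul, Submodule.mkQ_apply, face_elem, (Submodule.Quotient.mk_eq_zero _).2, smul_zero]
      rcases lt_or_gt_of_ne h1 with h | h
      · refine degenerate_mem P S _ _ ⟨p - 1, by omega⟩ ?_
        simp only [faceWord]
        rw [if_neg (by omega), if_neg (by omega)]
        convert hp using 2
        simp [Fin.ext_iff]; omega
      · refine degenerate_mem P S _ _ ⟨p, by omega⟩ ?_
        simp only [faceWord]
        rw [if_pos (by omega)]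
        exact hp
    · simp
    · simp

end RelChains

/-- The cyclic tensor product `M ⊗_S (B/S) ⊗_S ⋯ ⊗_S (B/S) ⊗_S` over `S`, with `n` factors `B/S`.
If `S = ⊥` is the image of `k` in `B`, it is `M ⊗ (B/k) ⊗ ⋯ ⊗ (B/k)`. -/
abbrev RelChains {k B M : Type*} [CommRing k] [Ring B] [Algebra k B] [AddCommGroup M] [Module k M]
    (P : BimoduleData k B M) (S : Subalgebra k B) (n : ℕ) :=
  RelChains.Chains k B M n ⧸ RelChains.relations P S n

namespace RelChains

variable {k B M : Type*} [CommRing k] [Ring B] [Algebra k B] [AddCommGroup M] [Module k M]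

/-- The class in the cyclic tensor product of an element of `M ⊗ B ⊗ ⋯ ⊗ B`. -/
def mk (P : BimoduleData k B M) (S : Subalgebra k B) (n : ℕ) :
    Chains k B M n →ₗ[k] RelChains P S n := (relations P S n).mkQ

/-- The boundary induced by `b` on the cyclic tensor products. -/
def d (P : BimoduleData k B M) (S : Subalgebra k B) (n : ℕ) :
    RelChains P S (n + 1) →ₗ[k] RelChains P S n :=
  (relations P S (n + 1)).mapQ (relations P S n) (boundary P n) (boundary_relations P S n)

theorem d_comp (P : BimoduleData k B M) (S : Subalgebra k B) (n : ℕ) :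
    d P S n ∘ₗ d P S (n + 1) = 0 := by
  refine Submodule.linearMap_qext _ (LinearMap.ext fun x => ?_)
  have := LinearMap.congr_fun (boundary_comp P n) x
  simp only [LinearMap.comp_apply, LinearMap.zero_apply] at this
  simp [d, this]

/-- The chain complex `(M ⊗_S (B/S)^* ⊗_S, b)`. For `S = ⊥` it is the normalized Hochschild complex
of `B` with coefficients in `M`. -/
def complex (P : BimoduleData k B M) (S : Subalgebra k B) : ChainComplex (ModuleCat k) ℕ :=
  ChainComplex.of (fun n => ModuleCat.of k (RelChains P S n)) (fun n => ModuleCat.ofHom (d P S n))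
    fun n => by
      rw [← ModuleCat.ofHom_comp, d_comp]
      rfl

variable {M' : Type*} [AddCommGroup M'] [Module k M']

theorem rTensor_relations (P : BimoduleData k B M) (P' : BimoduleData k B M') (S : Subalgebra k B)
    (φ : M →ₗ[k] M') (hl : ∀ b m, φ (P.l b m) = P'.l b (φ m))
    (hr : ∀ b m, φ (P.r b m) = P'.r b (φ m)) (n : ℕ) :
    relations P S n ≤ (relations P' S n).comap (φ.rTensor _) := by
  refine Submodule.span_le.2 ?_
  rintro x (⟨j, s, m, a, rfl⟩ | ⟨m, a, ⟨p, hp⟩, rfl⟩)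
  · have h1 : φ (afterEnd P j (s : B) m) = afterEnd P' j (s : B) (φ m) := by
      unfold afterEnd; split_ifs <;> simp [hr]
    have h2 : φ (beforeEnd P n j (s : B) m) = beforeEnd P' n j (s : B) (φ m) := by
      unfold beforeEnd; split_ifs <;> simp [hl]
    have := balance_mem P' S j j.2 s s.2 (φ m) a
    rw [← h1, ← h2] at this
    rw [SetLike.mem_coe, Submodule.mem_comap, map_sub]
    exact this
  · exact degenerate_mem P' S (φ m) a p hp

/-- Functoriality of the cyclic tensor products in the bimodule. -/
def map (P : BimoduleData k B M) (P' : BimoduleData k B M') (S : Subalgebra k B)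
    (φ : M →ₗ[k] M') (hl : ∀ b m, φ (P.l b m) = P'.l b (φ m))
    (hr : ∀ b m, φ (P.r b m) = P'.r b (φ m)) (n : ℕ) : RelChains P S n →ₗ[k] RelChains P' S n :=
  (relations P S n).mapQ (relations P' S n) (φ.rTensor _) (rTensor_relations P P' S φ hl hr n)

theorem map_d (P : BimoduleData k B M) (P' : BimoduleData k B M') (S : Subalgebra k B)
    (φ : M →ₗ[k] M') (hl : ∀ b m, φ (P.l b m) = P'.l b (φ m))
    (hr : ∀ b m, φ (P.r b m) = P'.r b (φ m)) (n : ℕ) :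
    map P P' S φ hl hr n ∘ₗ d P S n = d P' S n ∘ₗ map P P' S φ hl hr (n + 1) := by
  refine Submodule.linearMap_qext _ (chains_ext fun m a => ?_)
  have h : ∀ j : Fin (n + 2), φ.rTensor _ (face P j (elem m a)) = face P' j (elem (φ m) a) := by
    intro j
    rw [face_elem, face_elem, elem, LinearMap.rTensor_tmul, elem]
    congr 1
    unfold faceEnd; split_ifs <;> simp [hl, hr]
  have h2 : φ.rTensor _ (elem (k := k) m a) = elem (φ m) a := rfl
  simp [map, d, boundary, h, h2]

end RelChains

/-- The Hochschild homology `H_n(B, M)`: the homology of the normalized Hochschild complex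
`(M ⊗ (B/k)^*, b)`. -/
def hochschildHomology {k : Type u} {B : Type v} {M : Type w} [CommRing k] [Ring B] [Algebra k B]
    [AddCommGroup M] [Module k M] (P : BimoduleData k B M) (n : ℕ) :
    ModuleCat.{max u v w} k :=
  (RelChains.complex P ⊥).homology n

namespace HopfHomology

variable {k : Type u} {H : Type v} [CommRing k] [Ring H] [Bialgebra k H]
  {C : ChainComplex (ModuleCat.{w} k) ℕ} (ρ : H →ₐ[k] CategoryTheory.End C)

/-- A chain complex `C` of `k`-modules with an algebra map `ρ : H → End C` is a chain complex of
left `H`-modules; this is the `H`-module structure of `C_r`. -/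
def coeff (r : ℕ) : H →ₐ[k] Module.End k (C.X r) :=
  AlgHom.ofLinearMap
    { toFun := fun h => ((ρ h).f r).hom
      map_add' := fun x y => by rw [map_add]; rfl
      map_smul' := fun c x => by rw [map_smul]; rfl }
    (by simp only [LinearMap.coe_mk, AddHom.coe_mk, map_one]; rfl)
    (fun x y => by simp only [LinearMap.coe_mk, AddHom.coe_mk, map_mul]; rfl)

/-- `C_r` as an `H`-bimodule, with trivial right action. -/
abbrev coeffBimodule (r : ℕ) : BimoduleData k H (C.X r) := BimoduleData.ofAction (coeff ρ r)

/-- The `(r, s)` spot `C_r ⊗ (H/k)^s` of the double complex computing the homology of `H` with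
coefficients in `C`. -/
abbrev bi (r s : ℕ) := RelChains (coeffBimodule ρ r) (⊥ : Subalgebra k H) s

theorem coeff_comm (r : ℕ) (h : H) (x : C.X (r + 1)) :
    (C.d (r + 1) r).hom (coeff ρ (r + 1) h x) = coeff ρ r h ((C.d (r + 1) r).hom x) :=
  LinearMap.congr_fun (congrArg ModuleCat.Hom.hom ((ρ h).comm (r + 1) r)) x

/-- The differential `C_{r+1} ⊗ (H/k)^s → C_r ⊗ (H/k)^s` induced by that of `C`. -/
def horizontal (r s : ℕ) : bi ρ (r + 1) s →ₗ[k] bi ρ r s :=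
  RelChains.map (coeffBimodule ρ (r + 1)) (coeffBimodule ρ r) ⊥ (C.d (r + 1) r).hom
    (fun h x => coeff_comm ρ r h x) (fun h x => by simp [BimoduleData.ofAction]) s

/-- The differential of the canonical complex for the homology of `H` with coefficients in the
left `H`-module `C_r`: `c ⊗ h₁ ⊗ ⋯ ⊗ h_s` goes to `ε(h₁) c ⊗ h₂ ⊗ ⋯ ⊗ h_s
+ ∑ (-1)^i c ⊗ h₁ ⊗ ⋯ ⊗ h_i h_{i+1} ⊗ ⋯ ⊗ h_s + (-1)^s h_s c ⊗ h₁ ⊗ ⋯ ⊗ h_{s-1}`. -/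
def vertical (r s : ℕ) : bi ρ r (s + 1) →ₗ[k] bi ρ r s := RelChains.d (coeffBimodule ρ r) ⊥ s

theorem horizontal_comp (r s : ℕ) : horizontal ρ r s ∘ₗ horizontal ρ (r + 1) s = 0 := by
  refine Submodule.linearMap_qext _ (RelChains.chains_ext fun m a => ?_)
  have h : (C.d (r + 1) r).hom ((C.d (r + 1 + 1) (r + 1)).hom m) = 0 := by
    have := congrArg ModuleCat.Hom.hom (C.d_comp_d (r + 1 + 1) (r + 1) r)
    exact LinearMap.congr_fun this m
  simp [horizontal, RelChains.map, RelChains.elem, h]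

theorem vertical_comp (r s : ℕ) : vertical ρ r s ∘ₗ vertical ρ r (s + 1) = 0 :=
  RelChains.d_comp _ _ s

theorem horizontal_vertical (r s : ℕ) :
    horizontal ρ r s ∘ₗ vertical ρ (r + 1) s = vertical ρ r s ∘ₗ horizontal ρ r (s + 1) :=
  RelChains.map_d _ _ _ _ _ _ s

/-- The degree `n` part of the total complex, `⨁_{r+s=n} C_r ⊗ (H/k)^s`. -/
abbrev Total (n : ℕ) := ∀ p : {p : ℕ × ℕ // p.1 + p.2 = n}, bi ρ p.1.1 p.1.2

/-- The differential of the total complex: horizontal plus `(-1)^r` times vertical. -/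
def totalD (n : ℕ) : Total ρ (n + 1) →ₗ[k] Total ρ n :=
  LinearMap.pi fun p =>
    horizontal ρ p.1.1 p.1.2 ∘ₗ
        LinearMap.proj (⟨(p.1.1 + 1, p.1.2), by have := p.2; simp only; omega⟩ :
          {q : ℕ × ℕ // q.1 + q.2 = n + 1}) +
      (-1 : k) ^ p.1.1 • (vertical ρ p.1.1 p.1.2 ∘ₗ
        LinearMap.proj (⟨(p.1.1, p.1.2 + 1), by have := p.2; simp only; omega⟩ :
          {q : ℕ × ℕ // q.1 + q.2 = n + 1}))

theorem totalD_comp (n : ℕ) : totalD ρ n ∘ₗ totalD ρ (n + 1) = 0 := by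
  refine LinearMap.ext fun x => funext fun p => ?_
  have hh := fun r s y => LinearMap.congr_fun (horizontal_comp ρ r s) y
  have vv := fun r s y => LinearMap.congr_fun (vertical_comp ρ r s) y
  have hv := fun r s y => LinearMap.congr_fun (horizontal_vertical ρ r s) y
  simp only [LinearMap.comp_apply, LinearMap.zero_apply] at hh vv hv
  simp [totalD, hh, vv, hv, pow_succ]

/-- The total complex of the double complex `C_r ⊗ (H/k)^s`. -/
def total : ChainComplex (ModuleCat.{max u v w} k) ℕ :=
  ChainComplex.of (fun n => ModuleCat.of k (Total ρ n)) (fun n => ModuleCat.ofHom (totalD ρ n))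
    fun n => by
      rw [← ModuleCat.ofHom_comp, totalD_comp]
      rfl

end HopfHomology

/-- The homology of `H` with coefficients in the chain complex of left `H`-modules `(C, ρ)`. -/
def hopfHomology {k : Type u} {H : Type v} [CommRing k] [Ring H] [Bialgebra k H]
    {C : ChainComplex (ModuleCat.{w} k) ℕ} (ρ : H →ₐ[k] CategoryTheory.End C) (n : ℕ) :
    ModuleCat.{max u v w} k :=
  (HopfHomology.total ρ).homology n

/-- A `k`-algebra `S` is separable if it has a separability idempotent: `e ∈ S ⊗ S` which
multiplies to `1` and satisfies `s e = e s` for all `s`. Equivalently, `S` is a projective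
`S ⊗ S^op`-module. -/
def IsSeparableAlgebra (k S : Type*) [CommRing k] [Ring S] [Algebra k S] : Prop :=
  ∃ e : S ⊗[k] S, LinearMap.mul' k S e = 1 ∧
    ∀ s : S, (LinearMap.mulLeft k s).rTensor S e = (LinearMap.mulRight k s).lTensor S e

/-- A weak action of the Hopf algebra `H` on the algebra `A`; `act h a` is written `a^h`. The laws
are `(ab)^h = a^{h⁽¹⁾} b^{h⁽²⁾}`, `1^h = ε(h) 1` and `a^1 = a`. -/
structure WeakAction (k A H : Type*) [CommRing k] [Ring A] [Algebra k A] [Ring H]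
    [HopfAlgebra k H] where
  act : H →ₗ[k] A →ₗ[k] A
  act_mul : ∀ h a b, act h (a * b) =
    LinearMap.mul' k A (TensorProduct.map (act.flip a) (act.flip b) (Coalgebra.comul h))
  act_one : ∀ h, act h 1 = Coalgebra.counit (R := k) h • (1 : A)
  one_act : ∀ a, act 1 a = a

namespace WeakAction

variable {k A H : Type*} [CommRing k] [Ring A] [Algebra k A] [Ring H] [HopfAlgebra k H]

/-- `h ⊗ l ↦ f(h⁽¹⁾, l⁽¹⁾) ⊗ h⁽²⁾ l⁽²⁾`. -/
def cocycleProd (f : H ⊗[k] H →ₗ[k] A) : H ⊗[k] H →ₗ[k] A ⊗[k] H :=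
  TensorProduct.map f (LinearMap.mul' k H) ∘ₗ
    (TensorProduct.tensorTensorTensorComm k H H H H).toLinearMap ∘ₗ
      TensorProduct.map Coalgebra.comul Coalgebra.comul

/-- `x ⊗ y ↦ a b^x f(y⁽¹⁾, l⁽¹⁾) ⊗ y⁽²⁾ l⁽²⁾`. -/
def crossedAux (α : WeakAction k A H) (f : H ⊗[k] H →ₗ[k] A) (a b : A) (l : H) :
    H ⊗[k] H →ₗ[k] A ⊗[k] H :=
  TensorProduct.lift <| LinearMap.mk₂ k
    (fun x y => (a * α.act x b) • cocycleProd f (y ⊗ₜ l))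
    (fun x x' y => by simp only [map_add, LinearMap.add_apply, mul_add, add_smul])
    (fun c x y => by simp only [map_smul, LinearMap.smul_apply, mul_smul_comm, smul_assoc])
    (fun x y y' => by simp only [TensorProduct.add_tmul, map_add, smul_add])
    (fun c x y => by
      rw [← TensorProduct.smul_tmul', map_smul, smul_comm])

theorem crossedAux_tmul (α : WeakAction k A H) (f : H ⊗[k] H →ₗ[k] A) (a b : A) (l x y : H) :
    crossedAux α f a b l (x ⊗ₜ y) = (a * α.act x b) • cocycleProd f (y ⊗ₜ l) := rfl

/-- The multiplication of `A #_f H` on `A ⊗ H`: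
`(a ⊗ h)(b ⊗ l) = a b^{h⁽¹⁾} f(h⁽²⁾, l⁽¹⁾) ⊗ h⁽³⁾ l⁽²⁾`. -/
def crossedMul (α : WeakAction k A H) (f : H ⊗[k] H →ₗ[k] A) :
    A ⊗[k] H →ₗ[k] A ⊗[k] H →ₗ[k] A ⊗[k] H :=
  TensorProduct.lift <| LinearMap.mk₂ k
    (fun a h => TensorProduct.lift <| LinearMap.mk₂ k
      (fun b l => crossedAux α f a b l (Coalgebra.comul h))
      (fun b b' l => by
        rw [← LinearMap.add_apply]; congr 1
        ext; simp [crossedAux_tmul, mul_add, add_smul])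
      (fun c b l => by
        rw [← LinearMap.smul_apply]; congr 1
        ext; simp [crossedAux_tmul, smul_assoc])
      (fun b l l' => by
        rw [← LinearMap.add_apply]; congr 1
        ext; simp [crossedAux_tmul, TensorProduct.tmul_add])
      (fun c b l => by
        rw [← LinearMap.smul_apply]; congr 1
        refine TensorProduct.ext' fun x y => ?_
        rw [LinearMap.smul_apply, crossedAux_tmul, crossedAux_tmul, TensorProduct.tmul_smul,
          map_smul, smul_comm]))
    (fun a a' h => by
      ext b l
      simp only [TensorProduct.AlgebraTensorModule.curry_apply, TensorProduct.curry_apply,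
        LinearMap.restrictScalars_self, TensorProduct.lift.tmul, LinearMap.mk₂_apply,
        LinearMap.add_apply]
      rw [← LinearMap.add_apply]; congr 1
      ext; simp [crossedAux_tmul, add_mul, add_smul])
    (fun c a h => by
      ext b l
      simp only [TensorProduct.AlgebraTensorModule.curry_apply, TensorProduct.curry_apply,
        LinearMap.restrictScalars_self, TensorProduct.lift.tmul, LinearMap.mk₂_apply,
        LinearMap.smul_apply]
      rw [← LinearMap.smul_apply]; congr 1
      ext; simp [crossedAux_tmul, smul_assoc])
    (fun a h h' => by ext b l; simp)
    (fun c a h => by ext b l; simp)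

theorem crossedMul_tmul (α : WeakAction k A H) (f : H ⊗[k] H →ₗ[k] A) (a b : A) (h l : H) :
    crossedMul α f (a ⊗ₜ h) (b ⊗ₜ l) = crossedAux α f a b l (Coalgebra.comul h) := rfl

end WeakAction

/-- A weak action of `H` on `A` together with a linear map `f : H ⊗ H → A` such that `A #_f H` is a
crossed product, that is, associative with `1 # 1` as identity element. -/
structure CrossedSystem (k A H : Type*) [CommRing k] [Ring A] [Algebra k A] [Ring H]
    [HopfAlgebra k H] extends WeakAction k A H where
  f : H ⊗[k] H →ₗ[k] A
  crossed_assoc : ∀ x y z : A ⊗[k] H,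
    toWeakAction.crossedMul f (toWeakAction.crossedMul f x y) z =
      toWeakAction.crossedMul f x (toWeakAction.crossedMul f y z)
  crossed_one_mul : ∀ x : A ⊗[k] H, toWeakAction.crossedMul f (1 ⊗ₜ 1) x = x
  crossed_mul_one : ∀ x : A ⊗[k] H, toWeakAction.crossedMul f x (1 ⊗ₜ 1) = x

/-- The crossed product `E = A #_f H`, with underlying module `A ⊗ H`. -/
def CrossedProduct {k A H : Type*} [CommRing k] [Ring A] [Algebra k A] [Ring H]
    [HopfAlgebra k H] (_X : CrossedSystem k A H) : Type _ := A ⊗[k] H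

namespace CrossedProduct

variable {k A H : Type*} [CommRing k] [Ring A] [Algebra k A] [Ring H] [HopfAlgebra k H]
  (X : CrossedSystem k A H)

instance : AddCommGroup (CrossedProduct X) := inferInstanceAs (AddCommGroup (A ⊗[k] H))

instance : Module k (CrossedProduct X) := inferInstanceAs (Module k (A ⊗[k] H))

/-- The element `a # h` of `A #_f H`. -/
def tmul (a : A) (h : H) : CrossedProduct X := a ⊗ₜ[k] h

instance : Ring (CrossedProduct X) :=
  { (inferInstance : AddCommGroup (CrossedProduct X)) with
    mul := fun x y => X.toWeakAction.crossedMul X.f x y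
    one := tmul X 1 1
    mul_assoc := X.crossed_assoc
    one_mul := X.crossed_one_mul
    mul_one := X.crossed_mul_one
    left_distrib := fun x y z => map_add (X.toWeakAction.crossedMul X.f x) y z
    right_distrib := fun x y z =>
      LinearMap.congr_fun (map_add (X.toWeakAction.crossedMul X.f) x y) z
    zero_mul := fun x => LinearMap.congr_fun (map_zero (X.toWeakAction.crossedMul X.f)) x
    mul_zero := fun x => map_zero (X.toWeakAction.crossedMul X.f x) }

theorem mul_def (x y : CrossedProduct X) : x * y = X.toWeakAction.crossedMul X.f x y := rfl

instance : Algebra k (CrossedProduct X) :=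
  Algebra.ofModule
    (fun c x y => LinearMap.congr_fun (map_smul (X.toWeakAction.crossedMul X.f) c x) y)
    (fun c x y => map_smul (X.toWeakAction.crossedMul X.f x) c y)

theorem f_one_one : X.f (1 ⊗ₜ 1) = 1 := by
  have h : X.toWeakAction.crossedMul X.f (1 ⊗ₜ 1) (1 ⊗ₜ 1) = (1 : A) ⊗ₜ[k] (1 : H) := X.crossed_one_mul _
  rw [WeakAction.crossedMul_tmul, Bialgebra.comul_one, Algebra.TensorProduct.one_def,
    WeakAction.crossedAux_tmul, X.one_act] at h
  have h2 := congrArg (TensorProduct.rid k A ∘ (Coalgebra.counit (R := k) (A := H)).lTensor A) h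
  simpa [WeakAction.cocycleProd, Algebra.TensorProduct.one_def] using h2

/-- The inclusion `a ↦ a # 1` of `A` into `E`. -/
def inclA : A →ₐ[k] CrossedProduct X :=
  AlgHom.ofLinearMap ((TensorProduct.mk k A H).flip 1) rfl fun a b => by
    change (a * b) ⊗ₜ[k] (1 : H) = X.toWeakAction.crossedMul X.f (a ⊗ₜ 1) (b ⊗ₜ 1)
    rw [WeakAction.crossedMul_tmul, Bialgebra.comul_one, Algebra.TensorProduct.one_def,
      WeakAction.crossedAux_tmul, X.one_act]
    simp [WeakAction.cocycleProd, Algebra.TensorProduct.one_def, f_one_one,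
      TensorProduct.smul_tmul']

/-- The map `h ↦ 1 # h`. -/
def inclH : H →ₗ[k] CrossedProduct X := TensorProduct.mk k A H 1

/-- The convolution inverse `f⁻¹` of `f` (when `f` is convolution invertible). -/
def fInv : H ⊗[k] H →ₗ[k] A := (Ring.inverse (WithConv.toConv X.f)).ofConv

/-- The map `h ↦ (1 # h)⁻¹ = f⁻¹(S(h⁽²⁾), h⁽³⁾) # S(h⁽¹⁾)`, the convolution inverse of `h ↦ 1 # h`. -/
def inclHInv : H →ₗ[k] CrossedProduct X :=
  (TensorProduct.comm k H A).toLinearMap ∘ₗ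
    TensorProduct.map (HopfAlgebra.antipode k) (fInv X ∘ₗ (HopfAlgebra.antipode k).rTensor H) ∘ₗ
      Coalgebra.comul.lTensor H ∘ₗ Coalgebra.comul

/-- The iterated comultiplication `h ↦ h⁽¹⁾ ⊗ ⋯ ⊗ h⁽ⁿ⁾`, which is `ε` for `n = 0`. -/
def iterComul (k : Type*) {H : Type*} [CommRing k] [Ring H] [Bialgebra k H] :
    (n : ℕ) → H →ₗ[k] ⨂[k] _ : Fin n, H
  | 0 => Coalgebra.counit.smulRight (PiTensorProduct.tprod k fun i : Fin 0 => i.elim0)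
  | n + 1 => TensorProduct.lift
      (PiTensorProduct.lift.toLinearMap ∘ₗ
        (PiTensorProduct.tprod k : MultilinearMap k (fun _ : Fin (n + 1) => H) _).curryLeft) ∘ₗ
      (iterComul k n).lTensor H ∘ₗ Coalgebra.comul

/-- `h ↦ (a₁ ⊗ ⋯ ⊗ aₙ ↦ a₁^{h⁽¹⁾} ⊗ ⋯ ⊗ aₙ^{h⁽ⁿ⁾})`. -/
def diag (α : WeakAction k A H) (n : ℕ) : H →ₗ[k] Module.End k (⨂[k] _ : Fin n, A) :=
  PiTensorProduct.map₂ (fun _ => α.act) ∘ₗ iterComul k n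

/-- `x ⊗ z ↦ (m ↦ (1 # z) m (1 # x)⁻¹)`. -/
def conj {M : Type*} [AddCommGroup M] [Module k M] (P : BimoduleData k (CrossedProduct X) M) :
    H ⊗[k] H →ₗ[k] Module.End k M :=
  LinearMap.mul' k (Module.End k M) ∘ₗ
    TensorProduct.map (P.l ∘ₗ inclH X) (P.r ∘ₗ inclHInv X) ∘ₗ
      (TensorProduct.comm k H H).toLinearMap

/-- `h ↦ (m ⊗ a ↦ (1 # h⁽³⁾) m (1 # h⁽¹⁾)⁻¹ ⊗ a^{h⁽²⁾})` on `M ⊗ A ⊗ ⋯ ⊗ A`. -/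
def twist {M : Type*} [AddCommGroup M] [Module k M] (P : BimoduleData k (CrossedProduct X) M)
    (n : ℕ) : H →ₗ[k] Module.End k (RelChains.Chains k A M n) :=
  TensorProduct.homTensorHomMap (RingHom.id k) M _ M _ ∘ₗ
    TensorProduct.map (conj X P) (diag X.toWeakAction n) ∘ₗ
      (TensorProduct.comm k H (H ⊗[k] H)).toLinearMap ∘ₗ
        (TensorProduct.leftComm k H H H).toLinearMap ∘ₗ
          Coalgebra.comul.lTensor H ∘ₗ Coalgebra.comul

section Bimodule

variable (M : Type*) [AddCommGroup M] [Module k M] [Module (CrossedProduct X) M]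
  [Module (CrossedProduct X)ᵐᵒᵖ M] [IsScalarTower k (CrossedProduct X) M]
  [IsScalarTower k (CrossedProduct X)ᵐᵒᵖ M] [SMulCommClass (CrossedProduct X) (CrossedProduct X)ᵐᵒᵖ M]

/-- The `E`-bimodule `M`. -/
abbrev bimod : BimoduleData k (CrossedProduct X) M := BimoduleData.ofModule

/-- The `E`-bimodule `M`, considered as an `A`-bimodule. -/
abbrev bimodA : BimoduleData k A M := (bimod X M).restrict (inclA X)

/-- The chain complex `(M ⊗_S (A/S)^* ⊗_S, b)`. -/
abbrev cyclicComplex (S : Subalgebra k A) := RelChains.complex (bimodA X M) S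

end Bimodule

end CrossedProduct

end

/-! The proof is by dimension shifting in the bimodule `M`. Let `E ⊗ M` carry left multiplication on
`E` and the right action on `M`, and let `K` be the kernel of the multiplication `E ⊗ M → M`. A
separability idempotent `∑ e' ⊗ e''` of `S` gives the section `m ↦ ∑ e' ⊗ e'' m`, which is linear
over `S` on both sides (`BimoduleData.exists_section`). Therefore `0 → K → E ⊗ M → M → 0` induces
degreewise split exact sequences both of normalized Hochschild complexes and of the total complexes
built from the cyclic tensor products over `S` (`splitExact`, `splitExactHopf`). If both complexes
of `E ⊗ M` are exact in positive degrees, then in both theories `H_{n+2}(M) ≅ H_{n+1}(K)`, while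
`H_1(M)` is the kernel of `H_0(K) → H_0(E ⊗ M)`. In both theories `H_0(M)` is `M / [E, M]`
(`presents`, `presents_hopfD`), so induction finishes the argument.

Exactness for `E ⊗ M` comes from one homotopy: if the coefficients are `B ⊗ V` with `B` multiplying
on the left and acting on `V` from the right, then `(x ⊗ w) ⊗ a ↦ (1 ⊗ w) ⊗ a ⊗ x` contracts the
complex onto `V` (`LeftFree`). It applies directly to the Hochschild complex. On the other side `E ⊗
M = A ⊗ (H ⊗ M)` is left free over `A`, so each row of the double complex resolves a term of the
complex for `H` with coefficients in `H ⊗ M`. The coaction of `H` on `E`, combined with right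
multiplication, makes the action on `H ⊗ M` plain left multiplication. This is left free over `H`,
and the same homotopy applies again (`acyclic_hopfD_free`).

The action of `H` is handled by reading a chain as a word. The element `h · (m ⊗ a₁ ⊗ ⋯ ⊗ a_r)` is a
multilinear expression evaluated on the iterated comultiplication of `h`, with letters `(1 # h)⁻¹`,
`a_i^h`, `1 # h` in the convolution algebra `Hom(H, E)`. By coassociativity a face multiplies
adjacent letters by convolution, so compatibility with the boundary reduces to identities there. For
the product of two elements of `H` the letters are functions on `H ⊗ H`. A letter `f` is inserted
into the word and pushed past the `a_i`; since `f` takes values in `S`, its two adjacent faces agree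
in the cyclic tensor product (`twist_mul`).

These identities require `h ↦ (1 # h)⁻¹` to be a two-sided convolution inverse. The left inverse is
a direct computation with `f⁻¹`; the right inverse follows from the left one by a coinvariance
argument (`convHInv_mul_convH`, `convH_mul_convHInv`). -/

noncomputable section

/-! ### Homology of a sequence of modules, and dimension shifting -/

namespace SeqHomology

variable {k : Type*} [CommRing k]

section Basic

variable {C : ℕ → Type*} [∀ n, AddCommGroup (C n)] [∀ n, Module k (C n)]

/-- The cycles of a sequence of modules and maps `d n : C (n + 1) → C n`. -/
def cycles (d : ∀ n, C (n + 1) →ₗ[k] C n) : ∀ n, Submodule k (C n)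
  | 0 => ⊤
  | n + 1 => LinearMap.ker (d n)

/-- The homology of a sequence of modules and maps `d n : C (n + 1) → C n`. -/
abbrev Homology (d : ∀ n, C (n + 1) →ₗ[k] C n) (n : ℕ) :=
  cycles d n ⧸ (LinearMap.range (d n)).comap (cycles d n).subtype

end Basic

open CategoryTheory in
/-- The homology of `ChainComplex.of` in terms of cycles and boundaries. -/
theorem nonempty_homology_equiv {k : Type u} [CommRing k] {C : ℕ → Type v}
    [∀ n, AddCommGroup (C n)] [∀ n, Module k (C n)] (d : ∀ n, C (n + 1) →ₗ[k] C n)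
    (sq : ∀ n, ModuleCat.ofHom (d (n + 1)) ≫ ModuleCat.ofHom (d n) = 0) (n : ℕ) :
    Nonempty ((ChainComplex.of (fun n => ModuleCat.of k (C n)) (fun n => ModuleCat.ofHom (d n))
      sq).homology n ≃ₗ[k] Homology d n) := by
  set K := ChainComplex.of (fun n => ModuleCat.of k (C n)) (fun n => ModuleCat.ofHom (d n)) sq
    with hK
  -- The neighbouring degrees `i` and `l` stay variable because the successor of degree `0` in
  -- `ComplexShape.down ℕ` is `0` itself, where the differential is zero and its kernel is
  -- everything.
  have key : ∀ i l : ℕ, (ComplexShape.down ℕ).prev n = i → (ComplexShape.down ℕ).next n = l →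
      LinearMap.ker (K.d n l).hom = cycles d n →
      LinearMap.range (K.d i n).hom = LinearMap.range (d n) →
      Nonempty (K.homology n ≃ₗ[k] Homology d n) := by
    intro i l hi hl h1 h2
    let e1 : K.homology n ≅ ModuleCat.of k (LinearMap.ker (K.d n l).hom ⧸
        LinearMap.range (K.sc' i n l).moduleCatToCycles) :=
      ShortComplex.homologyMapIso (K.isoSc' i n l hi hl) ≪≫ (K.sc' i n l).moduleCatHomologyIso
    let e2 : (LinearMap.ker (K.d n l).hom ⧸ LinearMap.range (K.sc' i n l).moduleCatToCycles) ≃ₗ[k]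
        Homology d n := by
      refine Submodule.Quotient.equiv _ _ (LinearEquiv.ofEq _ _ h1) ?_
      ext ⟨x, hx⟩
      simp only [LinearMap.mem_range, Submodule.mem_comap]
      have h3 : x ∈ LinearMap.range (K.d i n).hom ↔ x ∈ LinearMap.range (d n) := by rw [h2]
      constructor
      · rintro ⟨_, ⟨y, rfl⟩, h⟩
        have h4 : (K.d i n).hom y = x := congrArg Subtype.val h
        exact h3.1 ⟨y, h4⟩
      · intro h
        obtain ⟨y, hy⟩ := h3.2 h
        refine ⟨_, ⟨y, rfl⟩, ?_⟩
        exact Subtype.ext hy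
    exact ⟨e1.toLinearEquiv.trans e2⟩
  have hof : (K.d (n + 1) n) = ModuleCat.ofHom (d n) :=
      ChainComplex.of_d (fun n => ModuleCat.of k (C n)) (fun n => ModuleCat.ofHom (d n)) n
  rcases n with _ | n
  · refine key 1 0 (by simp) (by simp) ?_ (by rw [hof]; rfl)
    rw [K.shape 0 0 (by simp)]
    exact LinearMap.ker_zero
  · refine key (n + 2) n (by simp) (by simp) ?_ (by rw [hof]; rfl)
    have : K.d (n + 1) n = ModuleCat.ofHom (d n) :=
      ChainComplex.of_d (fun n => ModuleCat.of k (C n)) (fun n => ModuleCat.ofHom (d n)) n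
    rw [this]
    rfl

/-- Exactness in positive degrees. -/
def Acyclic {C : ℕ → Type*} [∀ n, AddCommGroup (C n)] [∀ n, Module k (C n)]
    (d : ∀ n, C (n + 1) →ₗ[k] C n) : Prop :=
  ∀ n x, d n x = 0 → ∃ y, d (n + 1) y = x

section Shift

variable {A B C : ℕ → Type*} [∀ n, AddCommGroup (A n)] [∀ n, Module k (A n)]
  [∀ n, AddCommGroup (B n)] [∀ n, Module k (B n)] [∀ n, AddCommGroup (C n)] [∀ n, Module k (C n)]

/-- A degreewise split short exact sequence of complexes. -/
structure SplitExact (dA : ∀ n, A (n + 1) →ₗ[k] A n) (dB : ∀ n, B (n + 1) →ₗ[k] B n)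
    (dC : ∀ n, C (n + 1) →ₗ[k] C n) where
  ι : ∀ n, A n →ₗ[k] B n
  π : ∀ n, B n →ₗ[k] C n
  τ : ∀ n, B n →ₗ[k] A n
  σ : ∀ n, C n →ₗ[k] B n
  ι_d : ∀ n x, ι n (dA n x) = dB n (ι (n + 1) x)
  π_d : ∀ n x, π n (dB n x) = dC n (π (n + 1) x)
  τ_ι : ∀ n x, τ n (ι n x) = x
  π_ι : ∀ n x, π n (ι n x) = 0
  π_σ : ∀ n x, π n (σ n x) = x
  add : ∀ n x, ι n (τ n x) + σ n (π n x) = x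
  dB_dB : ∀ n x, dB n (dB (n + 1) x) = 0

namespace SplitExact

variable {dA : ∀ n, A (n + 1) →ₗ[k] A n} {dB : ∀ n, B (n + 1) →ₗ[k] B n}
    {dC : ∀ n, C (n + 1) →ₗ[k] C n} (E : SplitExact dA dB dC)

include E in
theorem ι_injective (n : ℕ) : Function.Injective (E.ι n) := fun x y h => by
  rw [← E.τ_ι n x, h, E.τ_ι]

theorem ι_τ (n : ℕ) (x : B n) (h : E.π n x = 0) : E.ι n (E.τ n x) = x := by
  have := E.add n x
  rwa [h, map_zero, add_zero] at this

/-- The elements of `B` whose boundary lies in `A`. -/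
def liftable (n : ℕ) : Submodule k (B (n + 1)) := LinearMap.ker (E.π n ∘ₗ dB n)

theorem mem_liftable (n : ℕ) (b : B (n + 1)) : b ∈ E.liftable n ↔ E.π n (dB n b) = 0 := Iff.rfl

/-- The projection of the liftable elements to the homology of `C`. -/
def toC (n : ℕ) : E.liftable n →ₗ[k] Homology dC (n + 1) :=
  Submodule.mkQ _ ∘ₗ LinearMap.codRestrict (cycles dC (n + 1)) (E.π (n + 1) ∘ₗ Submodule.subtype _)
    fun b => by
      have := b.2
      rw [mem_liftable, E.π_d] at this
      exact this

theorem τ_mem (n : ℕ) (b : E.liftable n) : E.τ n (dB n b) ∈ cycles dA n := by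
  rcases n with _ | n
  · trivial
  · refine LinearMap.mem_ker.2 (E.ι_injective n ?_)
    rw [E.ι_d, E.ι_τ _ _ b.2, E.dB_dB, map_zero]

/-- The boundary of the liftable elements in the homology of `A`. -/
def toA (n : ℕ) : E.liftable n →ₗ[k] Homology dA n :=
  Submodule.mkQ _ ∘ₗ LinearMap.codRestrict (cycles dA n) (E.τ n ∘ₗ dB n ∘ₗ Submodule.subtype _)
    fun b => E.τ_mem n b

theorem toC_surjective (n : ℕ) : Function.Surjective (E.toC n) := by
  intro x
  obtain ⟨⟨x, hx⟩, rfl⟩ := Submodule.mkQ_surjective _ x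
  refine ⟨⟨E.σ _ x, ?_⟩, ?_⟩
  · rw [mem_liftable, E.π_d, E.π_σ]; exact hx
  · simp only [toC, LinearMap.comp_apply]
    congr 1
    exact Subtype.ext (E.π_σ _ _)

/-- The connecting map is obtained from two projections of `liftable`, to the homology of `C` and to
that of `A`, without choosing lifts. This kernel and that of `toA` have the same description, so the
two images are isomorphic. -/
theorem ker_toC (n : ℕ) (b : E.liftable n) :
    E.toC n b = 0 ↔ ∃ a y, (b : B (n + 1)) = E.ι (n + 1) a + dB (n + 1) y := by
  simp only [toC, LinearMap.comp_apply, Submodule.mkQ_apply, Submodule.Quotient.mk_eq_zero,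
    Submodule.mem_comap, LinearMap.mem_range]
  constructor
  · rintro ⟨c, hc⟩
    refine ⟨E.τ _ (b - dB _ (E.σ _ c)), E.σ _ c, ?_⟩
    rw [E.ι_τ, sub_add_cancel]
    rw [map_sub, E.π_d, E.π_σ, hc, sub_eq_zero]
    rfl
  · rintro ⟨a, y, h⟩
    refine ⟨E.π _ y, ?_⟩
    change _ = E.π _ (b : B (n + 1))
    rw [h, map_add, E.π_ι, zero_add, E.π_d]

/-- If the boundary of `b` is the image of a boundary `dA a`, then `b - ι a` is a cycle of `B`,
hence a boundary. This is where acyclicity enters; the converse holds without it. -/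
theorem ker_toA (hB : Acyclic dB) (n : ℕ) (b : E.liftable n) :
    E.toA n b = 0 ↔ ∃ a y, (b : B (n + 1)) = E.ι (n + 1) a + dB (n + 1) y := by
  simp only [toA, LinearMap.comp_apply, Submodule.mkQ_apply, Submodule.Quotient.mk_eq_zero,
    Submodule.mem_comap, LinearMap.mem_range]
  constructor
  · rintro ⟨a, ha⟩
    replace ha : dA n a = E.τ n (dB n b) := ha
    have h : dB n (b - E.ι _ a) = 0 := by
      rw [map_sub, ← E.ι_d, ha, E.ι_τ _ _ b.2, sub_self]
    obtain ⟨y, hy⟩ := hB _ _ h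
    exact ⟨a, y, by rw [hy]; abel⟩
  · rintro ⟨a, y, h⟩
    refine ⟨a, ?_⟩
    change _ = E.τ n (dB n (b : B (n + 1)))
    rw [h, map_add, E.dB_dB, add_zero, ← E.ι_d, E.τ_ι]

/-- Exactness at the homology of `A`: a class is hit by the connecting map exactly when it dies in
`B`. -/
theorem mem_range_toA (n : ℕ) (a : cycles dA n) :
    Submodule.mkQ _ a ∈ LinearMap.range (E.toA n) ↔ E.ι n a ∈ LinearMap.range (dB n) := by
  constructor
  · rintro ⟨b, hb⟩
    simp only [toA, LinearMap.comp_apply, Submodule.mkQ_apply, Submodule.Quotient.eq,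
      Submodule.mem_comap, LinearMap.mem_range] at hb
    obtain ⟨y, hy⟩ := hb
    replace hy : dA n y = E.τ n (dB n b) - a := hy
    refine ⟨b - E.ι _ y, ?_⟩
    rw [map_sub, ← E.ι_d, hy, map_sub, E.ι_τ _ _ b.2, sub_sub_cancel]
  · rintro ⟨b, hb⟩
    refine ⟨⟨b, ?_⟩, ?_⟩
    · rw [mem_liftable, hb, E.π_ι]
    · simp only [toA, LinearMap.comp_apply]
      congr 1
      refine Subtype.ext ?_
      change E.τ n (dB n b) = a
      rw [hb, E.τ_ι]

/-- The connecting isomorphism onto its image. -/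
theorem nonempty_equiv_range (hB : Acyclic dB) (n : ℕ) :
    Nonempty (Homology dC (n + 1) ≃ₗ[k] LinearMap.range (E.toA n)) := by
  refine ⟨((E.toC n).quotKerEquivOfSurjective (E.toC_surjective n)).symm.trans
    ((Submodule.quotEquivOfEq _ _ ?_).trans (E.toA n).quotKerEquivRange)⟩
  ext b
  rw [LinearMap.mem_ker, LinearMap.mem_ker, E.ker_toC, E.ker_toA hB]

-- In positive degree every cycle of `A` becomes a boundary in `B`, so the connecting map is onto.
include E in
theorem nonempty_equiv_succ (hB : Acyclic dB) (n : ℕ) :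
    Nonempty (Homology dC (n + 2) ≃ₗ[k] Homology dA (n + 1)) := by
  obtain ⟨e⟩ := E.nonempty_equiv_range hB (n + 1)
  refine ⟨e.trans (LinearEquiv.ofTop _ (Submodule.eq_top_iff'.2 fun x => ?_))⟩
  obtain ⟨⟨a, ha⟩, rfl⟩ := Submodule.mkQ_surjective _ x
  refine (E.mem_range_toA _ _).2 ?_
  obtain ⟨y, hy⟩ := hB n (E.ι _ a) (by
    rw [← E.ι_d, LinearMap.mem_ker.1 ha, map_zero])
  exact ⟨y, hy⟩

end SplitExact

end Shift

section Presentation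

variable {C : ℕ → Type*} [∀ n, AddCommGroup (C n)] [∀ n, Module k (C n)]

/-- `κ : M → C 0` induces an isomorphism of `M / R` with the homology in degree zero. -/
structure Presents (d : ∀ n, C (n + 1) →ₗ[k] C n) {M : Type*} [AddCommGroup M] [Module k M]
    (R : Submodule k M) (κ : M →ₗ[k] C 0) : Prop where
  surj : ∀ c, ∃ m, c - κ m ∈ LinearMap.range (d 0)
  ker : ∀ m, κ m ∈ LinearMap.range (d 0) ↔ m ∈ R

/-- The map to the homology in degree zero. -/
def toZero (d : ∀ n, C (n + 1) →ₗ[k] C n) : C 0 →ₗ[k] Homology d 0 :=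
  Submodule.mkQ _ ∘ₗ LinearMap.codRestrict (cycles d 0) LinearMap.id fun _ => trivial

theorem toZero_eq_zero (d : ∀ n, C (n + 1) →ₗ[k] C n) (x : C 0) :
    toZero d x = 0 ↔ x ∈ LinearMap.range (d 0) := by
  simp only [toZero, LinearMap.comp_apply, Submodule.mkQ_apply, Submodule.Quotient.mk_eq_zero,
    Submodule.mem_comap]
  rfl

theorem toZero_surjective (d : ∀ n, C (n + 1) →ₗ[k] C n) : Function.Surjective (toZero d) := by
  intro x
  obtain ⟨x, rfl⟩ := Submodule.mkQ_surjective _ x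
  exact ⟨x, rfl⟩

theorem Presents.nonempty_equiv {d : ∀ n, C (n + 1) →ₗ[k] C n} {M : Type*} [AddCommGroup M]
    [Module k M] {R : Submodule k M} {κ : M →ₗ[k] C 0} (h : Presents d R κ) :
    Nonempty (Homology d 0 ≃ₗ[k] M ⧸ R) := by
  have hs : Function.Surjective (toZero d ∘ₗ κ) := by
    intro x
    obtain ⟨x, rfl⟩ := toZero_surjective d x
    obtain ⟨m, hm⟩ := h.surj x
    refine ⟨m, ?_⟩
    rw [← toZero_eq_zero, map_sub, sub_eq_zero] at hm
    exact hm.symm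
  refine ⟨(LinearMap.quotKerEquivOfSurjective _ hs).symm.trans (Submodule.quotEquivOfEq _ _ ?_)⟩
  ext m
  rw [LinearMap.mem_ker, LinearMap.comp_apply, toZero_eq_zero, h.ker]

/-- Degree zero of `B` need not be acyclic, so `H_1(C)` is only the kernel of `H_0(A) → H_0(B)`.
Expressing this kernel through presentations makes it depend on `φ`, `RK` and `RL` alone, so two
theories with the same presentations have isomorphic `H_1`. -/
theorem SplitExact.nonempty_equiv_one {A B : ℕ → Type*} [∀ n, AddCommGroup (A n)]
    [∀ n, Module k (A n)] [∀ n, AddCommGroup (B n)] [∀ n, Module k (B n)]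
    {dA : ∀ n, A (n + 1) →ₗ[k] A n} {dB : ∀ n, B (n + 1) →ₗ[k] B n}
    {dC : ∀ n, C (n + 1) →ₗ[k] C n} (E : SplitExact dA dB dC) (hB : Acyclic dB)
    {K L : Type*} [AddCommGroup K] [Module k K] [AddCommGroup L] [Module k L]
    {RK : Submodule k K} {RL : Submodule k L} {κK : K →ₗ[k] A 0} {κL : L →ₗ[k] B 0}
    (hK : Presents dA RK κK) (hL : Presents dB RL κL) (φ : K →ₗ[k] L)
    (hφ : ∀ x, E.ι 0 (κK x) = κL (φ x)) :
    Nonempty (Homology dC 1 ≃ₗ[k] RL.comap φ ⧸ RK.comap (RL.comap φ).subtype) := by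
  obtain ⟨e⟩ := E.nonempty_equiv_range hB 0
  let g : RL.comap φ →ₗ[k] Homology dA 0 := toZero dA ∘ₗ κK ∘ₗ Submodule.subtype _
  have hg : LinearMap.range g = LinearMap.range (E.toA 0) := by
    ext x
    constructor
    · rintro ⟨⟨y, hy⟩, rfl⟩
      refine (E.mem_range_toA 0 ⟨κK y, trivial⟩).2 ?_
      rw [hφ]
      exact (hL.ker _).2 hy
    · intro hx
      obtain ⟨x, rfl⟩ := toZero_surjective dA x
      replace hx := (E.mem_range_toA 0 ⟨x, trivial⟩).1 hx
      obtain ⟨y, a, hy⟩ := hK.surj x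
      refine ⟨⟨y, ?_⟩, ?_⟩
      -- The representative `κK y` differs from `x` by a boundary of `A`, and `ι` carries boundaries
      -- to boundaries; hence it still bounds in `B`.
      · rw [Submodule.mem_comap, ← hL.ker, ← hφ, show κK y = x - dA 0 a by rw [hy]; abel,
          map_sub, E.ι_d]
        exact Submodule.sub_mem _ hx ⟨_, rfl⟩
      · have := (toZero_eq_zero dA (x - κK y)).2 ⟨a, hy⟩
        rw [map_sub, sub_eq_zero] at this
        exact this.symm
  refine ⟨e.trans ((LinearEquiv.ofEq _ _ hg.symm).trans
    (g.quotKerEquivRange.symm.trans (Submodule.quotEquivOfEq _ _ ?_)))⟩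
  ext ⟨y, hy⟩
  rw [LinearMap.mem_ker, LinearMap.comp_apply, toZero_eq_zero]
  exact hK.ker y

end Presentation

end SeqHomology

/-! ### Functoriality of cyclic tensor products in the coefficients -/

namespace RelChains

variable {k B M : Type*} [CommRing k] [Ring B] [Algebra k B] [AddCommGroup M] [Module k M]
  {M' : Type*} [AddCommGroup M'] [Module k M'] {M'' : Type*} [AddCommGroup M''] [Module k M'']

theorem hom_ext {P : BimoduleData k B M} {S : Subalgebra k B} {n : ℕ} {N : Type*} [AddCommGroup N]
    [Module k N] {φ ψ : RelChains P S n →ₗ[k] N}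
    (h : ∀ m a, φ (mk P S n (elem m a)) = ψ (mk P S n (elem m a))) : φ = ψ :=
  Submodule.linearMap_qext _ (chains_ext h)

theorem elem_add {n : ℕ} (m m' : M) (a : Fin n → B) :
    elem (k := k) (m + m') a = elem m a + elem m' a := TensorProduct.add_tmul ..

theorem mk_surjective (P : BimoduleData k B M) (S : Subalgebra k B) (n : ℕ) :
    Function.Surjective (mk P S n) := Submodule.mkQ_surjective _

theorem mk_eq_zero (P : BimoduleData k B M) (S : Subalgebra k B) {n : ℕ} {x : Chains k B M n} :
    mk P S n x = 0 ↔ x ∈ relations P S n := Submodule.Quotient.mk_eq_zero _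

theorem d_mk (P : BimoduleData k B M) (S : Subalgebra k B) (n : ℕ) (x : Chains k B M (n + 1)) :
    d P S n (mk P S (n + 1) x) = mk P S n (boundary P n x) := rfl

theorem d_d (P : BimoduleData k B M) (S : Subalgebra k B) (n : ℕ) (x : RelChains P S (n + 2)) :
    d P S n (d P S (n + 1) x) = 0 := LinearMap.congr_fun (d_comp P S n) x

/-- A `k`-linear map which is linear over `S` on both sides. -/
def IsBilinear (P : BimoduleData k B M) (P' : BimoduleData k B M') (S : Subalgebra k B)
    (φ : M →ₗ[k] M') : Prop :=
  ∀ b ∈ S, ∀ m, φ (P.l b m) = P'.l b (φ m) ∧ φ (P.r b m) = P'.r b (φ m)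

namespace IsBilinear

variable {P : BimoduleData k B M} {P' : BimoduleData k B M'} {P'' : BimoduleData k B M''}
  {S : Subalgebra k B}

theorem comp {φ : M →ₗ[k] M'} {ψ : M' →ₗ[k] M''} (hψ : IsBilinear P' P'' S ψ)
    (hφ : IsBilinear P P' S φ) : IsBilinear P P'' S (ψ ∘ₗ φ) := fun b hb m => by
  simp [(hφ b hb m).1, (hφ b hb m).2, (hψ b hb _).1, (hψ b hb _).2]

theorem id : IsBilinear P P S LinearMap.id := fun _ _ _ => ⟨rfl, rfl⟩

end IsBilinear

theorem l_algebraMap (P : BimoduleData k B M) (c : k) (m : M) : P.l (algebraMap k B c) m = c • m := by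
  rw [Algebra.algebraMap_eq_smul_one, map_smul, P.l_one]; rfl

theorem r_algebraMap (P : BimoduleData k B M) (c : k) (m : M) : P.r (algebraMap k B c) m = c • m := by
  rw [Algebra.algebraMap_eq_smul_one, map_smul, P.r_one]; rfl

/-- `⊥` is the image of `k`, which acts centrally. On normalized complexes over `k`, sections and
homotopies therefore need only be `k`-linear. -/
theorem isBilinear_bot (P : BimoduleData k B M) (P' : BimoduleData k B M') (φ : M →ₗ[k] M') :
    IsBilinear P P' ⊥ φ := by
  rintro b hb m
  obtain ⟨c, rfl⟩ := Algebra.mem_bot.1 hb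
  simp only [l_algebraMap, r_algebraMap, map_smul, and_self]

theorem rTensor_relations_of_isBilinear {P : BimoduleData k B M} {P' : BimoduleData k B M'}
    {S : Subalgebra k B} {φ : M →ₗ[k] M'} (h : IsBilinear P P' S φ) (n : ℕ) :
    relations P S n ≤ (relations P' S n).comap (φ.rTensor _) := by
  refine Submodule.span_le.2 ?_
  rintro x (⟨j, s, m, a, rfl⟩ | ⟨m, a, ⟨p, hp⟩, rfl⟩)
  · have h1 : φ (afterEnd P j (s : B) m) = afterEnd P' j (s : B) (φ m) := by
      unfold afterEnd; split_ifs <;> simp [(h s s.2 _).2]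
    have h2 : φ (beforeEnd P n j (s : B) m) = beforeEnd P' n j (s : B) (φ m) := by
      unfold beforeEnd; split_ifs <;> simp [(h s s.2 _).1]
    have := balance_mem P' S j j.2 s s.2 (φ m) a
    rw [← h1, ← h2] at this
    rw [SetLike.mem_coe, Submodule.mem_comap, map_sub]
    exact this
  · exact degenerate_mem P' S (φ m) a p hp

/-- The map on cyclic tensor products induced by an `S`-bilinear map of coefficients. -/
def mapS {P : BimoduleData k B M} {P' : BimoduleData k B M'} {S : Subalgebra k B}
    {φ : M →ₗ[k] M'} (h : IsBilinear P P' S φ) (n : ℕ) : RelChains P S n →ₗ[k] RelChains P' S n :=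
  (relations P S n).mapQ (relations P' S n) (φ.rTensor _) (rTensor_relations_of_isBilinear h n)

section mapS

variable {P : BimoduleData k B M} {P' : BimoduleData k B M'} {P'' : BimoduleData k B M''}
  {S : Subalgebra k B}

theorem mapS_mk_elem {φ : M →ₗ[k] M'} (h : IsBilinear P P' S φ) (n : ℕ) (m : M) (a : Fin n → B) :
    mapS h n (mk P S n (elem m a)) = mk P' S n (elem (φ m) a) := rfl

theorem mapS_id (n : ℕ) (h : IsBilinear P P S LinearMap.id) (x : RelChains P S n) :
    mapS h n x = x :=
  LinearMap.congr_fun (hom_ext (φ := mapS h n) (ψ := LinearMap.id) fun _ _ => rfl) x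

theorem mapS_mapS {φ : M →ₗ[k] M'} {ψ : M' →ₗ[k] M''} (hφ : IsBilinear P P' S φ)
    (hψ : IsBilinear P' P'' S ψ) {χ : M →ₗ[k] M''} (hχ : IsBilinear P P'' S χ)
    (h : ∀ m, ψ (φ m) = χ m) (n : ℕ) (x : RelChains P S n) :
    mapS hψ n (mapS hφ n x) = mapS hχ n x :=
  LinearMap.congr_fun (hom_ext (φ := mapS hψ n ∘ₗ mapS hφ n) fun m a => by
    rw [LinearMap.comp_apply, mapS_mk_elem, mapS_mk_elem, mapS_mk_elem, h]) x

theorem mapS_add {φ ψ χ : M →ₗ[k] M'} (hφ : IsBilinear P P' S φ) (hψ : IsBilinear P P' S ψ)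
    (hχ : IsBilinear P P' S χ) (h : ∀ m, φ m + ψ m = χ m) (n : ℕ) (x : RelChains P S n) :
    mapS hφ n x + mapS hψ n x = mapS hχ n x :=
  LinearMap.congr_fun (hom_ext (φ := mapS hφ n + mapS hψ n) fun m a => by
    rw [LinearMap.add_apply, mapS_mk_elem, mapS_mk_elem, mapS_mk_elem, ← h, elem_add, map_add]) x

theorem mapS_zero {φ : M →ₗ[k] M'} (hφ : IsBilinear P P' S φ) (h : ∀ m, φ m = 0) (n : ℕ)
    (x : RelChains P S n) : mapS hφ n x = 0 :=
  LinearMap.congr_fun (hom_ext (φ := mapS hφ n) (ψ := 0) fun m a => by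
    rw [mapS_mk_elem, h, LinearMap.zero_apply, elem, TensorProduct.zero_tmul, map_zero]) x

/-- Linearity over `S` makes the induced map well defined, but the outer faces involve arbitrary
letters, so commuting with the boundary requires linearity over the whole algebra. -/
theorem mapS_d {φ : M →ₗ[k] M'} (h : IsBilinear P P' S φ) (h' : IsBilinear P P' ⊤ φ) (n : ℕ)
    (x : RelChains P S (n + 1)) : mapS h n (d P S n x) = d P' S n (mapS h (n + 1) x) :=
  LinearMap.congr_fun (map_d P P' S φ (fun b m => (h' b trivial m).1)
    (fun b m => (h' b trivial m).2) n) x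

end mapS

/-- Chains of degree zero are coefficients. -/
def chainsZero (k B M : Type*) [CommRing k] [Ring B] [Algebra k B] [AddCommGroup M] [Module k M] :
    Chains k B M 0 ≃ₗ[k] M :=
  (LinearEquiv.lTensor M (PiTensorProduct.isEmptyEquiv (Fin 0))).trans (TensorProduct.rid k M)

theorem chainsZero_elem (m : M) (a : Fin 0 → B) : chainsZero k B M (elem m a) = m := by
  simp [chainsZero, elem]

/-! ### The contracting homotopy for left free coefficients -/

section LeftFree

variable {V : Type*} [AddCommGroup V] [Module k V]

/-- The bimodule `M` is `B ⊗ V` with the multiplication of `B` from the left and a right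
action `ρ` on `V` from the right. -/
structure LeftFree (P : BimoduleData k B M) (ρ : B →ₗ[k] Module.End k V) where
  e : B ⊗[k] V ≃ₗ[k] M
  l : ∀ b x w, P.l b (e (x ⊗ₜ w)) = e ((b * x) ⊗ₜ w)
  r : ∀ b x w, P.r b (e (x ⊗ₜ w)) = e (x ⊗ₜ ρ b w)
  mul : ∀ b c w, ρ (b * c) w = ρ c (ρ b w)
  one : ∀ w, ρ 1 w = w

namespace LeftFree

variable {P : BimoduleData k B M} {ρ : B →ₗ[k] Module.End k V} (F : LeftFree P ρ)

include F in
theorem chains_ext {n : ℕ} {N : Type*} [AddCommGroup N] [Module k N]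
    {φ ψ : Chains k B M n →ₗ[k] N}
    (h : ∀ x w a, φ (elem (F.e (x ⊗ₜ w)) a) = ψ (elem (F.e (x ⊗ₜ w)) a)) : φ = ψ := by
  refine RelChains.chains_ext fun m a => ?_
  obtain ⟨t, rfl⟩ := F.e.surjective m
  induction t with
  | zero => simp [elem]
  | tmul x w => exact h x w a
  | add t t' ht ht' => rw [map_add, elem_add, map_add, map_add, ht, ht']

/-- `(x ⊗ w) ⊗ a ↦ (1 ⊗ w) ⊗ a ⊗ x` on unreduced chains. -/
def snoc (n : ℕ) : Chains k B M n →ₗ[k] Chains k B M (n + 1) :=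
  TensorProduct.lift ((TensorProduct.lift (LinearMap.mk₂ k (fun x w =>
    TensorProduct.mk k M _ (F.e (1 ⊗ₜ w)) ∘ₗ
      (PiTensorProduct.lift (MultilinearMap.curryRight
        (PiTensorProduct.tprod k : MultilinearMap k (fun _ : Fin (n + 1) => B) _))).flip x)
    (fun x x' w => by rw [map_add, LinearMap.comp_add])
    (fun c x w => by rw [map_smul, LinearMap.comp_smul])
    (fun x w w' => by rw [TensorProduct.tmul_add, map_add, map_add, LinearMap.add_comp])
    (fun c x w => by rw [TensorProduct.tmul_smul, map_smul, map_smul, LinearMap.smul_comp])))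
      ∘ₗ F.e.symm.toLinearMap)

theorem snoc_elem {n : ℕ} (x : B) (w : V) (a : Fin n → B) :
    F.snoc n (elem (F.e (x ⊗ₜ w)) a) = elem (F.e (1 ⊗ₜ w)) (Fin.snoc a x) := by
  simp [snoc, elem]

/-- The new letter `x` is inert except for `j = n + 1`: there the old last face multiplies the
coefficient `x ⊗ w` by the last letter of `a`, while the new word multiplies the same letter into
`x` as an inner face. -/
theorem face_castSucc_snoc {n : ℕ} (j : Fin (n + 2)) (z : Chains k B M (n + 1)) :
    face P j.castSucc (F.snoc (n + 1) z) = F.snoc n (face P j z) := by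
  refine LinearMap.congr_fun (F.chains_ext (φ := face P j.castSucc ∘ₗ F.snoc (n + 1))
    (ψ := F.snoc n ∘ₗ face P j) fun x w a => ?_) z
  simp only [LinearMap.comp_apply, snoc_elem, face_elem]
  obtain ⟨j, hj⟩ := j
  have hw : ∀ y : B, (∀ i : Fin (n + 1), (i : ℕ) = n →
      faceWord (⟨j, hj⟩ : Fin (n + 2)).castSucc (Fin.snoc a x : Fin (n + 2) → B) i = y) →
      faceWord (⟨j, hj⟩ : Fin (n + 2)).castSucc (Fin.snoc a x : Fin (n + 2) → B) =
        (Fin.snoc (faceWord ⟨j, hj⟩ a) y : Fin (n + 1) → B) := by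
    intro y hy
    funext i
    refine Fin.lastCases ?_ (fun i => ?_) i
    · rw [hy _ rfl, Fin.snoc_last]
    · rw [Fin.snoc_castSucc]
      simp only [faceWord, Fin.val_castSucc, Fin.snoc_castSucc, ← Fin.castSucc_succ]
  rcases Nat.eq_zero_or_pos j with rfl | h0
  · have := hw x fun i hi => by
      have : i.succ = Fin.last (n + 1) := Fin.ext (by simp [hi])
      simp [faceWord, this]
    rw [this]
    have h1 : (Fin.snoc a x : Fin (n + 2) → B) 0 = a 0 := Fin.snoc_castSucc (i := 0) ..
    simp [faceEnd, F.r, snoc_elem, h1]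
  · rcases eq_or_ne j (n + 1) with rfl | h1
    · have := hw (a (Fin.last n) * x) fun i hi => by
        have h3 : i = Fin.last n := Fin.ext (by simp [hi])
        simp only [faceWord, h3, Fin.snoc_castSucc]
        simp
      rw [this]
      simp [faceEnd, F.l, snoc_elem]
    · have := hw x fun i hi => by
        have h2 : i.succ = Fin.last (n + 1) := Fin.ext (by simp [hi])
        simp only [faceWord, hi, h2, Fin.snoc_last]
        rw [if_neg (by simp; omega), if_neg (by simp; omega)]
      rw [this]
      have h3 : j ≠ n + 1 + 1 := by omega
      simp [faceEnd, h0.ne', h1, h3, snoc_elem]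

/-- The closing face multiplies the appended letter back onto the coefficient `1 ⊗ w`. -/
theorem face_last_snoc {n : ℕ} (z : Chains k B M n) :
    face P (Fin.last (n + 1)) (F.snoc n z) = z := by
  refine LinearMap.congr_fun (F.chains_ext (φ := face P (Fin.last (n + 1)) ∘ₗ F.snoc n)
    (ψ := LinearMap.id) fun x w a => ?_) z
  simp only [LinearMap.comp_apply, snoc_elem, face_elem, LinearMap.id_apply]
  congr 1
  · simp [faceEnd, F.l]
  · funext i
    simp [faceWord]

/-- All faces but the last commute with `snoc`. The last has index `n + 2` and returns `z`, which
accounts for the sign `(-1) ^ n`. -/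
theorem boundary_snoc {n : ℕ} (z : Chains k B M (n + 1)) :
    boundary P (n + 1) (F.snoc (n + 1) z) = F.snoc n (boundary P n z) + (-1 : k) ^ n • z := by
  simp only [boundary, LinearMap.sum_apply, LinearMap.smul_apply, map_sum, map_smul]
  rw [Fin.sum_univ_castSucc, F.face_last_snoc]
  simp only [F.face_castSucc_snoc]
  simp [pow_succ]

/-- Moving `s` across the sign that closes the cycle multiplies `x` by `s` on the left; after `snoc`
this is a move across the inner sign in front of the letter `x`. The other signs keep their places.
-/
theorem snoc_relations (S : Subalgebra k B) (n : ℕ) :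
    relations P S n ≤ (relations P S (n + 1)).comap (F.snoc n) := by
  refine Submodule.span_le.2 ?_
  rintro z (⟨⟨j, hj⟩, s, m, a, rfl⟩ | ⟨m, a, ⟨p, hp⟩, rfl⟩)
  · obtain ⟨t, rfl⟩ := F.e.surjective m
    simp only [SetLike.mem_coe, Submodule.mem_comap]
    induction t with
    | zero => simp [elem]
    | add t t' ht ht' =>
      convert Submodule.add_mem _ ht ht' using 1
      simp only [map_add, elem_add, map_sub]
      abel
    | tmul x w =>
      rw [map_sub]
      convert balance_mem P S (n := n + 1) j (by omega) s s.2 (F.e (1 ⊗ₜ w)) (Fin.snoc a x) using 2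
      · have h1 : F.snoc n (elem (afterEnd P j s (F.e (x ⊗ₜ w))) (afterWord j (s : B) a)) =
            elem (afterEnd P j (s : B) (F.e (1 ⊗ₜ w))) (Fin.snoc (afterWord j (s : B) a) x) := by
          unfold afterEnd
          split_ifs
          · rw [F.r, F.r, snoc_elem]
          · rw [LinearMap.id_apply, snoc_elem]; rfl
        rw [h1]
        congr 1
        funext i
        refine Fin.lastCases ?_ (fun i => ?_) i
        · simp only [afterWord, Fin.snoc_last, Fin.val_last]
          rw [if_neg (by omega)]
        · simp [afterWord]
      · have h1 : beforeEnd P (n + 1) j (s : B) (F.e (1 ⊗ₜ w)) = F.e (1 ⊗ₜ w) := by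
          rw [beforeEnd, if_neg (by omega)]; rfl
        have h2 : beforeEnd P n j s (F.e (x ⊗ₜ w)) = F.e ((if j = n then s * x else x) ⊗ₜ w) := by
          unfold beforeEnd
          split_ifs
          · rw [F.l]
          · rfl
        rw [h1]
        simp only [h2, snoc_elem]
        congr 1
        funext i
        refine Fin.lastCases ?_ (fun i => ?_) i
        · simp [beforeWord, eq_comm]
        · simp [beforeWord]
  · obtain ⟨t, rfl⟩ := F.e.surjective m
    simp only [SetLike.mem_coe, Submodule.mem_comap]
    induction t with
    | zero => simp [elem]
    | add t t' ht ht' =>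
      convert Submodule.add_mem _ ht ht' using 1
      simp only [map_add, elem_add]
    | tmul x w =>
      rw [snoc_elem]
      exact degenerate_mem P S _ _ p.castSucc (by simpa using hp)

/-- The contracting homotopy `(x ⊗ w) ⊗ a ↦ (1 ⊗ w) ⊗ a ⊗ x` on cyclic tensor products. -/
def homotopy (S : Subalgebra k B) (n : ℕ) : RelChains P S n →ₗ[k] RelChains P S (n + 1) :=
  (relations P S n).mapQ (relations P S (n + 1)) (F.snoc n) (F.snoc_relations S n)

theorem d_homotopy (S : Subalgebra k B) (n : ℕ) (z : RelChains P S (n + 1)) :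
    d P S (n + 1) (F.homotopy S (n + 1) z) = F.homotopy S n (d P S n z) + (-1 : k) ^ n • z := by
  obtain ⟨z, rfl⟩ := mk_surjective P S _ z
  exact congrArg (RelChains.mk P S (n + 1)) (F.boundary_snoc z)

include F in
theorem acyclic (S : Subalgebra k B) : SeqHomology.Acyclic (d P S) := by
  intro n z hz
  refine ⟨(-1 : k) ^ n • F.homotopy S (n + 1) z, ?_⟩
  rw [map_smul, F.d_homotopy, hz, map_zero, zero_add, smul_smul, ← mul_pow]
  simp

/-- The augmentation `x ⊗ w ↦ w x`. -/
def aug (S : Subalgebra k B) : RelChains P S 0 →ₗ[k] V :=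
  (relations P S 0).liftQ (TensorProduct.lift ρ ∘ₗ F.e.symm.toLinearMap ∘ₗ
    (chainsZero k B M).toLinearMap) <| by
    refine Submodule.span_le.2 ?_
    rintro z (⟨⟨j, hj⟩, s, m, a, rfl⟩ | ⟨m, a, ⟨p, hp⟩, rfl⟩)
    · obtain rfl : j = 0 := by omega
      obtain ⟨t, rfl⟩ := F.e.surjective m
      simp only [SetLike.mem_coe, LinearMap.mem_ker, map_sub, LinearMap.comp_apply,
        LinearEquiv.coe_coe, chainsZero_elem, afterEnd, beforeEnd, if_true]
      induction t with
      | zero => simp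
      | tmul x w => simp [F.l, F.r, F.mul]
      | add t t' ht ht' =>
        simp only [map_add]
        rw [add_sub_add_comm, ht, ht', add_zero]
    · exact p.elim0

theorem aug_mk (S : Subalgebra k B) (x : B) (w : V) (a : Fin 0 → B) :
    F.aug S (RelChains.mk P S 0 (elem (F.e (x ⊗ₜ w)) a)) = ρ x w := by
  change (TensorProduct.lift ρ ∘ₗ F.e.symm.toLinearMap ∘ₗ
    (chainsZero k B M).toLinearMap) (elem (F.e (x ⊗ₜ w)) a) = _
  simp [chainsZero_elem]

/-- The section `w ↦ 1 ⊗ w` of the augmentation. -/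
def unit (S : Subalgebra k B) : V →ₗ[k] RelChains P S 0 :=
  RelChains.mk P S 0 ∘ₗ (chainsZero k B M).symm.toLinearMap ∘ₗ F.e.toLinearMap ∘ₗ
    TensorProduct.mk k B V 1

theorem unit_apply (S : Subalgebra k B) (w : V) (a : Fin 0 → B) :
    F.unit S w = RelChains.mk P S 0 (elem (F.e (1 ⊗ₜ w)) a) := by
  simp only [unit, LinearMap.comp_apply]
  congr 1
  rw [LinearEquiv.coe_coe, LinearEquiv.symm_apply_eq, chainsZero_elem]
  rfl

theorem aug_unit (S : Subalgebra k B) (w : V) : F.aug S (F.unit S w) = w := by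
  rw [F.unit_apply S w Fin.elim0, aug_mk, F.one]

include F in
theorem relChains_ext {S : Subalgebra k B} {n : ℕ} {N : Type*} [AddCommGroup N]
    [Module k N] {φ ψ : RelChains P S n →ₗ[k] N}
    (h : ∀ x w a, φ (RelChains.mk P S n (elem (F.e (x ⊗ₜ w)) a)) =
      ψ (RelChains.mk P S n (elem (F.e (x ⊗ₜ w)) a))) : φ = ψ :=
  Submodule.linearMap_qext _ (F.chains_ext h)

theorem _root_.RelChains.boundary_zero (m : M) (a : Fin 1 → B) :
    boundary P 0 (elem m a) = elem (P.r (a 0) m) Fin.elim0 - elem (P.l (a 0) m) Fin.elim0 := by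
  have h0 : face (k := k) P (n := 0) 0 (elem m a) = elem (P.r (a 0) m) Fin.elim0 := by
    rw [face_elem, Subsingleton.elim (faceWord _ a) Fin.elim0]
    rfl
  have h1 : face (k := k) P (n := 0) 1 (elem m a) = elem (P.l (a 0) m) Fin.elim0 := by
    rw [face_elem, Subsingleton.elim (faceWord _ a) Fin.elim0]
    rfl
  rw [boundary, LinearMap.sum_apply, Fin.sum_univ_two, LinearMap.smul_apply, LinearMap.smul_apply,
    h0, h1]
  simp [sub_eq_add_neg]

theorem aug_d (S : Subalgebra k B) (z : RelChains P S 1) : F.aug S (d P S 0 z) = 0 := by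
  refine LinearMap.congr_fun (F.relChains_ext (φ := F.aug S ∘ₗ d P S 0) (ψ := 0)
    fun x w a => ?_) z
  rw [LinearMap.comp_apply, d_mk, boundary_zero, map_sub, map_sub, F.l, F.r, aug_mk, aug_mk, F.mul,
    sub_self]
  rfl

/-- In degree zero the homotopy contracts onto `V` instead of `0`: the boundary of `(1 ⊗ w) ⊗ x` is
`1 ⊗ ρ x w` minus `x ⊗ w`. -/
theorem d_homotopy_zero (S : Subalgebra k B) (z : RelChains P S 0) :
    d P S 0 (F.homotopy S 0 z) = F.unit S (F.aug S z) - z := by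
  refine LinearMap.congr_fun (F.relChains_ext (φ := d P S 0 ∘ₗ F.homotopy S 0)
    (ψ := F.unit S ∘ₗ F.aug S - LinearMap.id) fun x w a => ?_) z
  have h : F.homotopy S 0 (RelChains.mk P S 0 (elem (F.e (x ⊗ₜ w)) a)) =
      RelChains.mk P S 1 (elem (F.e (1 ⊗ₜ w)) (Fin.snoc a x)) :=
    congrArg (RelChains.mk P S 1) (F.snoc_elem x w a)
  rw [LinearMap.comp_apply, h, d_mk, boundary_zero, LinearMap.sub_apply, LinearMap.comp_apply,
    aug_mk, F.unit_apply S _ Fin.elim0, map_sub, LinearMap.id_apply,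
    Subsingleton.elim a Fin.elim0]
  have h1 : (Fin.snoc (Fin.elim0 : Fin 0 → B) x : Fin 1 → B) 0 = x :=
    Fin.snoc_last (n := 0) (α := fun _ => B) x Fin.elim0
  rw [h1, F.r, F.l, mul_one]

end LeftFree

end LeftFree

end RelChains

/-! ### Acyclicity of a total complex from its rows -/

namespace DoubleComplex

variable {k : Type*} [CommRing k] {D : ℕ → ℕ → Type*} [∀ r s, AddCommGroup (D r s)]
  [∀ r s, Module k (D r s)]

/-- The degree `n` part of the total complex. -/
abbrev Total (D : ℕ → ℕ → Type*) (n : ℕ) := ∀ p : {p : ℕ × ℕ // p.1 + p.2 = n}, D p.1.1 p.1.2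

/-- The differential of the total complex: horizontal plus `(-1)^r` times vertical. -/
def totalD (dh : ∀ r s, D (r + 1) s →ₗ[k] D r s) (dv : ∀ r s, D r (s + 1) →ₗ[k] D r s) (n : ℕ) :
    Total D (n + 1) →ₗ[k] Total D n :=
  LinearMap.pi fun p =>
    dh p.1.1 p.1.2 ∘ₗ
        LinearMap.proj (⟨(p.1.1 + 1, p.1.2), by have := p.2; simp only; omega⟩ :
          {q : ℕ × ℕ // q.1 + q.2 = n + 1}) +
      (-1 : k) ^ p.1.1 • (dv p.1.1 p.1.2 ∘ₗ
        LinearMap.proj (⟨(p.1.1, p.1.2 + 1), by have := p.2; simp only; omega⟩ :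
          {q : ℕ × ℕ // q.1 + q.2 = n + 1}))

variable {dh : ∀ r s, D (r + 1) s →ₗ[k] D r s} {dv : ∀ r s, D r (s + 1) →ₗ[k] D r s}

theorem totalD_apply (n : ℕ) (x : Total D (n + 1)) (r s : ℕ) (h : r + s = n) :
    totalD dh dv n x ⟨(r, s), h⟩ = dh r s (x ⟨(r + 1, s), by simp only; omega⟩) +
      (-1 : k) ^ r • dv r s (x ⟨(r, s + 1), by simp only; omega⟩) := rfl

/-- If the rows of a double complex are resolutions of the terms of a complex `Q` which is exact
in positive degrees, then so is the total complex. -/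
theorem acyclic_of_rows {Q : ℕ → Type*} [∀ s, AddCommGroup (Q s)] [∀ s, Module k (Q s)]
    {dQ : ∀ s, Q (s + 1) →ₗ[k] Q s} (q : ∀ s, D 0 s →ₗ[k] Q s)
    (total_total : ∀ n x, totalD dh dv n (totalD dh dv (n + 1) x) = 0)
    (hrow : ∀ r s x, dh r s x = 0 → ∃ y, dh (r + 1) s y = x)
    (hrow0 : ∀ s x, q s x = 0 → ∃ y, dh 0 s y = x)
    (hq : ∀ s, Function.Surjective (q s)) (hqh : ∀ s x, q s (dh 0 s x) = 0)
    (hqv : ∀ s x, q s (dv 0 s x) = dQ s (q (s + 1) x)) (hQ : SeqHomology.Acyclic dQ) :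
    SeqHomology.Acyclic (totalD dh dv) := by
  classical
  intro n x hx
  -- The cycle is modified by boundaries so that its components with `r < j` vanish, one value of
  -- `r` at a time. At `j = n + 2` nothing is left, since `r ≤ n + 1`.
  have key : ∀ j ≤ n + 2, ∃ y : Total D (n + 2), ∀ r s (h : r + s = n + 1), r < j →
      (x - totalD dh dv (n + 1) y) ⟨(r, s), h⟩ = 0 := by
    intro j
    induction j with
    | zero => exact fun _ => ⟨0, fun r s h hr => absurd hr (Nat.not_lt_zero r)⟩
    | succ j ih =>
      intro hj
      obtain ⟨y, hy⟩ := ih (by omega)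
      set z := x - totalD dh dv (n + 1) y with hz
      have hdz : totalD dh dv n z = 0 := by rw [hz, map_sub, hx, total_total, sub_zero]
      rcases j with _ | j
      -- In column `0` the map `q` turns the component into a cycle of `Q`. It bounds there, and a
      -- lift `w` of the bounding element corrects the component up to the kernel of `q`, which
      -- consists of horizontal boundaries.
      · have h1 := congrFun hdz ⟨(0, n), by simp⟩
        rw [totalD_apply] at h1
        replace h1 := congrArg (q n) h1
        rw [map_add, hqh, zero_add, pow_zero, one_smul, hqv] at h1
        obtain ⟨w, hw⟩ := hQ n _ (h1.trans (map_zero _))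
        obtain ⟨w, rfl⟩ := hq _ w
        rw [← hqv] at hw
        obtain ⟨w', hw'⟩ := hrow0 (n + 1) (z ⟨(0, n + 1), by simp⟩ - dv 0 (n + 1) w) (by
          rw [map_sub, hw]; exact sub_self _)
        refine ⟨y + Pi.single ⟨(0, n + 2), by simp⟩ w + Pi.single ⟨(1, n + 1), by simp; omega⟩ w',
          ?_⟩
        intro r s h hr
        obtain rfl : r = 0 := by omega
        obtain rfl : s = n + 1 := by omega
        rw [map_add, map_add, ← sub_sub, ← sub_sub, ← hz, Pi.sub_apply, Pi.sub_apply, totalD_apply,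
          totalD_apply]
        simp only [Pi.single_eq_same]
        rw [Pi.single_eq_of_ne (by simp), Pi.single_eq_of_ne (by simp), hw']
        simp
      -- As the component in column `j` already vanishes, the cycle condition makes the next
      -- component a horizontal cycle. The correction in column `j + 2` has no effect on earlier
      -- columns.
      · have h1 := congrFun hdz ⟨(j, n - j), by simp; omega⟩
        rw [totalD_apply, hy j _ _ (by omega), map_zero, smul_zero, add_zero] at h1
        obtain ⟨w, hw⟩ := hrow _ _ _ h1
        refine ⟨y + Pi.single ⟨(j + 1 + 1, n - j), by simp; omega⟩ w, ?_⟩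
        intro r s h hr
        rw [map_add, ← sub_sub, ← hz, Pi.sub_apply, totalD_apply]
        rcases Nat.lt_or_ge r (j + 1) with h2 | h2
        · rw [Pi.single_eq_of_ne (by simp [Subtype.ext_iff]; omega),
            Pi.single_eq_of_ne (by simp [Subtype.ext_iff]; omega), hy r s h h2]
          simp
        · obtain rfl : r = j + 1 := by omega
          obtain rfl : s = n - j := by omega
          rw [Pi.single_eq_same, Pi.single_eq_of_ne (by simp [Subtype.ext_iff]), hw]
          simp
  obtain ⟨y, hy⟩ := key (n + 2) le_rfl
  refine ⟨y, funext fun p => ?_⟩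
  obtain ⟨⟨r, s⟩, h⟩ := p
  have := hy r s h (by simp only at h; omega)
  exact (sub_eq_zero.1 this).symm

end DoubleComplex

/-! ### Multilinear maps on iterated comultiplications -/

namespace IterComul

open Coalgebra CrossedProduct

variable {k : Type*} [CommRing k]

section Coalg

variable {C : Type*} [AddCommGroup C] [Module k C] [Coalgebra k C] {Z : Type*} [AddCommGroup Z]
  [Module k Z]

theorem lift_comul (b : C →ₗ[k] C →ₗ[k] Z) {c : C} {ι : Type*} (R : Repr k c ι) :
    TensorProduct.lift b (comul c) = ∑ i ∈ R.index, b (R.left i) (R.right i) := by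
  rw [← R.eq, map_sum]
  simp

/-- Coassociativity in Sweedler form: both sums are `t(c⁽¹⁾, c⁽²⁾, c⁽³⁾)`, with the first or the
last factor of the comultiplication split again. -/
theorem sum_trilinear (t : C →ₗ[k] C →ₗ[k] C →ₗ[k] Z) {c : C} {ι : Type*} (R : Repr k c ι) :
    ∑ i ∈ R.index, ∑ j ∈ (ℛ k (R.left i)).index,
        t ((ℛ k (R.left i)).left j) ((ℛ k (R.left i)).right j) (R.right i) =
      ∑ i ∈ R.index, ∑ j ∈ (ℛ k (R.right i)).index,
        t (R.left i) ((ℛ k (R.right i)).left j) ((ℛ k (R.right i)).right j) := by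
  have := congrArg (TensorProduct.lift ((TensorProduct.lift.equiv (RingHom.id k) C C Z).toLinearMap ∘ₗ t))
    (sum_tmul_tmul_eq R (fun i => ℛ k (R.left i)) (fun i => ℛ k (R.right i)))
  simpa [map_sum] using this

end Coalg

/-- The word obtained from `c` by replacing the letter `c p` by the two letters `x`, `y`. -/
def splitAt {X : Type*} {n : ℕ} (p : Fin n) (c : Fin n → X) (x y : X) (i : Fin (n + 1)) : X :=
  if h : (i : ℕ) < p then c ⟨i, by omega⟩
  else if (i : ℕ) = p then x
  else if (i : ℕ) = p + 1 then y
  else c ⟨i - 1, by omega⟩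

theorem splitAt_zero {X : Type*} {n : ℕ} (a : X) (c : Fin n → X) (x y : X) :
    splitAt 0 (Fin.cons a c : Fin (n + 1) → X) x y = (Fin.cons x (Fin.cons y c) : Fin (n + 2) → X) := by
  funext i
  refine Fin.cases ?_ (fun i => ?_) i
  · simp [splitAt]
  · refine Fin.cases ?_ (fun i => ?_) i
    · simp [splitAt]
    · have : (⟨(i : ℕ) + 1, by omega⟩ : Fin (n + 1)) = i.succ := rfl
      simp [splitAt, this]

theorem splitAt_succ {X : Type*} {n : ℕ} (p : Fin n) (a : X) (c : Fin n → X) (x y : X) :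
    splitAt p.succ (Fin.cons a c : Fin (n + 1) → X) x y =
      (Fin.cons a (splitAt p c x y) : Fin (n + 2) → X) := by
  funext i
  refine Fin.cases ?_ (fun i => ?_) i
  · simp [splitAt]
  · simp only [splitAt, Fin.val_succ, Fin.cons_succ, add_lt_add_iff_right, add_left_inj,
      Nat.add_sub_cancel]
    split_ifs with h1 h2 h3
    · exact Fin.cons_succ (α := fun _ => X) a c ⟨i, by omega⟩
    · rfl
    · rfl
    · have : (⟨(i : ℕ), by omega⟩ : Fin (n + 1)) = Fin.succ ⟨i - 1, by omega⟩ :=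
        Fin.ext (by simp; omega)
      rw [this, Fin.cons_succ]

variable {C : Type*} [Ring C] [Bialgebra k C] {Z : Type*} [AddCommGroup Z] [Module k Z]

/-- The linear map `c ↦ Φ (c⁽¹⁾, …, c⁽ⁿ⁾)`. -/
def eval {n : ℕ} (Φ : MultilinearMap k (fun _ : Fin n => C) Z) : C →ₗ[k] Z :=
  PiTensorProduct.lift Φ ∘ₗ iterComul k n

/-- `eval` as a linear map in the multilinear map. -/
def evalL (n : ℕ) : MultilinearMap k (fun _ : Fin n => C) Z →ₗ[k] C →ₗ[k] Z :=
  (LinearMap.lcomp k Z (iterComul k n)) ∘ₗ PiTensorProduct.lift.toLinearMap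

theorem evalL_apply {n : ℕ} (Φ : MultilinearMap k (fun _ : Fin n => C) Z) :
    evalL n Φ = eval Φ := rfl

theorem lift_iterComul_succ {n : ℕ} (Φ : MultilinearMap k (fun _ : Fin (n + 1) => C) Z) (c : C) :
    eval Φ c = TensorProduct.lift (evalL n ∘ₗ Φ.curryLeft) (comul c) := by
  have : PiTensorProduct.lift Φ ∘ₗ TensorProduct.lift
      (PiTensorProduct.lift.toLinearMap ∘ₗ
        (PiTensorProduct.tprod k : MultilinearMap k (fun _ : Fin (n + 1) => C) _).curryLeft) ∘ₗ
      (iterComul k n).lTensor C = TensorProduct.lift (evalL n ∘ₗ Φ.curryLeft) := by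
    refine TensorProduct.ext' fun x y => ?_
    simp only [LinearMap.comp_apply, LinearMap.lTensor_tmul, TensorProduct.lift.tmul,
      LinearEquiv.coe_coe, evalL_apply, eval]
    generalize iterComul k n y = t
    induction t using PiTensorProduct.induction_on with
    | smul_tprod r f => simp
    | add a b ha hb => simp only [map_add, ha, hb]
  exact LinearMap.congr_fun this (comul c)

theorem eval_succ {n : ℕ} (Φ : MultilinearMap k (fun _ : Fin (n + 1) => C) Z) {c : C} {ι : Type*}
    (R : Repr k c ι) :
    eval Φ c = ∑ i ∈ R.index, eval (Φ.curryLeft (R.left i)) (R.right i) := by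
  rw [lift_iterComul_succ, lift_comul _ R]
  rfl

theorem eval_zero (Φ : MultilinearMap k (fun _ : Fin 0 => C) Z) (c : C) :
    eval Φ c = counit (R := k) c • Φ Fin.elim0 := by
  simp only [eval, LinearMap.comp_apply, iterComul, LinearMap.smulRight_apply, map_smul,
    PiTensorProduct.lift.tprod]

theorem eval_ext {n : ℕ} {Φ Ψ : MultilinearMap k (fun _ : Fin n => C) Z} (h : ∀ c, Φ c = Ψ c) :
    eval Φ = eval Ψ := by rw [MultilinearMap.ext h]

theorem eval_sum {n : ℕ} {ι : Type*} (s : Finset ι)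
    (Φ : ι → MultilinearMap k (fun _ : Fin n => C) Z) (c : C) :
    eval (∑ i ∈ s, Φ i) c = ∑ i ∈ s, eval (Φ i) c := by
  rw [← evalL_apply, map_sum, LinearMap.sum_apply]
  rfl

theorem map_eval {n : ℕ} {Z' : Type*} [AddCommGroup Z'] [Module k Z'] (g : Z →ₗ[k] Z')
    (Φ : MultilinearMap k (fun _ : Fin n => C) Z) (c : C) :
    g (eval Φ c) = eval (g.compMultilinearMap Φ) c := by
  simp only [eval, LinearMap.comp_apply]
  generalize iterComul k n c = t
  induction t using PiTensorProduct.induction_on with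
  | smul_tprod r f => simp
  | add a b ha hb => simp only [map_add, ha, hb]

/-- Composing with the quotient map by `N` makes the multilinear map zero. Relations that hold for
all letters thus pass to Sweedler sums. -/
theorem eval_mem {n : ℕ} (N : Submodule k Z) (Φ : MultilinearMap k (fun _ : Fin n => C) Z)
    (h : ∀ c, Φ c ∈ N) (c : C) : eval Φ c ∈ N := by
  rw [← Submodule.Quotient.mk_eq_zero, ← Submodule.mkQ_apply, map_eval]
  rw [eval_ext (Ψ := 0) fun c => (Submodule.Quotient.mk_eq_zero _).2 (h c), ← evalL_apply,
    map_zero, LinearMap.zero_apply]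

/-- Merging two adjacent factors of the iterated comultiplication. -/
theorem eval_merge {n : ℕ} (p : Fin n) (Φ : MultilinearMap k (fun _ : Fin (n + 1) => C) Z)
    (Ψ : MultilinearMap k (fun _ : Fin n => C) Z)
    (h : ∀ c : Fin n → C, Ψ c = ∑ i ∈ (ℛ k (c p)).index,
      Φ (splitAt p c ((ℛ k (c p)).left i) ((ℛ k (c p)).right i))) (c : C) :
    eval Φ c = eval Ψ c := by
  induction n generalizing c with
  | zero => exact p.elim0
  | succ n ih =>
    rw [eval_succ Φ (ℛ k c), eval_succ Ψ (ℛ k c)]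
    refine Fin.cases (motive := fun p : Fin (n + 1) => (∀ c : Fin (n + 1) → C, Ψ c =
      ∑ i ∈ (ℛ k (c p)).index,
        Φ (splitAt p c ((ℛ k (c p)).left i) ((ℛ k (c p)).right i))) → _) (fun h => ?_)
        (fun p h => ?_) p h
    -- Merging the first two factors is where coassociativity is used; merging later factors reduces
    -- by induction to the tail of the word.
    · have h1 : ∀ x, Ψ.curryLeft x = ∑ j ∈ (ℛ k x).index,
          (Φ.curryLeft ((ℛ k x).left j)).curryLeft ((ℛ k x).right j) := by
        intro x
        refine MultilinearMap.ext fun c => ?_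
        rw [sum_apply]
        exact (h (Fin.cons x c)).trans (Finset.sum_congr rfl fun j _ => by
          rw [splitAt_zero]; rfl)
      let t : C →ₗ[k] C →ₗ[k] C →ₗ[k] Z :=
        { toFun := fun x => evalL n ∘ₗ (Φ.curryLeft x).curryLeft
          map_add' := fun x y => by
            rw [← LinearMap.comp_add]; congr 1; rw [map_add]; rfl
          map_smul' := fun c x => by
            rw [RingHom.id_apply, ← LinearMap.comp_smul]; congr 1; rw [map_smul]; rfl }
      have h2 := sum_trilinear t (ℛ k c)
      calc _ = _ := Finset.sum_congr rfl fun i _ => eval_succ _ (ℛ k _)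
        _ = _ := h2.symm
        _ = _ := Finset.sum_congr rfl fun i _ => by rw [h1, eval_sum]; rfl
    · refine Finset.sum_congr rfl fun i _ => ih p _ _ (fun c' => ?_) _
      exact (h (Fin.cons _ c')).trans (Finset.sum_congr rfl fun j _ => by
          rw [splitAt_succ]; rfl)

/-- The recursion for the iterated comultiplication at the last factor. -/
theorem eval_snoc {n : ℕ} (Φ : MultilinearMap k (fun _ : Fin (n + 1) => C) Z) {c : C} :
    eval Φ c = TensorProduct.lift ((evalL n (Z := C →ₗ[k] Z) Φ.curryRight).flip).flip (comul c) := by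
  induction n generalizing c with
  | zero =>
    rw [eval_succ Φ (ℛ k c), lift_comul _ (ℛ k c)]
    simp only [eval_zero, evalL_apply, LinearMap.flip_apply]
    let b : C →ₗ[k] Z := (MultilinearMap.ofSubsingletonₗ k k C Z (0 : Fin 1)).symm Φ
    have hb : ∀ x, b x = Φ (fun _ => x) := fun x => rfl
    have e1 : ∀ x, (Φ.curryLeft x) Fin.elim0 = b x := fun x => by
      rw [hb]; exact congrArg Φ (funext fun i => by
        obtain rfl := Fin.fin_one_eq_zero i; rfl)
    have e2 : ∀ x, (Φ.curryRight Fin.elim0) x = b x := fun x => by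
      rw [hb]; exact congrArg Φ (funext fun i => by
        obtain rfl := Fin.fin_one_eq_zero i
        exact Fin.snoc_last (n := 0) (α := fun _ => C) x Fin.elim0)
    simp only [e1, e2, LinearMap.smul_apply, ← map_smul, ← map_sum]
    congr 1
    have h1 := sum_counit_smul (ℛ k c)
    have h2 := congrArg (TensorProduct.rid k C) (sum_tmul_counit_eq (ℛ k c))
    simp only [map_sum, TensorProduct.rid_tmul, one_smul] at h2
    rw [h1, h2]
  | succ n ih =>
    rw [eval_succ Φ (ℛ k c), lift_comul _ (ℛ k c)]
    -- The three arguments are the first factor, the middle block and the last factor.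
    -- Coassociativity lets either end be split off first.
    let t : C →ₗ[k] C →ₗ[k] C →ₗ[k] Z :=
      { toFun := fun x => ((evalL n (Z := C →ₗ[k] Z) (Φ.curryLeft x).curryRight).flip).flip
        map_add' := fun x y => by
          rw [LinearMap.flip_flip, LinearMap.flip_flip, LinearMap.flip_flip, ← map_add, map_add]; rfl
        map_smul' := fun c x => by
          rw [RingHom.id_apply, LinearMap.flip_flip, LinearMap.flip_flip, ← map_smul, map_smul]
          rfl }
    have h2 := sum_trilinear t (ℛ k c)
    calc _ = _ := Finset.sum_congr rfl fun i _ => (ih _).trans (lift_comul _ (ℛ k _))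
      _ = _ := h2.symm
      _ = _ := Finset.sum_congr rfl fun i _ => ?_
    simp only [LinearMap.flip_apply, evalL_apply]
    rw [eval_succ _ (ℛ k _), LinearMap.sum_apply]
    refine Finset.sum_congr rfl fun j _ => ?_
    simp only [t, LinearMap.coe_mk, AddHom.coe_mk, LinearMap.flip_apply, evalL_apply]
    congr 2
    refine eval_ext fun c => LinearMap.ext fun x => ?_
    simp only [MultilinearMap.curryRight_apply, MultilinearMap.curryLeft_apply]
    rw [Fin.cons_snoc_eq_snoc_cons]

theorem eval_tprod (n : ℕ) :
    eval (PiTensorProduct.tprod k : MultilinearMap k (fun _ : Fin n => C) _) = iterComul k n := by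
  rw [eval, PiTensorProduct.lift_tprod, LinearMap.id_comp]

/-- Coalgebra maps commute with iterated comultiplication. It is needed for the multiplication `H ⊗
H → H`, which transports the word of `h l` to a word on `H ⊗ H`. -/
theorem eval_coalgHom {D : Type*} [Ring D] [Bialgebra k D] (g : C →ₗc[k] D) {n : ℕ}
    (Φ : MultilinearMap k (fun _ : Fin n => D) Z) (c : C) :
    eval Φ (g c) = eval (Φ.compLinearMap fun _ => g.toLinearMap) c := by
  induction n generalizing c with
  | zero =>
    rw [eval_zero, eval_zero, CoalgHomClass.counit_comp_apply]
    congr 1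
    exact congrArg Φ (Subsingleton.elim _ _)
  | succ n ih =>
    rw [eval_succ _ ((ℛ k c).induced g), eval_succ _ (ℛ k c)]
    refine Finset.sum_congr rfl fun i _ => (ih _ _).trans ?_
    congr 1
    refine eval_ext fun x => congrArg Φ (funext fun i => ?_)
    exact Fin.cases rfl (fun i => rfl) i

/-- The coalgebra structure of a tensor product is componentwise. This allows two successive actions
of `H` to be read as one word evaluated on `h ⊗ l`. -/
theorem iterComul_tmul {D : Type*} [Ring D] [Bialgebra k D] (n : ℕ) (c : C) (d : D) :
    iterComul k n (c ⊗ₜ[k] d) = PiTensorProduct.map₂ (fun _ => TensorProduct.mk k C D)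
      (iterComul k n c) (iterComul k n d) := by
  induction n generalizing c d with
  | zero =>
    simp only [iterComul, LinearMap.smulRight_apply, TensorProduct.counit_tmul, map_smul,
      LinearMap.smul_apply, PiTensorProduct.map₂_tprod_tprod, smul_smul, smul_eq_mul]
    rw [mul_comm]
    congr 2
    exact Subsingleton.elim _ _
  | succ n ih =>
    have key : ∀ (x : C) (y : D) s t,
        PiTensorProduct.map₂ (fun _ => TensorProduct.mk k C D)
          (PiTensorProduct.lift ((PiTensorProduct.tprod k :
            MultilinearMap k (fun _ : Fin (n + 1) => C) _).curryLeft x) s)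
          (PiTensorProduct.lift ((PiTensorProduct.tprod k :
            MultilinearMap k (fun _ : Fin (n + 1) => D) _).curryLeft y) t) =
        PiTensorProduct.lift ((PiTensorProduct.tprod k :
            MultilinearMap k (fun _ : Fin (n + 1) => C ⊗[k] D) _).curryLeft (x ⊗ₜ y))
          (PiTensorProduct.map₂ (fun _ => TensorProduct.mk k C D) s t) := by
      intro x y s t
      induction s using PiTensorProduct.induction_on with
      | add a b ha hb => simp only [map_add, LinearMap.add_apply, ha, hb]
      | smul_tprod r f =>
        induction t using PiTensorProduct.induction_on with
        | add a b ha hb => simp only [map_add, ha, hb]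
        | smul_tprod r g =>
          simp only [map_smul, LinearMap.smul_apply, PiTensorProduct.lift.tprod,
            MultilinearMap.curryLeft_apply, PiTensorProduct.map₂_tprod_tprod]
          congr 3
          funext i
          exact Fin.cases rfl (fun i => rfl) i
    rw [← eval_tprod, ← eval_tprod, ← eval_tprod, eval_succ _ ((ℛ k c).tmul (ℛ k d)),
      eval_succ _ (ℛ k c), eval_succ _ (ℛ k d)]
    simp only [map_sum, LinearMap.sum_apply, Coalgebra.Repr.tmul_index, Finset.sum_product]
    refine Finset.sum_comm.trans ?_
    refine Finset.sum_congr rfl fun j _ => ?_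
    refine Finset.sum_congr rfl fun i _ => ?_
    simp only [Coalgebra.Repr.tmul_left, Coalgebra.Repr.tmul_right, eval, LinearMap.comp_apply]
    rw [key, ih]

/-- The word obtained from `x` by multiplying the letters in places `p` and `p + 1`. -/
def contract {X : Type*} [Mul X] {n : ℕ} (p : Fin n) (x : Fin (n + 1) → X) (i : Fin n) : X :=
  if (i : ℕ) < p then x i.castSucc
  else if (i : ℕ) = p then x i.castSucc * x i.succ
  else x i.succ

section Word

variable {E : Type*} [Ring E] [Algebra k E]

/-- The linear map `c ↦ G (g₀ (c⁽¹⁾), …, g_{n-1} (c⁽ⁿ⁾))`. -/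
def word {n : ℕ} (G : MultilinearMap k (fun _ : Fin n => E) Z)
    (g : Fin n → WithConv (C →ₗ[k] E)) : C →ₗ[k] Z :=
  eval (G.compLinearMap fun i => (g i).ofConv)

/-- Multiplying two adjacent letters of a word corresponds to the convolution product. -/
theorem word_contract {n : ℕ} (p : Fin n) (G : MultilinearMap k (fun _ : Fin n => E) Z)
    (G' : MultilinearMap k (fun _ : Fin (n + 1) => E) Z) (g : Fin (n + 1) → WithConv (C →ₗ[k] E))
    (h : ∀ c : Fin (n + 1) → C, G' (fun i => g i (c i)) = G (contract p fun i => g i (c i))) :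
    word G' g = word G (contract p g) := by
  refine LinearMap.ext fun c => eval_merge p _ _ (fun c => ?_) c
  simp only [MultilinearMap.compLinearMap_apply]
  -- Only letter `p` of the contracted word is a convolution product; it is written as a sum so that
  -- multilinearity takes the sum out of the word.
  have h1 : (fun i => (contract p g i).ofConv (c i)) =
      Function.update (fun i => (contract p g i).ofConv (c i)) p (∑ j ∈ (ℛ k (c p)).index,
        g p.castSucc ((ℛ k (c p)).left j) * g p.succ ((ℛ k (c p)).right j)) := by
    refine (Function.update_eq_self_iff.2 ?_).symm
    rw [← (ℛ k (c p)).convMul_apply]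
    simp [contract]
  rw [h1, MultilinearMap.map_update_sum]
  refine Finset.sum_congr rfl fun j _ => ?_
  rw [h]
  congr 1
  funext i
  by_cases hi : i = p
  · subst hi
    simp [contract, splitAt]
  · rw [Function.update_of_ne hi]
    have hi' : (i : ℕ) ≠ p := fun h => hi (Fin.ext h)
    simp only [contract, splitAt, Fin.val_castSucc, Fin.val_succ, hi', if_false]
    split_ifs with h1 h2 h3
    · rfl
    · omega
    · omega
    · omega
    · rfl

end Word

end IterComul

/-! ### Chains as words in a larger algebra -/

namespace RelChains

open IterComul

variable {k A E M : Type*} [CommRing k] [Ring A] [Algebra k A] [Ring E] [Algebra k E]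
  [AddCommGroup M] [Module k M]

/-- Each letter enters exactly one place: the first acts on `m` from the right, the last from the
left, and every other one fills a tensor slot. Hence the dependence on one letter is linear. -/
theorem chainWord_update (P : BimoduleData k E M) (π : E →ₗ[k] A) (m : M) {n : ℕ}
    (x : Fin (n + 2) → E) (p : Fin (n + 2)) :
    ∃ L : E →ₗ[k] Chains k A M n, ∀ y,
      elem (P.l (Function.update x p y (Fin.last _)) (P.r (Function.update x p y 0) m))
        (fun i => π (Function.update x p y i.castSucc.succ)) = L y := by
  refine Fin.cases ?_ (fun p => ?_) p
  · refine ⟨(TensorProduct.mk k M _).flip (PiTensorProduct.tprod k fun i => π (x i.castSucc.succ)) ∘ₗ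
      P.l (x (Fin.last _)) ∘ₗ P.r.flip m, fun y => ?_⟩
    have h1 : ∀ i : Fin n, Function.update x 0 y i.castSucc.succ = x i.castSucc.succ := fun i =>
      Function.update_of_ne (by simp [Fin.ext_iff]) ..
    rw [Function.update_of_ne (by simp [Fin.ext_iff]), Function.update_self]
    simp only [h1]
    rfl
  · refine Fin.lastCases ?_ (fun p => ?_) p
    · refine ⟨(TensorProduct.mk k M _).flip (PiTensorProduct.tprod k
        fun i => π (x i.castSucc.succ)) ∘ₗ P.l.flip (P.r (x 0) m), fun y => ?_⟩
      have h1 : ∀ i : Fin n, Function.update x (Fin.last n).succ y i.castSucc.succ =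
          x i.castSucc.succ := fun i =>
        Function.update_of_ne (by simpa [Fin.ext_iff] using i.2.ne) ..
      rw [Function.update_of_ne (a := 0) (by simp [Fin.ext_iff]), ← Fin.succ_last,
        Function.update_self]
      simp only [h1]
      rfl
    · refine ⟨TensorProduct.mk k M _ (P.l (x (Fin.last _)) (P.r (x 0) m)) ∘ₗ
        (PiTensorProduct.tprod k).toLinearMap (fun i => π (x i.castSucc.succ)) p ∘ₗ π, fun y => ?_⟩
      have h1 : (fun i : Fin n => π (Function.update x p.castSucc.succ y i.castSucc.succ)) =
          Function.update (fun i => π (x i.castSucc.succ)) p (π y) := by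
        funext i
        by_cases hi : i = p
        · subst hi; simp
        · rw [Function.update_of_ne hi, Function.update_of_ne]
          simpa [Fin.ext_iff] using hi
      rw [h1, Function.update_of_ne (by simpa [Fin.ext_iff] using p.2.ne'),
        Function.update_of_ne (by simp [Fin.ext_iff])]
      rfl

/-- The multilinear map `(x₀, …, x_{n+1}) ↦ x_{n+1} m x₀ ⊗ π x₁ ⊗ ⋯ ⊗ π xₙ`. -/
def chainWord (P : BimoduleData k E M) (π : E →ₗ[k] A) (m : M) (n : ℕ) :
    MultilinearMap k (fun _ : Fin (n + 2) => E) (Chains k A M n) where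
  toFun x := elem (P.l (x (Fin.last _)) (P.r (x 0) m)) fun i => π (x i.castSucc.succ)
  map_update_add' x p y z := by
    rename_i inst
    obtain rfl : inst = instDecidableEqFin _ := Subsingleton.elim _ _
    obtain ⟨L, hL⟩ := chainWord_update P π m x p
    rw [hL, hL, hL, map_add]
  map_update_smul' x p c y := by
    rename_i inst
    obtain rfl : inst = instDecidableEqFin _ := Subsingleton.elim _ _
    obtain ⟨L, hL⟩ := chainWord_update P π m x p
    rw [hL, hL, map_smul]

theorem chainWord_apply (P : BimoduleData k E M) (π : E →ₗ[k] A) (m : M) (n : ℕ)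
    (x : Fin (n + 2) → E) : chainWord P π m n x =
      elem (P.l (x (Fin.last _)) (P.r (x 0) m)) fun i => π (x i.castSucc.succ) := rfl

/-- The faces of a word multiply adjacent letters. -/
theorem face_chainWord (P : BimoduleData k E M) (ι : A →ₐ[k] E) (π : E →ₗ[k] A)
    (hπ : ∀ a, π (ι a) = a) (m : M) {n : ℕ} (x : Fin (n + 3) → E)
    (hx : ∀ i : Fin (n + 1), x i.castSucc.succ ∈ ι.range) (j : Fin (n + 2)) :
    face (P.restrict ι) j (chainWord P π m (n + 1) x) = chainWord P π m n (contract j x) := by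
  have hι : ∀ i : Fin (n + 1), ι (π (x i.castSucc.succ)) = x i.castSucc.succ := by
    intro i
    obtain ⟨a, ha⟩ := hx i
    rw [← ha]
    exact congrArg ι (hπ a)
  have hw : faceWord j (fun i : Fin (n + 1) => π (x i.castSucc.succ)) =
      fun i => π (contract j x i.castSucc.succ) := by
    funext i
    obtain ⟨j, hj⟩ := j
    simp only [faceWord, contract, Fin.val_succ, Fin.val_castSucc]
    split_ifs
    · rfl
    · have h1 := hι i.castSucc
      have h2 := hι i.succ
      -- `π` is not assumed multiplicative; it respects this product because both letters lie in the
      -- image of `ι`.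
      change _ = π (x i.castSucc.castSucc.succ * x i.succ.castSucc.succ)
      rw [← h1, ← h2, hπ, hπ, ← map_mul ι, hπ]
    · rfl
  rw [chainWord_apply, chainWord_apply, face_elem, hw]
  congr 1
  obtain ⟨j, hj⟩ := j
  simp only [faceEnd, BimoduleData.restrict, LinearMap.comp_apply, AlgHom.toLinearMap_apply]
  rcases Nat.eq_zero_or_pos j with rfl | h0
  · have h1 := hι 0
    have h2 : contract (⟨0, hj⟩ : Fin (n + 2)) x 0 = x 0 * x 1 := by simp [contract]
    have h3 : contract (⟨0, hj⟩ : Fin (n + 2)) x (Fin.last (n + 1)) = x (Fin.last (n + 2)) := by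
      simp [contract]
    rw [if_pos rfl, h1, h2, h3, P.r_mul, ← P.l_r]
    rfl
  · rcases eq_or_ne j (n + 1) with rfl | h1
    · have h1 := hι (Fin.last n)
      have h2 : contract (⟨n + 1, hj⟩ : Fin (n + 2)) x 0 = x 0 := by simp [contract]
      have h3 : contract (⟨n + 1, hj⟩ : Fin (n + 2)) x (Fin.last (n + 1)) =
          x (Fin.last n).castSucc.succ * x (Fin.last (n + 2)) := by
        simp [contract]
        rfl
      rw [if_neg (by simp), if_pos rfl, h1, h2, h3, P.l_mul]
    · have h2 : contract (⟨j, hj⟩ : Fin (n + 2)) x 0 = x 0 := by simp [contract, h0]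
      have h3 : contract (⟨j, hj⟩ : Fin (n + 2)) x (Fin.last (n + 1)) = x (Fin.last (n + 2)) := by
        have h4 : ¬ (n + 1 < j) := by omega
        simp [contract, h4, Ne.symm h1]
      rw [if_neg (by exact h0.ne'), if_neg (by exact h1), h2, h3]
      rfl

section Word

variable {C : Type*} [Ring C] [Bialgebra k C]

/-- The chain `c ↦ g_{n+1}(c⁽ⁿ⁺²⁾) m g₀(c⁽¹⁾) ⊗ π g₁(c⁽²⁾) ⊗ ⋯ ⊗ π gₙ(c⁽ⁿ⁺¹⁾)`. -/
def wordChain (P : BimoduleData k E M) (π : E →ₗ[k] A) (m : M) {n : ℕ}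
    (g : Fin (n + 2) → WithConv (C →ₗ[k] E)) : C →ₗ[k] Chains k A M n :=
  word (chainWord P π m n) g

/-- `face_chainWord` holds letter by letter, and `word_contract` turns products of letters into
convolution products. Identities for faces thereby become identities in the convolution algebra. -/
theorem face_wordChain (P : BimoduleData k E M) (ι : A →ₐ[k] E) (π : E →ₗ[k] A)
    (hπ : ∀ a, π (ι a) = a) (m : M) {n : ℕ} (g : Fin (n + 3) → WithConv (C →ₗ[k] E))
    (hg : ∀ (i : Fin (n + 1)) c, g i.castSucc.succ c ∈ ι.range) (j : Fin (n + 2)) (c : C) :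
    face (P.restrict ι) j (wordChain P π m g c) = wordChain P π m (contract j g) c := by
  rw [wordChain, word, map_eval]
  refine LinearMap.congr_fun (word_contract j (chainWord P π m n)
    ((face (P.restrict ι) j).compMultilinearMap (chainWord P π m (n + 1))) g fun c => ?_) c
  exact face_chainWord P ι π hπ m (fun i => g i (c i)) (fun i => hg i _) j

theorem wordChain_mem (P : BimoduleData k E M) (Q : BimoduleData k A M) (π : E →ₗ[k] A) (m : M)
    (S : Subalgebra k A) {n : ℕ} (g : Fin (n + 2) → WithConv (C →ₗ[k] E)) (i : Fin n)
    (h : ∀ c, π (g i.castSucc.succ c) ∈ S) (c : C) : wordChain P π m g c ∈ relations Q S n :=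
  eval_mem _ _ (fun _ => degenerate_mem Q S _ _ i (h _)) c

/-- Two adjacent faces of a chain with a letter in `S` agree in the cyclic tensor product. -/
theorem face_sub_face_mem (P : BimoduleData k A M) (S : Subalgebra k A) {n : ℕ} (m : M)
    (a : Fin (n + 1) → A) (p : Fin (n + 1)) (hp : a p ∈ S) :
    face P p.castSucc (elem m a) - face P p.succ (elem m a) ∈ relations P S n := by
  convert balance_mem P S p p.2 (a p) hp m (fun i => a (p.succAbove i)) using 1
  rw [face_elem, face_elem]
  congr 2
  · obtain ⟨p, hq⟩ := p
    rcases Nat.eq_zero_or_pos p with rfl | h0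
    · simp [faceEnd, afterEnd]
    · have : p ≠ n + 1 := by omega
      simp [faceEnd, afterEnd, h0.ne', this]
  · funext ⟨q, hq⟩
    obtain ⟨p, hp'⟩ := p
    simp only [faceWord, afterWord, Fin.succAbove, Fin.lt_def, Fin.val_castSucc]
    split_ifs <;> first | omega | rfl | skip
    all_goals subst_vars; rfl
  · obtain ⟨p, hq⟩ := p
    rcases eq_or_ne p n with rfl | h0
    · simp [faceEnd, beforeEnd, Fin.last]
    · simp [faceEnd, beforeEnd, h0]
  · funext ⟨q, hq⟩
    obtain ⟨p, hp'⟩ := p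
    simp only [faceWord, beforeWord, Fin.succAbove, Fin.lt_def, Fin.val_castSucc, Fin.val_succ]
    split_ifs <;> first | omega | rfl | skip
    all_goals subst_vars; rfl

theorem face_sub_face_wordChain_mem (P : BimoduleData k E M) (ι : A →ₐ[k] E) (π : E →ₗ[k] A)
    (m : M) (S : Subalgebra k A) {n : ℕ} (g : Fin (n + 3) → WithConv (C →ₗ[k] E))
    (p : Fin (n + 1)) (h : ∀ c, π (g p.castSucc.succ c) ∈ S) (c : C) :
    face (P.restrict ι) p.castSucc (wordChain P π m g c) -
      face (P.restrict ι) p.succ (wordChain P π m g c) ∈ relations (P.restrict ι) S n := by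
  rw [← LinearMap.sub_apply, wordChain, word, map_eval]
  exact eval_mem _ _ (fun _ => face_sub_face_mem _ S _ _ p (h _)) c

/-- The relations in the cyclic tensor product in terms of faces. -/
theorem relations_le (P : BimoduleData k A M) (S : Subalgebra k A) {n : ℕ}
    (N : Submodule k (Chains k A M n))
    (h1 : ∀ (m : M) (a : Fin (n + 1) → A) (p : Fin (n + 1)), a p ∈ S →
      face P p.castSucc (elem m a) - face P p.succ (elem m a) ∈ N)
    (h2 : ∀ (m : M) (a : Fin n → A) (p : Fin n), a p ∈ S → elem m a ∈ N) :
    relations P S n ≤ N := by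
  refine Submodule.span_le.2 ?_
  rintro x (⟨j, s, m, a, rfl⟩ | ⟨m, a, ⟨p, hp⟩, rfl⟩)
  -- With `s` inserted as an extra letter in place `j`, its two adjacent faces multiply `s` into the
  -- preceding and into the following letter; their difference is the balancing relation.
  · have h := h1 m (j.insertNth (s : A) a : Fin (n + 1) → A) j (by simp)
    rw [face_elem, face_elem] at h
    have hs : ∀ i : Fin (n + 1), i = j → (j.insertNth (s : A) a : Fin (n + 1) → A) i = s := by
      rintro i rfl; simp
    have ha : ∀ (i : Fin (n + 1)) (q : Fin n), i = j.succAbove q →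
        (j.insertNth (s : A) a : Fin (n + 1) → A) i = a q := by
      rintro i q rfl; simp
    rw [SetLike.mem_coe]
    convert h using 3
    · rcases Fin.eq_zero_or_eq_succ j with rfl | ⟨j, rfl⟩
      · simp [faceEnd, afterEnd]
      · have : (j : ℕ) ≠ n := by omega
        simp [faceEnd, afterEnd, this]
    · funext q
      simp only [faceWord, afterWord, Fin.val_castSucc]
      split_ifs
      · omega
      · rw [ha q.castSucc q, hs q.succ]
        · ext; simp; omega
        · simp [Fin.succAbove, Fin.lt_def]; omega
      · rw [ha q.castSucc q]
        simp [Fin.succAbove, Fin.lt_def]; omega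
      · rw [ha q.succ q]
        simp [Fin.succAbove, Fin.lt_def]; omega
    · rcases eq_or_ne (j : ℕ) n with h | h
      · have : Fin.last n = j := Fin.ext h.symm
        simp [faceEnd, beforeEnd, h, this]
      · simp [faceEnd, beforeEnd, h]
    · funext q
      simp only [faceWord, beforeWord, Fin.val_succ]
      split_ifs
      · omega
      · rw [ha q.succ q, hs q.castSucc]
        · ext; simp; omega
        · simp [Fin.succAbove, Fin.lt_def]; omega
      · omega
      · rw [ha q.castSucc q]
        simp [Fin.succAbove, Fin.lt_def]; omega
      · omega
      · rw [ha q.succ q]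
        simp [Fin.succAbove, Fin.lt_def]; omega
  · exact h2 m a p hp

end Word

end RelChains

/-! ### Convolution algebras -/

namespace Convolution

open Coalgebra WithConv

variable {k C D E E' : Type*} [CommRing k] [AddCommGroup C] [Module k C] [Coalgebra k C]
  [AddCommGroup D] [Module k D] [Coalgebra k D] [Ring E] [Algebra k E] [Ring E'] [Algebra k E']

/-- Precomposition with a coalgebra map. -/
def pre (g : C →ₗc[k] D) : WithConv (D →ₗ[k] E) →* WithConv (C →ₗ[k] E) where
  toFun f := toConv (f.ofConv ∘ₗ g.toLinearMap)
  map_one' := by ext c; simp [LinearMap.convOne_def]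
  map_mul' f f' := congrArg toConv (LinearMap.convMul_comp_coalgHom_distrib f f' g)

/-- Postcomposition with an algebra map. -/
def post (φ : E →ₐ[k] E') : WithConv (C →ₗ[k] E) →* WithConv (C →ₗ[k] E') where
  toFun f := toConv (φ.toLinearMap ∘ₗ f.ofConv)
  map_one' := by ext c; simp [LinearMap.convOne_def]
  map_mul' f f' := congrArg toConv (LinearMap.algHom_comp_convMul_distrib φ f f')

theorem post_apply (φ : E →ₐ[k] E') (f : WithConv (C →ₗ[k] E)) (c : C) :
    post φ f c = φ (f c) := rfl

/-- The map `c ↦ ε(c) x`. -/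
def const (C : Type*) [AddCommGroup C] [Module k C] [Coalgebra k C] (x : E) :
    WithConv (C →ₗ[k] E) := toConv (counit.smulRight x)

theorem const_apply (x : E) (c : C) : const (k := k) C x c = counit (R := k) c • x := rfl

/-- By the counit law a constant factor acts by ordinary multiplication, so elements of the algebra
can appear in convolution identities. -/
theorem const_mul (x : E) (f : WithConv (C →ₗ[k] E)) (c : C) :
    (const (k := k) C x * f) c = x * f c := by
  rw [(ℛ k c).convMul_apply]
  simp only [const_apply, smul_mul_assoc, ← mul_smul_comm, ← map_smul, ← Finset.mul_sum, ← map_sum]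
  rw [sum_counit_smul]

theorem mul_const (x : E) (f : WithConv (C →ₗ[k] E)) (c : C) :
    (f * const (k := k) C x) c = f c * x := by
  have h2 := congrArg (TensorProduct.rid k C) (sum_tmul_counit_eq (ℛ k c))
  simp only [map_sum, TensorProduct.rid_tmul, one_smul] at h2
  rw [(ℛ k c).convMul_apply]
  simp only [const_apply, mul_smul_comm, ← smul_mul_assoc, ← map_smul, ← Finset.sum_mul, ← map_sum]
  rw [h2]

theorem pre_const (g : C →ₗc[k] D) (x : E) : pre g (const (k := k) D x) = const C x := by
  ext c
  change counit (R := k) (g c) • x = counit (R := k) c • x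
  rw [CoalgHomClass.counit_comp_apply]

omit [Coalgebra k C] in
theorem ext_apply {f g : WithConv (C →ₗ[k] E)} (h : ∀ c, f c = g c) : f = g :=
  WithConv.ext (LinearMap.ext h)

end Convolution

namespace HopfAlgebra

open Coalgebra WithConv Convolution

variable {k H : Type*} [CommRing k] [Ring H] [HopfAlgebra k H]

/-- The antipode is an antihomomorphism of coalgebras. -/
theorem comul_comp_antipode : comul ∘ₗ antipode k (A := H) =
    TensorProduct.map (antipode k) (antipode k) ∘ₗ
      (TensorProduct.comm k H H).toLinearMap ∘ₗ comul := by
  -- In `Hom(H, H ⊗ H)` the product `s₂ * s₁` is a left inverse of `comul = j₁ * j₂`, and `comul ∘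
  -- S` is a right inverse; the two therefore coincide.
  let i₁ : H →ₐ[k] H ⊗[k] H := Algebra.TensorProduct.includeLeft
  let i₂ : H →ₐ[k] H ⊗[k] H := Algebra.TensorProduct.includeRight
  let j₁ : WithConv (H →ₗ[k] H ⊗[k] H) := post i₁ (toConv LinearMap.id)
  let j₂ : WithConv (H →ₗ[k] H ⊗[k] H) := post i₂ (toConv LinearMap.id)
  let s₁ : WithConv (H →ₗ[k] H ⊗[k] H) := post i₁ (toConv (antipode k))
  let s₂ : WithConv (H →ₗ[k] H ⊗[k] H) := post i₂ (toConv (antipode k))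
  have h1 : s₁ * j₁ = 1 := by
    rw [← map_mul, LinearMap.antipode_mul_id, map_one]
  have h2 : s₂ * j₂ = 1 := by
    rw [← map_mul, LinearMap.antipode_mul_id, map_one]
  have hj : j₁ * j₂ = toConv comul := by
    refine ext_apply fun c => ?_
    rw [(ℛ k c).convMul_apply]
    refine Eq.trans (Finset.sum_congr rfl fun i _ => ?_) (ℛ k c).eq
    change (((ℛ k c).left i) ⊗ₜ[k] (1 : H)) * ((1 : H) ⊗ₜ[k] ((ℛ k c).right i)) = _
    simp
  have hs : s₂ * s₁ = toConv (TensorProduct.map (antipode k) (antipode k) ∘ₗ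
      (TensorProduct.comm k H H).toLinearMap ∘ₗ comul) := by
    refine ext_apply fun c => ?_
    rw [(ℛ k c).convMul_apply]
    change _ = TensorProduct.map (antipode k) (antipode k) (TensorProduct.comm k H H (comul c))
    rw [← (ℛ k c).eq]
    simp only [map_sum]
    refine Finset.sum_congr rfl fun i _ => ?_
    change ((1 : H) ⊗ₜ[k] antipode k ((ℛ k c).left i)) *
      (antipode k ((ℛ k c).right i) ⊗ₜ[k] (1 : H)) = _
    simp
  have h3 : toConv comul * toConv (comul ∘ₗ antipode k (A := H)) = 1 := LinearMap.comul_right_inv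
  have h4 : s₂ * s₁ * toConv comul = 1 := by
    rw [← hj, mul_assoc, ← mul_assoc s₁, h1, one_mul, h2]
  have := left_inv_eq_right_inv h4 h3
  rw [hs] at this
  exact (congrArg ofConv this).symm

end HopfAlgebra

/-! ### The crossed product through its convolution algebras -/

namespace CrossedProduct

open Coalgebra WithConv Convolution

variable {k A H : Type*} [CommRing k] [Ring A] [Algebra k A] [Ring H] [HopfAlgebra k H]
  (X : CrossedSystem k A H)

theorem cocycleProd_tmul (f : H ⊗[k] H →ₗ[k] A) (h l : H) :
    WeakAction.cocycleProd f (h ⊗ₜ l) = ∑ i ∈ (ℛ k h).index, ∑ j ∈ (ℛ k l).index,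
      f ((ℛ k h).left i ⊗ₜ (ℛ k l).left j) ⊗ₜ[k] ((ℛ k h).right i * (ℛ k l).right j) := by
  simp only [WeakAction.cocycleProd, LinearMap.comp_apply, TensorProduct.map_tmul]
  rw [← (ℛ k h).eq, ← (ℛ k l).eq]
  simp only [TensorProduct.sum_tmul, TensorProduct.tmul_sum, map_sum, LinearEquiv.coe_coe,
    TensorProduct.tensorTensorTensorComm_tmul, TensorProduct.map_tmul, LinearMap.mul'_apply]
  exact Finset.sum_comm

theorem crossedAux_comul (α : WeakAction k A H) (f : H ⊗[k] H →ₗ[k] A) (a b : A) (h l : H) :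
    α.crossedAux f a b l (comul h) = ∑ i ∈ (ℛ k h).index,
      (a * α.act ((ℛ k h).left i) b) • WeakAction.cocycleProd f ((ℛ k h).right i ⊗ₜ l) := by
  rw [← (ℛ k h).eq, map_sum]
  rfl

theorem crossedAux_one (α : WeakAction k A H) (f : H ⊗[k] H →ₗ[k] A) (h l : H) :
    α.crossedAux f 1 1 l (comul h) = WeakAction.cocycleProd f (h ⊗ₜ l) := by
  rw [crossedAux_comul]
  simp only [α.act_one, one_mul, smul_assoc, one_smul, ← map_smul, TensorProduct.smul_tmul',
    ← map_sum, ← TensorProduct.sum_tmul]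
  rw [sum_counit_smul]

theorem cocycleProd_one_left (l : H) : WeakAction.cocycleProd X.f (1 ⊗ₜ l) = 1 ⊗ₜ l := by
  have := X.crossed_one_mul (1 ⊗ₜ l)
  rwa [WeakAction.crossedMul_tmul, crossedAux_one] at this

theorem cocycleProd_one_right (h : H) : WeakAction.cocycleProd X.f (h ⊗ₜ 1) = 1 ⊗ₜ h := by
  have := X.crossed_mul_one (1 ⊗ₜ h)
  rwa [WeakAction.crossedMul_tmul, crossedAux_one] at this

theorem inclA_mul_tmul (a b : A) (h : H) : inclA X a * tmul X b h = tmul X (a * b) h := by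
  change X.toWeakAction.crossedMul X.f (a ⊗ₜ 1) (b ⊗ₜ h) = (a * b) ⊗ₜ[k] h
  rw [WeakAction.crossedMul_tmul, Bialgebra.comul_one, Algebra.TensorProduct.one_def,
    WeakAction.crossedAux_tmul, X.one_act, cocycleProd_one_left, TensorProduct.smul_tmul',
    smul_eq_mul, mul_one]

theorem tmul_eq (a : A) (h : H) : tmul X a h = inclA X a * inclH X h := by
  change _ = inclA X a * tmul X 1 h
  rw [inclA_mul_tmul, mul_one]

theorem inclH_one : inclH X 1 = 1 := rfl

theorem induction {p : CrossedProduct X → Prop} (h0 : p 0)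
    (h1 : ∀ a h, p (inclA X a * inclH X h)) (h2 : ∀ x y, p x → p y → p (x + y)) (x) : p x :=
  TensorProduct.induction_on (motive := p) x h0 (fun a h => by
    have := h1 a h
    rw [← tmul_eq] at this
    exact this) h2

theorem inclH_mul_inclA (h : H) (a : A) : inclH X h * inclA X a = ∑ i ∈ (ℛ k h).index,
    inclA X (X.act ((ℛ k h).left i) a) * inclH X ((ℛ k h).right i) := by
  change X.toWeakAction.crossedMul X.f (1 ⊗ₜ h) (a ⊗ₜ 1) = _
  rw [WeakAction.crossedMul_tmul, crossedAux_comul]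
  refine Finset.sum_congr rfl fun i _ => ?_
  rw [cocycleProd_one_right, one_mul, ← tmul_eq, TensorProduct.smul_tmul', smul_eq_mul, mul_one]
  rfl

theorem inclH_mul_inclH (h l : H) : inclH X h * inclH X l =
    ∑ i ∈ (ℛ k h).index, ∑ j ∈ (ℛ k l).index,
      inclA X (X.f ((ℛ k h).left i ⊗ₜ (ℛ k l).left j)) *
        inclH X ((ℛ k h).right i * (ℛ k l).right j) := by
  change X.toWeakAction.crossedMul X.f (1 ⊗ₜ h) (1 ⊗ₜ l) = _
  rw [WeakAction.crossedMul_tmul, crossedAux_one, cocycleProd_tmul]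
  simp only [← tmul_eq]
  rfl

/-- The map `h ↦ 1 # h` in the convolution algebra. -/
def convH : WithConv (H →ₗ[k] CrossedProduct X) := toConv (inclH X)

/-- The map `h ↦ (1 # h)⁻¹` in the convolution algebra. -/
def convHInv : WithConv (H →ₗ[k] CrossedProduct X) := toConv (inclHInv X)

/-- The map `h ↦ a^h # 1` in the convolution algebra. -/
def convAct (a : A) : WithConv (H →ₗ[k] CrossedProduct X) :=
  toConv ((inclA X).toLinearMap ∘ₗ X.act.flip a)

theorem convH_apply (h : H) : convH X h = inclH X h := rfl
theorem convHInv_apply (h : H) : convHInv X h = inclHInv X h := rfl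
theorem convAct_apply (a : A) (h : H) : convAct X a h = inclA X (X.act h a) := rfl

/-- The commutation rule `(1 # h) a = a^{h⁽¹⁾} (1 # h⁽²⁾)` of the crossed product, as an identity of
functions of `h`. -/
theorem convH_mul_const (a : A) :
    convH X * const H (inclA X a) = convAct X a * convH X := by
  refine ext_apply fun h => ?_
  rw [mul_const, (ℛ k h).convMul_apply]
  exact inclH_mul_inclA X h a

theorem convAct_mul (a b : A) : convAct X (a * b) = convAct X a * convAct X b := by
  refine ext_apply fun h => ?_
  rw [(ℛ k h).convMul_apply, convAct_apply, X.act_mul, ← (ℛ k h).eq]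
  simp [map_sum, convAct_apply]

/-- The projections of `H ⊗ H` to `H`. -/
def projLeft (k H : Type*) [CommRing k] [Ring H] [HopfAlgebra k H] : H ⊗[k] H →ₗc[k] H :=
  (Coalgebra.TensorProduct.rid k k H).toCoalgHom.comp
    (Coalgebra.TensorProduct.map (CoalgHom.id k H) (Coalgebra.counitCoalgHom k H))

/-- The projections of `H ⊗ H` to `H`. -/
def projRight (k H : Type*) [CommRing k] [Ring H] [HopfAlgebra k H] : H ⊗[k] H →ₗc[k] H :=
  (Coalgebra.TensorProduct.lid k H).toCoalgHom.comp
    (Coalgebra.TensorProduct.map (Coalgebra.counitCoalgHom k H) (CoalgHom.id k H))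

theorem projLeft_tmul (h l : H) : projLeft k H (h ⊗ₜ l) = counit (R := k) l • h := rfl
theorem projRight_tmul (h l : H) : projRight k H (h ⊗ₜ l) = counit (R := k) h • l := rfl

theorem sum_counit_smul_right (h : H) :
    ∑ i ∈ (ℛ k h).index, counit (R := k) ((ℛ k h).right i) • (ℛ k h).left i = h := by
  have h2 := congrArg (TensorProduct.rid k H) (sum_tmul_counit_eq (ℛ k h))
  simpa only [map_sum, TensorProduct.rid_tmul, one_smul] using h2

theorem map_eq_sum_right {E : Type*} [AddCommGroup E] [Module k E] (f : H →ₗ[k] E) (h : H) :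
    f h = ∑ i ∈ (ℛ k h).index, counit (R := k) ((ℛ k h).right i) • f ((ℛ k h).left i) := by
  conv_lhs => rw [← sum_counit_smul_right (k := k) h]
  simp only [map_sum, map_smul]

theorem map_eq_sum_left {E : Type*} [AddCommGroup E] [Module k E] (f : H →ₗ[k] E) (h : H) :
    f h = ∑ i ∈ (ℛ k h).index, counit (R := k) ((ℛ k h).left i) • f ((ℛ k h).right i) := by
  conv_lhs => rw [← sum_counit_smul (ℛ k h)]
  simp only [map_sum, map_smul]

/-- The counits in the two projections collapse the comultiplications of `h` and `l`. Functions of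
two variables are thus products in `Hom(H ⊗ H, E)`, and in the companion lemma the values are
multiplied in the opposite order. -/
theorem pre_projLeft_mul_pre_projRight {E : Type*} [Ring E] [Algebra k E]
    (f g : WithConv (H →ₗ[k] E)) (h l : H) :
    (pre (projLeft k H) f * pre (projRight k H) g) (h ⊗ₜ l) = f h * g l := by
  have hf : f h = _ := map_eq_sum_right f.ofConv h
  have hg : g l = _ := map_eq_sum_left g.ofConv l
  rw [((ℛ k h).tmul (ℛ k l)).convMul_apply, hf, hg, Finset.sum_mul_sum, ← Finset.sum_product']
  refine Finset.sum_congr rfl fun p _ => ?_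
  rw [smul_mul_smul_comm]
  change f (projLeft k H ((ℛ k h).left p.1 ⊗ₜ (ℛ k l).left p.2)) *
    g (projRight k H ((ℛ k h).right p.1 ⊗ₜ (ℛ k l).right p.2)) = _
  rw [projLeft_tmul, projRight_tmul, map_smul, map_smul, smul_mul_smul_comm, mul_comm (counit _)]

theorem pre_projRight_mul_pre_projLeft {E : Type*} [Ring E] [Algebra k E]
    (f g : WithConv (H →ₗ[k] E)) (h l : H) :
    (pre (projRight k H) f * pre (projLeft k H) g) (h ⊗ₜ l) = f l * g h := by
  have hf : f l = _ := map_eq_sum_right f.ofConv l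
  have hg : g h = _ := map_eq_sum_left g.ofConv h
  rw [((ℛ k h).tmul (ℛ k l)).convMul_apply, hf, hg, Finset.sum_mul_sum, Finset.sum_comm,
    ← Finset.sum_product']
  refine Finset.sum_congr rfl fun p _ => ?_
  rw [smul_mul_smul_comm]
  change f (projRight k H ((ℛ k h).left p.1 ⊗ₜ (ℛ k l).left p.2)) *
    g (projLeft k H ((ℛ k h).right p.1 ⊗ₜ (ℛ k l).right p.2)) = _
  rw [projLeft_tmul, projRight_tmul, map_smul, map_smul, smul_mul_smul_comm, mul_comm (counit _)]

/-- The map `h ⊗ l ↦ f(h, l) # 1` in the convolution algebra. -/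
def convF : WithConv (H ⊗[k] H →ₗ[k] CrossedProduct X) := post (inclA X) (toConv X.f)

/-- The map `h ⊗ l ↦ f⁻¹(h, l) # 1` in the convolution algebra. -/
def convFInv : WithConv (H ⊗[k] H →ₗ[k] CrossedProduct X) := post (inclA X) (toConv (fInv X))

theorem convF_apply (c : H ⊗[k] H) : convF X c = inclA X (X.f c) := rfl

variable {X} in
theorem convFInv_mul_convF (hf : IsUnit (toConv X.f)) : convFInv X * convF X = 1 := by
  rw [convF, convFInv, ← map_mul]
  exact (congrArg _ (Ring.inverse_mul_cancel _ hf)).trans (map_one _)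

theorem conv_ext_tmul {E : Type*} [Ring E] [Algebra k E]
    {f g : WithConv (H ⊗[k] H →ₗ[k] E)} (h : ∀ x y, f (x ⊗ₜ y) = g (x ⊗ₜ y)) : f = g :=
  WithConv.ext (TensorProduct.ext' h)

/-- This is `(1 # h)(1 # l) = f(h⁽¹⁾, l⁽¹⁾) # h⁽²⁾ l⁽²⁾` in a form that permits cancelling `f` or `1
# hl`. -/
theorem pre_convH_mul_pre_convH :
    pre (projLeft k H) (convH X) * pre (projRight k H) (convH X) =
      convF X * pre (Bialgebra.mulCoalgHom k H) (convH X) := by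
  refine conv_ext_tmul fun h l => ?_
  rw [pre_projLeft_mul_pre_projRight, convH_apply, convH_apply, inclH_mul_inclH,
    ((ℛ k h).tmul (ℛ k l)).convMul_apply, ← Finset.sum_product']
  rfl

/-- The map `h ↦ f⁻¹(S(h⁽¹⁾), h⁽²⁾)`. -/
def fInvAntipode : H →ₗ[k] A := fInv X ∘ₗ (HopfAlgebra.antipode k).rTensor H ∘ₗ comul

theorem fInvAntipode_apply (h : H) : fInvAntipode X h = ∑ j ∈ (ℛ k h).index,
    fInv X (HopfAlgebra.antipode k ((ℛ k h).left j) ⊗ₜ (ℛ k h).right j) := by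
  rw [fInvAntipode, LinearMap.comp_apply, LinearMap.comp_apply]
  conv_lhs => rw [← (ℛ k h).eq]
  simp only [map_sum, LinearMap.rTensor_tmul]

theorem inclHInv_apply (h : H) : inclHInv X h = ∑ i ∈ (ℛ k h).index,
    inclA X (fInvAntipode X ((ℛ k h).right i)) *
      inclH X (HopfAlgebra.antipode k ((ℛ k h).left i)) := by
  change TensorProduct.comm k H A (TensorProduct.map (HopfAlgebra.antipode k)
    (fInv X ∘ₗ (HopfAlgebra.antipode k).rTensor H) (comul.lTensor H (comul h))) = _
  simp only [← tmul_eq]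
  rw [← (ℛ k h).eq]
  simp only [map_sum]
  rfl

/-- Coassociativity for four factors: it turns the nested sums in the definition of `(1 # h⁽¹⁾)⁻¹ (1
# h⁽²⁾)` into a sum over `h⁽¹⁾` and `h⁽²⁾` separately comultiplied. -/
theorem _root_.IterComul.sum_quadrilinear {C Z : Type*} [AddCommGroup C] [Module k C]
    [Coalgebra k C] [AddCommGroup Z] [Module k Z]
    (t : C →ₗ[k] C →ₗ[k] C →ₗ[k] C →ₗ[k] Z) (c : C) :
    ∑ i ∈ (ℛ k c).index, ∑ j ∈ (ℛ k ((ℛ k c).left i)).index,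
      ∑ l ∈ (ℛ k ((ℛ k ((ℛ k c).left i)).right j)).index,
        t ((ℛ k ((ℛ k c).left i)).left j) ((ℛ k ((ℛ k ((ℛ k c).left i)).right j)).left l)
          ((ℛ k ((ℛ k ((ℛ k c).left i)).right j)).right l) ((ℛ k c).right i) =
    ∑ i ∈ (ℛ k c).index, ∑ j ∈ (ℛ k ((ℛ k c).left i)).index,
      ∑ l ∈ (ℛ k ((ℛ k c).right i)).index,
        t ((ℛ k ((ℛ k c).left i)).left j) ((ℛ k ((ℛ k c).left i)).right j)
          ((ℛ k ((ℛ k c).right i)).left l) ((ℛ k ((ℛ k c).right i)).right l) := by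
  let t₁ : C →ₗ[k] C →ₗ[k] C →ₗ[k] Z := LinearMap.lcomp k (C →ₗ[k] Z) comul ∘ₗ
    (TensorProduct.lift.equiv (RingHom.id k) C C (C →ₗ[k] Z)).toLinearMap ∘ₗ t
  let t₂ : C →ₗ[k] C →ₗ[k] C →ₗ[k] Z := LinearMap.compr₂ t (LinearMap.lcomp k Z comul ∘ₗ
    (TensorProduct.lift.equiv (RingHom.id k) C C Z).toLinearMap)
  have h1 : ∀ x y z, t₁ x y z = ∑ l ∈ (ℛ k y).index, t x ((ℛ k y).left l) ((ℛ k y).right l) z := by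
    intro x y z
    refine (LinearMap.congr_fun (IterComul.lift_comul (t x) (ℛ k y)) z).trans ?_
    rw [LinearMap.sum_apply]
  have h2 : ∀ x y z, t₂ x y z = ∑ l ∈ (ℛ k z).index, t x y ((ℛ k z).left l) ((ℛ k z).right l) :=
    fun x y z => IterComul.lift_comul (t x y) (ℛ k z)
  have e1 := IterComul.sum_trilinear t₁ (ℛ k c)
  have e2 := IterComul.sum_trilinear t₂ (ℛ k c)
  simp only [h1] at e1
  simp only [h2] at e2
  rw [e1, e2]
  exact Finset.sum_congr rfl fun i _ => IterComul.sum_trilinear (t _) _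

omit [Ring A] [Algebra k A] in
theorem _root_.HopfAlgebra.comul_antipode (h : H) : comul (HopfAlgebra.antipode k h) = ∑ i ∈ (ℛ k h).index,
    HopfAlgebra.antipode k ((ℛ k h).right i) ⊗ₜ[k] HopfAlgebra.antipode k ((ℛ k h).left i) := by
  refine (LinearMap.congr_fun HopfAlgebra.comul_comp_antipode h).trans ?_
  rw [LinearMap.comp_apply, LinearMap.comp_apply]
  conv_lhs => rw [← (ℛ k h).eq]
  simp

/-- The representation of the comultiplication of `S(h)` by that of `h`. -/
def _root_.HopfAlgebra.reprAntipode (h : H) :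
    Repr k (HopfAlgebra.antipode k h) (H × H) where
  index := (ℛ k h).index
  left i := HopfAlgebra.antipode k ((ℛ k h).right i)
  right i := HopfAlgebra.antipode k ((ℛ k h).left i)
  eq := (HopfAlgebra.comul_antipode h).symm

-- Cancelling `f` gives `f⁻¹(h⁽¹⁾, l⁽¹⁾)(1 # h⁽²⁾)(1 # l⁽²⁾) = 1 # hl`. At `S(h⁽¹⁾) ⊗ h⁽²⁾` the
-- right side is `ε(h)`. On the left the antipode reverses the comultiplication, which produces
-- exactly the defining formula of `(1 # h)⁻¹`.
variable {X} in
theorem convHInv_mul_convH (hf : IsUnit (toConv X.f)) : convHInv X * convH X = 1 := by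
  have hK : convFInv X * (pre (projLeft k H) (convH X) * pre (projRight k H) (convH X)) =
      pre (Bialgebra.mulCoalgHom k H) (convH X) := by
    rw [pre_convH_mul_pre_convH, ← mul_assoc, convFInv_mul_convF hf, one_mul]
  let t : H →ₗ[k] H →ₗ[k] H →ₗ[k] H →ₗ[k] CrossedProduct X := LinearMap.mk₂ k
    (fun a b => (LinearMap.mul k (CrossedProduct X) ∘ₗ
      LinearMap.mulRight k (inclH X (HopfAlgebra.antipode k a)) ∘ₗ (inclA X).toLinearMap ∘ₗ
        fInv X ∘ₗ TensorProduct.mk k H H (HopfAlgebra.antipode k b)).compl₂ (inclH X))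
    (fun a a' b => by ext; simp [mul_add])
    (fun c a b => by ext; simp)
    (fun a b b' => by ext; simp [add_mul])
    (fun c a b => by ext; simp)
  have ht : ∀ a b c d, t a b c d = inclA X (fInv X (HopfAlgebra.antipode k b ⊗ₜ c)) *
    inclH X (HopfAlgebra.antipode k a) * inclH X d := fun a b c d => rfl
  have hL : ∀ h l : H, inclH X (HopfAlgebra.antipode k h * l) =
      ∑ i ∈ (ℛ k h).index, ∑ j ∈ (ℛ k l).index,
        t ((ℛ k h).left i) ((ℛ k h).right i) ((ℛ k l).left j) ((ℛ k l).right j) := by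
    intro h l
    have := congrArg (fun g => g (HopfAlgebra.antipode k h ⊗ₜ[k] l)) hK
    refine this.symm.trans ?_
    rw [((HopfAlgebra.reprAntipode h).tmul (ℛ k l)).convMul_apply, ← Finset.sum_product']
    refine Finset.sum_congr rfl fun p _ => ?_
    rw [ht, mul_assoc]
    congr 1
    exact pre_projLeft_mul_pre_projRight _ _ _ _
  refine ext_apply fun h => ?_
  rw [(ℛ k h).convMul_apply]
  have h4 := (IterComul.sum_quadrilinear t h).trans
    (Finset.sum_congr rfl fun i _ => (hL _ _).symm)
  simp only [ht] at h4
  rw [← map_sum, HopfAlgebra.sum_antipode_mul_eq_smul] at h4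
  refine Eq.trans (Finset.sum_congr rfl fun i _ => ?_) (h4.trans ?_)
  · rw [convHInv_apply, inclHInv_apply, Finset.sum_mul]
    refine Finset.sum_congr rfl fun j _ => ?_
    rw [fInvAntipode_apply, map_sum, Finset.sum_mul, Finset.sum_mul]
    rfl
  · rw [map_smul, inclH_one]
    simp [LinearMap.convOne_def, Algebra.algebraMap_eq_smul_one]

/-! ### The coaction of `H` and the right inverse -/

/-- The coaction `a # h ↦ (a # h⁽¹⁾) ⊗ h⁽²⁾`. -/
def coact : CrossedProduct X →ₗ[k] CrossedProduct X ⊗[k] H :=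
  (TensorProduct.assoc k A H H).symm.toLinearMap ∘ₗ (comul (R := k) (A := H)).lTensor A

/-- The map `a # h ↦ ε(h) a`. -/
def retr : CrossedProduct X →ₗ[k] A :=
  (TensorProduct.rid k A).toLinearMap ∘ₗ (counit (R := k) (A := H)).lTensor A

theorem retr_inclA_mul_inclH (a : A) (h : H) :
    retr X (inclA X a * inclH X h) = counit (R := k) h • a := by
  rw [← tmul_eq]
  rfl

theorem retr_inclA (a : A) : retr X (inclA X a) = a := by
  have := retr_inclA_mul_inclH X a 1
  rwa [inclH_one, mul_one, Bialgebra.counit_one, one_smul] at this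

theorem coact_tmul (a : A) {h : H} {ι : Type*} (R : Repr k h ι) : coact X (tmul X a h) =
    ∑ i ∈ R.index, tmul X a (R.left i) ⊗ₜ[k] R.right i := by
  change (TensorProduct.assoc k A H H).symm (a ⊗ₜ comul h) = _
  conv_lhs => rw [← R.eq]
  simp only [TensorProduct.tmul_sum, map_sum]
  rfl

theorem coact_inclA_mul (a : A) (x : CrossedProduct X) :
    coact X (inclA X a * x) = (inclA X a ⊗ₜ[k] (1 : H)) * coact X x := by
  induction x using induction with
  | h0 => simp
  | h1 b h =>
    rw [← tmul_eq, inclA_mul_tmul, coact_tmul X _ (ℛ k h), coact_tmul X _ (ℛ k h), Finset.mul_sum]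
    refine Finset.sum_congr rfl fun i _ => ?_
    rw [Algebra.TensorProduct.tmul_mul_tmul, inclA_mul_tmul, one_mul]
  | h2 x y hx hy => rw [mul_add, map_add, hx, hy, map_add, mul_add]

/-- The inclusion of `E` into `E ⊗ H`. -/
def inclLeft : CrossedProduct X →ₐ[k] CrossedProduct X ⊗[k] H :=
  Algebra.TensorProduct.includeLeft

/-- The inclusion of `H` into `E ⊗ H`. -/
def inclRight : H →ₐ[k] CrossedProduct X ⊗[k] H := Algebra.TensorProduct.includeRight

theorem convCoact_inclH : toConv (coact X ∘ₗ inclH X) =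
    post (inclLeft X) (convH X) *
      post (inclRight X) (toConv (LinearMap.id (R := k) (M := H))) := by
  refine ext_apply fun h => ?_
  rw [(ℛ k h).convMul_apply]
  refine (coact_tmul X 1 (ℛ k h)).trans (Finset.sum_congr rfl fun i _ => ?_)
  change _ = (inclH X ((ℛ k h).left i) ⊗ₜ[k] (1 : H)) *
    ((1 : CrossedProduct X) ⊗ₜ[k] ((ℛ k h).right i))
  rw [Algebra.TensorProduct.tmul_mul_tmul, mul_one, one_mul]
  rfl

/-- On `1 # h` the coaction is the convolution product of `1 # h` in `E` and of `h` in the second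
factor. The latter commutes with `b ⊗ 1`, so the commutation rule in `E` suffices. -/
theorem coact_inclH_mul_inclA (h : H) (b : A) :
    coact X (inclH X h * inclA X b) = coact X (inclH X h) * (inclA X b ⊗ₜ[k] (1 : H)) := by
  have h1 := congrArg (post (inclLeft X)) (convH_mul_const X b)
  rw [map_mul, map_mul] at h1
  have h2 : toConv (coact X ∘ₗ inclH X) * const (k := k) H (inclA X b ⊗ₜ[k] (1 : H)) =
      post (inclLeft X) (convAct X b) * toConv (coact X ∘ₗ inclH X) := by
    have h3 : post (inclLeft X) (const (k := k) H (inclA X b)) =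
        const (k := k) H (inclA X b ⊗ₜ[k] (1 : H)) := by
      refine ext_apply fun h => ?_
      rw [post_apply, const_apply, const_apply, map_smul]
      rfl
    have h4 : post (inclRight X) (toConv (LinearMap.id (R := k) (M := H))) *
        const (k := k) H (inclA X b ⊗ₜ[k] (1 : H)) = const (k := k) H (inclA X b ⊗ₜ[k] (1 : H)) *
        post (inclRight X) (toConv (LinearMap.id (R := k) (M := H))) := by
      refine ext_apply fun h => ?_
      rw [mul_const, const_mul]
      change ((1 : CrossedProduct X) ⊗ₜ[k] h) * (inclA X b ⊗ₜ[k] (1 : H)) =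
        (inclA X b ⊗ₜ[k] (1 : H)) * ((1 : CrossedProduct X) ⊗ₜ[k] h)
      simp
    rw [h3] at h1
    rw [convCoact_inclH]
    exact (mul_assoc _ _ _).trans <| (congrArg _ h4).trans <| (mul_assoc _ _ _).symm.trans <|
      (congrArg (· * _) h1).trans (mul_assoc _ _ _)
  have h5 := congrArg (fun g => g h) h2
  simp only [mul_const] at h5
  refine Eq.trans ?_ h5.symm
  rw [(ℛ k h).convMul_apply, inclH_mul_inclA, map_sum]
  exact Finset.sum_congr rfl fun i _ => coact_inclA_mul X _ _

/-- The `H`-component of the first factor commutes with the `E`-component of the second. After this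
exchange the two `E`-components multiply through `f` and the two `H`-components multiply in `H`. -/
theorem coact_inclH_mul_inclH (h l : H) :
    coact X (inclH X h * inclH X l) = coact X (inclH X h) * coact X (inclH X l) := by
  let μ := Bialgebra.mulCoalgHom k H
  let j := post (inclRight X) (toConv (LinearMap.id (R := k) (M := H)))
  have hu : toConv (coact X ∘ₗ inclH X) = post (inclLeft X) (convH X) * j := convCoact_inclH X
  have hjj : pre (projLeft k H) j * pre (projRight k H) j = pre μ j := by
    refine conv_ext_tmul fun h l => ?_
    rw [pre_projLeft_mul_pre_projRight]
    exact (map_mul (inclRight X) h l).symm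
  have hju : pre (projLeft k H) j * pre (projRight k H) (post (inclLeft X) (convH X)) =
      pre (projRight k H) (post (inclLeft X) (convH X)) * pre (projLeft k H) j := by
    refine conv_ext_tmul fun h l => ?_
    rw [pre_projLeft_mul_pre_projRight, pre_projRight_mul_pre_projLeft]
    change ((1 : CrossedProduct X) ⊗ₜ[k] h) * (inclH X l ⊗ₜ[k] (1 : H)) =
        (inclH X l ⊗ₜ[k] (1 : H)) * ((1 : CrossedProduct X) ⊗ₜ[k] h)
    simp
  have huu : pre (projLeft k H) (post (inclLeft X) (convH X)) * pre (projRight k H) (post (inclLeft X) (convH X)) =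
      post (inclLeft X) (convF X) * pre μ (post (inclLeft X) (convH X)) := by
    have := congrArg (post (inclLeft X)) (pre_convH_mul_pre_convH X)
    rwa [map_mul, map_mul] at this
  have key : pre (projLeft k H) (toConv (coact X ∘ₗ inclH X)) *
      pre (projRight k H) (toConv (coact X ∘ₗ inclH X)) =
      post (inclLeft X) (convF X) * pre μ (toConv (coact X ∘ₗ inclH X)) := by
    rw [hu]
    simp only [map_mul]
    rw [mul_assoc, ← mul_assoc _ (pre (projRight k H) (post (inclLeft X) (convH X))), hju, ← hjj]
    simp only [← mul_assoc]
    rw [huu]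
  have h5 := congrArg (fun g => g (h ⊗ₜ[k] l)) key
  simp only [pre_projLeft_mul_pre_projRight] at h5
  refine Eq.trans ?_ h5.symm
  rw [((ℛ k h).tmul (ℛ k l)).convMul_apply, inclH_mul_inclH, ← Finset.sum_product', map_sum]
  exact Finset.sum_congr rfl fun i _ => coact_inclA_mul X _ _

/-- Left `A`-linearity reduces to `x = 1 # h`; then `b` is moved to the left of `1 # h`, which
leaves the product of two elements `1 # h`, `1 # l`. -/
theorem coact_mul (x y : CrossedProduct X) : coact X (x * y) = coact X x * coact X y := by
  induction x using induction with
  | h0 => simp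
  | h2 x x' hx hx' => rw [add_mul, map_add, hx, hx', map_add, add_mul]
  | h1 a h =>
    rw [mul_assoc, coact_inclA_mul, coact_inclA_mul, mul_assoc]
    congr 1
    induction y using induction with
    | h0 => simp
    | h2 y y' hy hy' => rw [mul_add, map_add, hy, hy', map_add, mul_add]
    | h1 b l =>
      rw [← mul_assoc, inclH_mul_inclA, Finset.sum_mul, map_sum]
      simp only [mul_assoc, coact_inclA_mul, coact_inclH_mul_inclH]
      simp only [← mul_assoc, ← coact_inclA_mul, ← Finset.sum_mul, ← map_sum]
      rw [← inclH_mul_inclA, coact_inclH_mul_inclA, mul_assoc, coact_inclA_mul]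

theorem convCoact_inclHInv : toConv (coact X ∘ₗ inclHInv X) =
    post (inclRight X) (toConv (HopfAlgebra.antipode k)) *
      post (inclLeft X) (convHInv X) := by
  refine ext_apply fun h => ?_
  let t : H →ₗ[k] H →ₗ[k] H →ₗ[k] CrossedProduct X ⊗[k] H := LinearMap.mk₂ k
    (fun a b => (TensorProduct.mk k (CrossedProduct X) H).flip (HopfAlgebra.antipode k a) ∘ₗ
      LinearMap.mulRight k (inclH X (HopfAlgebra.antipode k b)) ∘ₗ (inclA X).toLinearMap ∘ₗ
        fInvAntipode X)
    (fun a a' b => by ext; simp)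
    (fun c a b => by ext; simp)
    (fun a b b' => by ext; simp [mul_add])
    (fun c a b => by ext; simp [TensorProduct.smul_tmul'])
  have ht : ∀ a b c, t a b c = (inclA X (fInvAntipode X c) *
    inclH X (HopfAlgebra.antipode k b)) ⊗ₜ[k] HopfAlgebra.antipode k a := fun a b c => rfl
  have h3 := IterComul.sum_trilinear t (ℛ k h)
  rw [(ℛ k h).convMul_apply]
  refine Eq.trans ?_ (h3.trans ?_)
  · change coact X (inclHInv X h) = _
    rw [inclHInv_apply, map_sum]
    refine Finset.sum_congr rfl fun i _ => ?_
    rw [coact_inclA_mul]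
    change _ * coact X (tmul X 1 _) = _
    rw [coact_tmul X _ (HopfAlgebra.reprAntipode ((ℛ k h).left i)), Finset.mul_sum]
    refine Finset.sum_congr rfl fun j _ => ?_
    rw [ht, Algebra.TensorProduct.tmul_mul_tmul, one_mul]
    rfl
  · refine Finset.sum_congr rfl fun i _ => ?_
    change _ = ((1 : CrossedProduct X) ⊗ₜ[k] HopfAlgebra.antipode k ((ℛ k h).left i)) *
      (inclHInv X ((ℛ k h).right i) ⊗ₜ[k] (1 : H))
    rw [Algebra.TensorProduct.tmul_mul_tmul, one_mul, mul_one, inclHInv_apply,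
      TensorProduct.sum_tmul]
    rfl

-- Under the coaction the adjacent factors `h` and `S(h)` cancel, so `(1 # h⁽¹⁾)(1 # h⁽²⁾)⁻¹` is
-- coinvariant, that is, an element of `A`. The left inverse gives `u * v * u = u` for `u h = 1 # h`
-- and `v = u⁻¹`, and applying the left `A`-linear map `retr` identifies this element of `A` as
-- `ε(h)`.
variable {X} in
theorem convH_mul_convHInv (hf : IsUnit (toConv X.f)) : convH X * convHInv X = 1 := by
  have h1 : toConv (coact X ∘ₗ (convH X * convHInv X).ofConv) =
      post (inclLeft X) (convH X * convHInv X) := by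
    have e1 : toConv (coact X ∘ₗ (convH X * convHInv X).ofConv) =
        toConv (coact X ∘ₗ inclH X) * toConv (coact X ∘ₗ inclHInv X) := by
      refine ext_apply fun h => ?_
      rw [(ℛ k h).convMul_apply]
      change coact X ((convH X * convHInv X) h) = _
      rw [(ℛ k h).convMul_apply, map_sum]
      exact Finset.sum_congr rfl fun i _ => coact_mul X _ _
    have e2 : post (inclRight X) (toConv (LinearMap.id (R := k) (M := H))) *
        post (inclRight X) (toConv (HopfAlgebra.antipode k)) = 1 := by
      rw [← map_mul, LinearMap.id_mul_antipode, map_one]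
    rw [e1, convCoact_inclH, convCoact_inclHInv, map_mul]
    exact (mul_assoc _ _ _).trans <| congrArg _ <| (mul_assoc _ _ _).symm.trans <|
      (congrArg (· * _) e2).trans (one_mul _)
  have h2 : ∀ x, TensorProduct.map (retr X) LinearMap.id (coact X x) = (x : A ⊗[k] H) := by
    intro x
    induction x using induction with
    | h0 => simp only [map_zero]; rfl
    | h1 a h =>
      rw [← tmul_eq, coact_tmul X _ (ℛ k h), map_sum]
      simp only [TensorProduct.map_tmul, LinearMap.id_apply, tmul_eq, retr_inclA_mul_inclH,
        TensorProduct.smul_tmul, ← TensorProduct.tmul_sum]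
      rw [sum_counit_smul, ← tmul_eq]
      rfl
    | h2 x y hx hy => rw [map_add, map_add, hx, hy]; rfl
  have h3 : ∀ h, (convH X * convHInv X) h = inclA X (retr X ((convH X * convHInv X) h)) := by
    intro h
    have := congrArg (fun g => TensorProduct.map (retr X) LinearMap.id (g h)) h1
    exact (h2 _).symm.trans this
  have h4 : convH X * convHInv X * convH X = convH X := by
    rw [mul_assoc, convHInv_mul_convH hf, mul_one]
  refine ext_apply fun h => ?_
  have h5 := congrArg (fun g => retr X (g h)) h4
  rw [(ℛ k h).convMul_apply, map_sum] at h5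
  have h6 : retr X ((convH X * convHInv X) h) = counit (R := k) h • 1 := by
    have h7 : retr X (inclH X h) = counit (R := k) h • 1 := by
      have := retr_inclA_mul_inclH X 1 h
      rwa [map_one, one_mul] at this
    refine Eq.trans ?_ (h5.trans h7)
    have h8 : retr X ((convH X * convHInv X) h) = _ :=
      map_eq_sum_right (retr X ∘ₗ (convH X * convHInv X).ofConv) h
    rw [h8]
    refine Finset.sum_congr rfl fun i _ => ?_
    rw [h3, convH_apply, retr_inclA_mul_inclH]
    rfl
  rw [h3, h6, map_smul, map_one]
  simp [LinearMap.convOne_def, Algebra.algebraMap_eq_smul_one]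

end CrossedProduct

/-! ### Exchange rules for inverses, the weak action and the cocycle -/

namespace CrossedProduct

open Coalgebra WithConv Convolution IterComul RelChains

variable {k A H : Type*} [CommRing k] [Ring A] [Algebra k A] [Ring H] [HopfAlgebra k H]
  {X : CrossedSystem k A H}

/-- Obtained from `(1 # h) a = a^{h⁽¹⁾} (1 # h⁽²⁾)` by multiplying by the inverse on both sides. -/
theorem convHInv_mul_convAct (hf : IsUnit (toConv X.f)) (a : A) :
    convHInv X * convAct X a = const H (inclA X a) * convHInv X := by
  calc _ = convHInv X * (convAct X a * convH X) * convHInv X := by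
        rw [mul_assoc, mul_assoc, convH_mul_convHInv hf, mul_one]
    _ = _ := by rw [← convH_mul_const, ← mul_assoc (convHInv X), convHInv_mul_convH hf, one_mul]

/-- The convolution inverse of `h ⊗ l ↦ (1 # h)(1 # l)`. -/
def convHInv₂ (X : CrossedSystem k A H) : WithConv (H ⊗[k] H →ₗ[k] CrossedProduct X) :=
  pre (projRight k H) (convHInv X) * pre (projLeft k H) (convHInv X)

/-- The map `h ⊗ l ↦ (1 # h)(1 # l)`. -/
def convH₂ (X : CrossedSystem k A H) : WithConv (H ⊗[k] H →ₗ[k] CrossedProduct X) :=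
  pre (projLeft k H) (convH X) * pre (projRight k H) (convH X)

/-- The map `h ⊗ l ↦ (a^l)^h # 1`. -/
def convAct₂ (X : CrossedSystem k A H) (a : A) : WithConv (H ⊗[k] H →ₗ[k] CrossedProduct X) :=
  toConv ((inclA X).toLinearMap ∘ₗ TensorProduct.lift (X.act.compl₂ (X.act.flip a)))

theorem convH₂_tmul (h l : H) : convH₂ X (h ⊗ₜ l) = inclH X h * inclH X l :=
  pre_projLeft_mul_pre_projRight _ _ _ _

theorem convHInv₂_tmul (h l : H) : convHInv₂ X (h ⊗ₜ l) = inclHInv X l * inclHInv X h :=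
  pre_projRight_mul_pre_projLeft _ _ _ _

/-- Multiplied on the right by `1 # hl`, the left side becomes `(1 # l)⁻¹(1 # h)⁻¹(1 # h)(1 # l) =
1` in Sweedler shorthand. It is therefore the inverse of `1 # hl`. -/
theorem convHInv₂_mul_convF (hf : IsUnit (toConv X.f)) :
    convHInv₂ X * convF X = pre (Bialgebra.mulCoalgHom k H) (convHInv X) := by
  have h1 : ∀ g : H ⊗[k] H →ₗc[k] H, pre g (convHInv X) * pre g (convH X) = 1 := fun g => by
    rw [← map_mul, convHInv_mul_convH hf, map_one]
  have h2 : pre (Bialgebra.mulCoalgHom k H) (convH X) *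
      pre (Bialgebra.mulCoalgHom k H) (convHInv X) = 1 := by
    rw [← map_mul, convH_mul_convHInv hf, map_one]
  have h3 : convHInv₂ X * convF X * pre (Bialgebra.mulCoalgHom k H) (convH X) = 1 := by
    rw [mul_assoc, ← pre_convH_mul_pre_convH, convHInv₂, mul_assoc,
      ← mul_assoc (pre (projLeft k H) (convHInv X)), h1, one_mul, h1]
  exact left_inv_eq_right_inv h3 h2

/-- The twisted module condition `(a^l)^h f = f a^{hl}`. Both sides times `1 # hl` compute `(1 #
h)(1 # l) a`, and `1 # hl` is then cancelled. -/
theorem convAct₂_mul_convF (hf : IsUnit (toConv X.f)) (a : A) :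
    convAct₂ X a * convF X = convF X * pre (Bialgebra.mulCoalgHom k H) (convAct X a) := by
  have h0 : ∀ g : H ⊗[k] H →ₗc[k] H, pre g (convH X) * const (H ⊗[k] H) (inclA X a) =
      pre g (convAct X a) * pre g (convH X) := fun g => by
    rw [← pre_const g, ← map_mul, convH_mul_const, map_mul]
  have h1 : pre (projLeft k H) (convH X) * pre (projRight k H) (convAct X a) =
      convAct₂ X a * pre (projLeft k H) (convH X) := by
    refine conv_ext_tmul fun h l => ?_
    have hl : ∀ b : H, inclA X (X.act b (X.act l a)) = _ := fun b => map_eq_sum_right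
      ((inclA X).toLinearMap ∘ₗ X.act b ∘ₗ X.act.flip a) l
    rw [pre_projLeft_mul_pre_projRight, ((ℛ k h).tmul (ℛ k l)).convMul_apply]
    refine (inclH_mul_inclA X h (X.act l a)).trans ?_
    refine Eq.trans ?_ (Finset.sum_product ..).symm
    refine Finset.sum_congr rfl fun i _ => ?_
    rw [hl, Finset.sum_mul]
    refine Finset.sum_congr rfl fun j _ => ?_
    change _ = inclA X (X.act ((ℛ k h).left i) (X.act ((ℛ k l).left j) a)) *
      inclH X (counit (R := k) ((ℛ k l).right j) • (ℛ k h).right i)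
    rw [map_smul, mul_smul_comm, smul_mul_assoc]
    rfl
  have h2 : convAct₂ X a * convF X * pre (Bialgebra.mulCoalgHom k H) (convH X) =
      convF X * pre (Bialgebra.mulCoalgHom k H) (convAct X a) *
        pre (Bialgebra.mulCoalgHom k H) (convH X) := by
    rw [mul_assoc, ← pre_convH_mul_pre_convH, ← mul_assoc, ← h1, mul_assoc, ← h0, ← mul_assoc,
      pre_convH_mul_pre_convH, mul_assoc, h0, mul_assoc]
  have h3 : pre (Bialgebra.mulCoalgHom k H) (convH X) *
      pre (Bialgebra.mulCoalgHom k H) (convHInv X) = 1 := by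
    rw [← map_mul, convH_mul_convHInv hf, map_one]
  have h4 := congrArg (· * pre (Bialgebra.mulCoalgHom k H) (convHInv X)) h2
  simpa only [mul_assoc, h3, mul_one] using h4

theorem inclHInv_one (hf : IsUnit (toConv X.f)) : inclHInv X 1 = 1 := by
  have h := congrArg (fun g => g (1 : H)) (convH_mul_convHInv hf)
  let R : Coalgebra.Repr k (1 : H) Unit :=
    ⟨{()}, fun _ => 1, fun _ => 1, by simp [Algebra.TensorProduct.one_def]⟩
  rw [R.convMul_apply] at h
  simp only [R, Finset.sum_singleton] at h
  refine Eq.trans ?_ (h.trans ?_)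
  · rw [convH_apply, inclH_one, one_mul, convHInv_apply]
  · simp [LinearMap.convOne_def]

end CrossedProduct

namespace RelChains

open IterComul WithConv

variable {k A E M C : Type*} [CommRing k] [Ring A] [Algebra k A] [Ring E] [Algebra k E]
  [AddCommGroup M] [Module k M] [Ring C] [Bialgebra k C]

theorem wordChain_congr (P : BimoduleData k E M) (π : E →ₗ[k] A) {m m' : M} {n : ℕ}
    {g g' : Fin (n + 2) → WithConv (C →ₗ[k] E)}
    (h : ∀ x z, P.l (g (Fin.last _) z) (P.r (g 0 x) m) = P.l (g' (Fin.last _) z) (P.r (g' 0 x) m'))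
    (h' : ∀ i : Fin n, ∀ c, π (g i.castSucc.succ c) = π (g' i.castSucc.succ c)) (c : C) :
    wordChain P π m g c = wordChain P π m' g' c := by
  refine LinearMap.congr_fun (eval_ext fun c => ?_) c
  change elem _ _ = elem _ _
  congr 1
  · exact h _ _
  · exact funext fun i => h' i _

/-- `1` is grouplike, so the Sweedler sum has the single term `(1, …, 1)`. -/
theorem eval_one {n : ℕ} {Z : Type*} [AddCommGroup Z] [Module k Z]
    (Φ : MultilinearMap k (fun _ : Fin n => C) Z) : eval Φ 1 = Φ fun _ => 1 := by
  induction n with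
  | zero =>
    rw [eval_zero, Bialgebra.counit_one, one_smul]
    exact congrArg Φ (Subsingleton.elim _ _)
  | succ n ih =>
    let R : Coalgebra.Repr k (1 : C) Unit :=
      ⟨{()}, fun _ => 1, fun _ => 1, by simp [Algebra.TensorProduct.one_def]⟩
    rw [eval_succ Φ R]
    simp only [R, Finset.sum_singleton, ih, MultilinearMap.curryLeft_apply]
    congr 1
    funext i
    exact Fin.cases rfl (fun _ => rfl) i

end RelChains

/-! ### The action of `H` on the cyclic tensor products -/

namespace CrossedProduct

open Coalgebra WithConv Convolution IterComul RelChains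

variable {k A H M : Type*} [CommRing k] [Ring A] [Algebra k A] [Ring H] [HopfAlgebra k H]
  (X : CrossedSystem k A H) [AddCommGroup M] [Module k M] (P : BimoduleData k (CrossedProduct X) M)

/-- The letters of the word which describes the action of `H`. -/
def letters {n : ℕ} (a : Fin n → A) : Fin (n + 2) → WithConv (H →ₗ[k] CrossedProduct X) :=
  Fin.cons (convHInv X) (Fin.snoc (fun i => convAct X (a i)) (convH X) :
    Fin (n + 1) → WithConv (H →ₗ[k] CrossedProduct X))

theorem letters_zero {n : ℕ} (a : Fin n → A) : letters X a 0 = convHInv X := rfl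

theorem letters_last {n : ℕ} (a : Fin n → A) : letters X a (Fin.last _) = convH X := by
  rw [letters, ← Fin.succ_last, Fin.cons_succ, Fin.snoc_last]

theorem letters_mid {n : ℕ} (a : Fin n → A) (i : Fin n) :
    letters X a i.castSucc.succ = convAct X (a i) := by
  rw [letters, Fin.cons_succ, Fin.snoc_castSucc]

theorem diag_tprod (n : ℕ) (h : H) (a : Fin n → A) :
    diag X.toWeakAction n h (PiTensorProduct.tprod k a) =
      eval ((PiTensorProduct.tprod k).compLinearMap fun i => X.act.flip (a i)) h := by
  rw [diag, LinearMap.comp_apply, eval, LinearMap.comp_apply]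
  generalize iterComul k n h = t
  induction t using PiTensorProduct.induction_on with
  | smul_tprod r f =>
    simp only [map_smul, LinearMap.smul_apply, PiTensorProduct.map₂_tprod_tprod,
      PiTensorProduct.lift.tprod]
    rfl
  | add a b ha hb => simp only [map_add, LinearMap.add_apply, ha, hb]

/-- The definition splits off the first and the last factor of the comultiplication; by `eval_succ`
and `eval_snoc` this is evaluation of one word on the full iterated comultiplication. -/
theorem twist_elem (n : ℕ) (h : H) (m : M) (a : Fin n → A) :
    twist X P n h (elem m a) = wordChain P (retr X) m (letters X a) h := by
  have h1 : twist X P n h (elem m a) = ∑ i ∈ (ℛ k h).index,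
      ∑ j ∈ (ℛ k ((ℛ k h).right i)).index,
        P.l (inclH X ((ℛ k ((ℛ k h).right i)).right j))
          (P.r (inclHInv X ((ℛ k h).left i)) m) ⊗ₜ[k]
        diag X.toWeakAction n ((ℛ k ((ℛ k h).right i)).left j) (PiTensorProduct.tprod k a) := by
    simp only [twist, LinearMap.comp_apply]
    conv_lhs => rw [← (ℛ k h).eq]
    simp only [map_sum, LinearMap.lTensor_tmul, LinearMap.sum_apply]
    refine Finset.sum_congr rfl fun i _ => ?_
    conv_lhs => rw [← (ℛ k ((ℛ k h).right i)).eq]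
    simp only [TensorProduct.tmul_sum, map_sum, LinearMap.sum_apply]
    rfl
  rw [h1, wordChain, word, eval_succ _ (ℛ k h)]
  refine Finset.sum_congr rfl fun i _ => ?_
  rw [eval_snoc, lift_comul _ (ℛ k ((ℛ k h).right i))]
  refine Finset.sum_congr rfl fun j _ => ?_
  simp only [LinearMap.flip_apply, evalL_apply]
  rw [diag_tprod]
  refine (map_eval (TensorProduct.mk k M _ _) _ _).trans ?_
  refine Eq.trans ?_ (map_eval (LinearMap.applyₗ _) _ _).symm
  refine LinearMap.congr_fun (eval_ext fun c => ?_) _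
  simp only [LinearMap.compMultilinearMap_apply, MultilinearMap.compLinearMap_apply,
    LinearMap.applyₗ_apply_apply, MultilinearMap.curryRight_apply, MultilinearMap.curryLeft_apply]
  have hlast : (Fin.cons ((ℛ k h).left i) (Fin.snoc c ((ℛ k ((ℛ k h).right i)).right j) :
      Fin (n + 1) → H) : Fin (n + 2) → H) (Fin.last _) = (ℛ k ((ℛ k h).right i)).right j := by
    rw [← Fin.succ_last, Fin.cons_succ, Fin.snoc_last]
  rw [chainWord_apply, letters_last, hlast]
  change elem _ _ = elem _ _
  congr 1
  funext q
  rw [letters_mid, Fin.cons_succ, Fin.snoc_castSucc]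
  exact (retr_inclA X _).symm

/-- The chain maps which describe the action of `H` commute with the faces. -/
theorem face_twist {X : CrossedSystem k A H} (hf : IsUnit (toConv X.f))
    (P : BimoduleData k (CrossedProduct X) M) (n : ℕ) (h : H) (j : Fin (n + 2))
    (x : Chains k A M (n + 1)) : face (P.restrict (inclA X)) j (twist X P (n + 1) h x) =
      twist X P n h (face (P.restrict (inclA X)) j x) := by
  refine LinearMap.congr_fun (RelChains.chains_ext (φ := face (P.restrict (inclA X)) j ∘ₗ
    twist X P (n + 1) h) (ψ := twist X P n h ∘ₗ face (P.restrict (inclA X)) j) fun m a => ?_) x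
  rw [LinearMap.comp_apply, LinearMap.comp_apply, twist_elem, face_elem, twist_elem,
    face_wordChain P (inclA X) (retr X) (retr_inclA X) m (letters X a) fun i c => ?_]
  swap
  · rw [letters_mid]
    exact ⟨_, rfl⟩
  -- Both sides are words, compared letter by letter. The first face uses the exchange of `(1 #
  -- h)⁻¹` with `a^h`, the last that of `a^h` with `1 # h`, and an inner face uses `(ab)^h =
  -- a^{h⁽¹⁾} b^{h⁽²⁾}`.
  refine wordChain_congr P (retr X) (fun x z => ?_) (fun i c => ?_) h
  · obtain ⟨j, hj⟩ := j
    simp only [letters_zero, letters_last, faceEnd, BimoduleData.restrict, LinearMap.comp_apply,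
      AlgHom.toLinearMap_apply]
    rcases Nat.eq_zero_or_pos j with rfl | h0
    · have h2 : contract (⟨0, hj⟩ : Fin (n + 2)) (letters X a) 0 =
          convHInv X * convAct X (a 0) := by
        simp only [contract, lt_irrefl, if_true, if_false, Fin.val_zero]
        exact congrArg (_ * ·) (letters_mid X a 0)
      have h3 : contract (⟨0, hj⟩ : Fin (n + 2)) (letters X a) (Fin.last (n + 1)) = convH X :=
        letters_last X a
      rw [if_pos rfl, h2, h3, convHInv_mul_convAct hf, const_mul, P.r_mul]
    · rcases eq_or_ne j (n + 1) with rfl | h1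
      · have h2 : contract (⟨n + 1, hj⟩ : Fin (n + 2)) (letters X a) 0 = convHInv X := by
          simp [contract, letters_zero]
        have h3 : contract (⟨n + 1, hj⟩ : Fin (n + 2)) (letters X a) (Fin.last (n + 1)) =
            convAct X (a (Fin.last n)) * convH X := by
          simp only [contract, lt_irrefl, if_true, if_false, Fin.val_last]
          exact congrArg₂ (· * ·) (letters_mid X a (Fin.last n)) (letters_last X a)
        rw [if_neg (by simp), if_pos rfl, h2, h3, ← convH_mul_const, mul_const, P.l_mul, P.l_r]
      · have h2 : contract (⟨j, hj⟩ : Fin (n + 2)) (letters X a) 0 = convHInv X := by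
          simp [contract, h0, letters_zero]
        have h3 : contract (⟨j, hj⟩ : Fin (n + 2)) (letters X a) (Fin.last (n + 1)) = convH X := by
          have h4 : ¬ (n + 1 < j) := by omega
          simp only [contract, Fin.val_last, h4, Ne.symm h1, if_false]
          exact letters_last X a
        rw [if_neg (by exact h0.ne'), if_neg (by exact h1), h2, h3]
        rfl
  · rw [letters_mid]
    congr 2
    obtain ⟨j, hj⟩ := j
    simp only [contract, faceWord, Fin.val_succ, Fin.val_castSucc]
    split_ifs
    · exact congrArg ofConv (letters_mid X a i.castSucc)
    · rw [convAct_mul]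
      exact congrArg ofConv (congrArg₂ (· * ·) (letters_mid X a i.castSucc) (letters_mid X a i.succ))
    · exact congrArg ofConv (letters_mid X a i.succ)

/-- The balancing relations are differences of adjacent faces at a letter in `S`. The action
commutes with faces, and it keeps that letter in `S` because `S` is stable. -/
theorem twist_relations {X : CrossedSystem k A H} (hf : IsUnit (toConv X.f))
    (P : BimoduleData k (CrossedProduct X) M) (S : Subalgebra k A)
    (hstable : ∀ (h : H), ∀ s ∈ S, X.act h s ∈ S) (n : ℕ) (h : H) :
    relations (P.restrict (inclA X)) S n ≤
      (relations (P.restrict (inclA X)) S n).comap (twist X P n h) := by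
  have hp : ∀ {n : ℕ} (a : Fin n → A) (p : Fin n), a p ∈ S →
      ∀ c, retr X (letters X a p.castSucc.succ c) ∈ S := by
    intro n a p hap c
    rw [letters_mid, convAct_apply, retr_inclA]
    exact hstable _ _ hap
  refine relations_le _ S _ (fun m a p hap => ?_) (fun m a p hap => ?_)
  · rw [Submodule.mem_comap, map_sub, ← face_twist hf, ← face_twist hf, twist_elem]
    exact face_sub_face_wordChain_mem P (inclA X) (retr X) m S _ p (hp a p hap) h
  · rw [Submodule.mem_comap, twist_elem]
    exact wordChain_mem P _ (retr X) m S _ p (hp a p hap) h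

theorem twist_one {X : CrossedSystem k A H} (hf : IsUnit (toConv X.f))
    (P : BimoduleData k (CrossedProduct X) M) (n : ℕ) : twist X P n 1 = LinearMap.id := by
  refine RelChains.chains_ext fun m a => ?_
  rw [twist_elem, wordChain, word, eval_one, MultilinearMap.compLinearMap_apply, chainWord_apply,
    LinearMap.id_apply]
  simp only [letters_last, letters_mid, letters_zero]
  change elem (P.l (inclH X 1) (P.r (inclHInv X 1) m)) (fun i => retr X (inclA X (X.act 1 (a i)))) = _
  rw [inclHInv_one hf, inclH_one, P.l_one, P.r_one]
  simp only [retr_inclA, X.one_act]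
  rfl

/-- The letters of the word which describes the composition of the actions of two elements. -/
def letters₂ {n : ℕ} (a : Fin n → A) : Fin (n + 2) → WithConv (H ⊗[k] H →ₗ[k] CrossedProduct X) :=
  Fin.cons (convHInv₂ X) (Fin.snoc (fun i => convAct₂ X (a i)) (convH₂ X) :
    Fin (n + 1) → WithConv (H ⊗[k] H →ₗ[k] CrossedProduct X))

/-- The inner action changes `m` and the letters, and the outer one acts on the result: the left
factors compose as `(1 # h)(1 # l)`, the right ones as `(1 # l)⁻¹(1 # h)⁻¹`. -/
theorem twist_twist_elem (n : ℕ) (h l : H) (m : M) (a : Fin n → A) :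
    twist X P n h (twist X P n l (elem m a)) =
      wordChain P (retr X) m (letters₂ X a) (h ⊗ₜ[k] l) := by
  have h1 : ∀ m a (s : ⨂[k] _ : Fin (n + 2), H) (c : Fin (n + 2) → H),
      PiTensorProduct.lift ((chainWord P (retr X) m n).compLinearMap
        fun i => (letters₂ X a i).ofConv) (PiTensorProduct.map₂ (fun _ => TensorProduct.mk k H H) s
          (PiTensorProduct.tprod k c)) =
      PiTensorProduct.lift ((chainWord P (retr X)
        (P.l (inclH X (c (Fin.last _))) (P.r (inclHInv X (c 0)) m)) n).compLinearMap
        fun i => (letters X (fun i => X.act (c i.castSucc.succ) (a i)) i).ofConv) s := by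
    intro m a s c
    induction s using PiTensorProduct.induction_on with
    | add a b ha hb => simp only [map_add, LinearMap.add_apply, ha, hb]
    | smul_tprod r b =>
      simp only [map_smul, LinearMap.smul_apply, PiTensorProduct.map₂_tprod_tprod,
        PiTensorProduct.lift.tprod, MultilinearMap.compLinearMap_apply, chainWord_apply,
        letters_zero, letters_last, letters_mid]
      congr 2
      · have e1 : letters₂ X a (Fin.last _) = convH₂ X := by
          rw [letters₂, ← Fin.succ_last, Fin.cons_succ, Fin.snoc_last]
        have e2 : letters₂ X a 0 = convHInv₂ X := rfl
        rw [e1, e2]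
        change P.l (convH₂ X (b _ ⊗ₜ c _)) (P.r (convHInv₂ X (b _ ⊗ₜ c _)) m) =
          P.l (inclH X _) (P.r (inclHInv X _) _)
        rw [convH₂_tmul, convHInv₂_tmul, P.l_mul, P.r_mul, P.l_r]
      · funext i
        have e3 : letters₂ X a i.castSucc.succ = convAct₂ X (a i) := by
          rw [letters₂, Fin.cons_succ, Fin.snoc_castSucc]
        rw [e3]
        rfl
  rw [twist_elem, wordChain, word, eval, LinearMap.comp_apply, wordChain, word, eval,
    LinearMap.comp_apply, iterComul_tmul]
  generalize iterComul k (n + 2) l = t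
  induction t using PiTensorProduct.induction_on with
  | add a b ha hb => simp only [map_add, ha, hb]
  | smul_tprod r c =>
    simp only [map_smul]
    congr 1
    rw [h1, PiTensorProduct.lift.tprod]
    refine Eq.trans ?_ (twist_elem X P n h _ _)
    rw [MultilinearMap.compLinearMap_apply, chainWord_apply, letters_zero, letters_last]
    simp only [letters_mid]
    congr 2
    funext i
    exact retr_inclA X _

/-- The letters of a word which interpolates between the composition of the actions of two
elements and the action of their product. -/
def interpolation {n : ℕ} (a : ℕ → A) (p : ℕ) (i : Fin (n + 3)) :
    WithConv (H ⊗[k] H →ₗ[k] CrossedProduct X) :=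
  if (i : ℕ) = 0 then convHInv₂ X
  else if (i : ℕ) = n + 2 then pre (Bialgebra.mulCoalgHom k H) (convH X)
  else if (i : ℕ) - 1 < p then convAct₂ X (a (i - 1))
  else if (i : ℕ) - 1 = p then convF X
  else pre (Bialgebra.mulCoalgHom k H) (convAct X (a (i - 2)))

theorem _root_.IterComul.contract_lt {Y : Type*} [Mul Y] {n : ℕ} (p : Fin n) (x : Fin (n + 1) → Y)
    (i : Fin n) (h : (i : ℕ) < p) : contract p x i = x i.castSucc := if_pos h

theorem _root_.IterComul.contract_eq {Y : Type*} [Mul Y] {n : ℕ} (p : Fin n) (x : Fin (n + 1) → Y)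
    (i : Fin n) (h : (i : ℕ) = p) : contract p x i = x i.castSucc * x i.succ := by
  rw [contract, if_neg (by omega), if_pos h]

theorem _root_.IterComul.contract_gt {Y : Type*} [Mul Y] {n : ℕ} (p : Fin n) (x : Fin (n + 1) → Y)
    (i : Fin n) (h : (p : ℕ) < i) : contract p x i = x i.succ := by
  rw [contract, if_neg (by omega), if_neg (by omega)]

section interpolation

variable {X} {n : ℕ} (a : ℕ → A) (p : ℕ) (i : Fin (n + 3))

theorem interpolation_zero (hi : (i : ℕ) = 0) : interpolation X a p i = convHInv₂ X := if_pos hi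

theorem interpolation_last (hi : (i : ℕ) = n + 2) :
    interpolation X a p i = pre (Bialgebra.mulCoalgHom k H) (convH X) := by
  rw [interpolation, if_neg (by omega), if_pos hi]

theorem interpolation_lt (q : ℕ) (hi : (i : ℕ) = q + 1) (hq : q < p) (hp : q ≤ n) :
    interpolation X a p i = convAct₂ X (a q) := by
  rw [interpolation, if_neg (by omega), if_neg (by omega), if_pos (by omega)]
  congr 2
  omega

theorem interpolation_eq (hi : (i : ℕ) = p + 1) (hp : p ≤ n) : interpolation X a p i = convF X := by
  rw [interpolation, if_neg (by omega), if_neg (by omega), if_neg (by omega), if_pos (by omega)]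

theorem interpolation_gt (q : ℕ) (hi : (i : ℕ) = q + 2) (hq : p ≤ q) (hp : q < n) :
    interpolation X a p i = pre (Bialgebra.mulCoalgHom k H) (convAct X (a q)) := by
  rw [interpolation, if_neg (by omega), if_neg (by omega), if_neg (by omega), if_neg (by omega)]
  congr 3
  omega

/-- In word `p` the cocycle stands immediately before `a_p^{hl}`, in word `p + 1` immediately after
`(a_p^l)^h`. The two products agree by the twisted module condition. -/
theorem contract_interpolation (hf : IsUnit (toConv X.f)) (hp : p < n) :
    contract (⟨p + 1, by omega⟩ : Fin (n + 2)) (interpolation X a p) =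
      contract (⟨p + 1, by omega⟩ : Fin (n + 2)) (interpolation X a (p + 1)) := by
  funext i
  rcases lt_trichotomy (i : ℕ) (p + 1) with h | h | h
  · rw [contract_lt _ _ _ h, contract_lt _ _ _ h]
    rcases Nat.eq_zero_or_pos (i : ℕ) with h0 | h0
    · rw [interpolation_zero a p _ h0, interpolation_zero a _ _ h0]
    · have hi : (i : ℕ) = i - 1 + 1 := by omega
      rw [interpolation_lt a p _ (i - 1) hi (by omega) (by omega),
        interpolation_lt a _ _ (i - 1) hi (by omega) (by omega)]
  · rw [contract_eq _ _ _ h, contract_eq _ _ _ h,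
      interpolation_eq a p _ h (by omega), interpolation_gt a p _ p (by simp [h]) le_rfl hp,
      interpolation_lt a _ _ p h (by omega) (by omega), interpolation_eq a _ _ (by simp [h]) hp,
      convAct₂_mul_convF hf]
  · rw [contract_gt _ _ _ h, contract_gt _ _ _ h]
    rcases eq_or_ne (i : ℕ) (n + 1) with h0 | h0
    · rw [interpolation_last a p _ (by simp [h0]), interpolation_last a _ _ (by simp [h0])]
    · have hi : (i.succ : ℕ) = i - 1 + 2 := by simp only [Fin.val_succ]; omega
      rw [interpolation_gt a p _ (i - 1) hi (by omega) (by omega),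
        interpolation_gt a _ _ (i - 1) hi (by omega) (by omega)]

/-- With the cocycle in front, the initial face absorbs it into the inverse and leaves the word of
the product `hl`. -/
theorem contract_interpolation_zero (hf : IsUnit (toConv X.f)) (b : Fin n → A)
    (hab : ∀ i : Fin n, a i = b i) :
    contract (0 : Fin (n + 2)) (interpolation X a 0) =
      fun i => pre (Bialgebra.mulCoalgHom k H) (letters X b i) := by
  funext i
  refine Fin.cases ?_ (fun i => Fin.lastCases ?_ (fun i => ?_) i) i
  · rw [contract_eq _ _ _ rfl, interpolation_zero a 0 _ rfl, interpolation_eq a 0 _ rfl (by omega),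
      convHInv₂_mul_convF hf, letters_zero]
  · rw [contract_gt _ _ _ (by simp), Fin.succ_last, letters_last, interpolation_last a 0 _ (by simp)]
  · rw [contract_gt _ _ _ (by simp), letters_mid, ← hab,
      interpolation_gt a 0 _ i (by simp) (by omega) i.2]

/-- With the cocycle at the end, the final face absorbs it into `1 # hl` and leaves the word of two
successive actions. -/
theorem contract_interpolation_last (b : Fin n → A) (hab : ∀ i : Fin n, a i = b i) :
    contract (Fin.last (n + 1)) (interpolation X a n) = letters₂ X b := by
  funext i
  refine Fin.cases ?_ (fun i => Fin.lastCases ?_ (fun i => ?_) i) i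
  · rw [contract_lt _ _ _ (by simp), interpolation_zero a _ _ rfl]
    rfl
  · rw [contract_eq _ _ _ (by simp), interpolation_eq a n _ (by simp) le_rfl,
      interpolation_last a n _ (by simp), letters₂, Fin.cons_succ, Fin.snoc_last, convH₂,
      pre_convH_mul_pre_convH]
  · rw [contract_lt _ _ _ (by simp), interpolation_lt a n _ i (by simp) i.2 i.2.le, letters₂,
      Fin.cons_succ, Fin.snoc_castSucc, hab]

end interpolation

theorem _root_.RelChains.wordChain_coalgHom {E C D : Type*} [Ring E] [Algebra k E] [Ring C]
    [Bialgebra k C] [Ring D] [Bialgebra k D] (P : BimoduleData k E M) (π : E →ₗ[k] A) (m : M)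
    {n : ℕ} (g : Fin (n + 2) → WithConv (D →ₗ[k] E)) (φ : C →ₗc[k] D) (c : C) :
    wordChain P π m g (φ c) = wordChain P π m (fun i => pre φ (g i)) c :=
  eval_coalgHom φ _ c

/-- The equality holds only in the cyclic tensor product: at each stage it moves a value of `f`, an
element of `S`, across a tensor sign. -/
theorem twist_mul {X : CrossedSystem k A H} (hf : IsUnit (toConv X.f))
    (P : BimoduleData k (CrossedProduct X) M) (S : Subalgebra k A)
    (hfS : ∀ h l : H, X.f (h ⊗ₜ[k] l) ∈ S) (n : ℕ) (h l : H) (x : Chains k A M n) :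
    mk (P.restrict (inclA X)) S n (twist X P n (h * l) x) =
      mk (P.restrict (inclA X)) S n (twist X P n h (twist X P n l x)) := by
  refine LinearMap.congr_fun (RelChains.chains_ext (φ := mk (P.restrict (inclA X)) S n ∘ₗ
    twist X P n (h * l)) (ψ := mk (P.restrict (inclA X)) S n ∘ₗ twist X P n h ∘ₗ
    twist X P n l) fun m a => ?_) x
  rw [LinearMap.comp_apply, LinearMap.comp_apply, LinearMap.comp_apply, twist_twist_elem,
    twist_elem]
  -- Indexing by `ℕ` spares casts in the shifted positions `i - 1` and `i - 2`; the default `0`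
  -- beyond `n` is never used as a letter.
  let a' : ℕ → A := fun i => if hi : i < n then a ⟨i, hi⟩ else 0
  have ha' : ∀ i : Fin n, a' i = a i := fun i => dif_pos i.2
  have hS : ∀ c, X.f c ∈ S := by
    intro c
    induction c with
    | zero => rw [map_zero]; exact S.zero_mem
    | tmul h l => exact hfS h l
    | add x y hx hy => rw [map_add]; exact S.add_mem hx hy
  have hmid : ∀ (p : Fin (n + 1)), interpolation X a' p p.castSucc.succ =
      (convF X : WithConv (H ⊗[k] H →ₗ[k] CrossedProduct X)) := by
    intro p
    have h1 : (p : ℕ) ≠ n + 1 := by omega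
    simp [interpolation, h1]
  let W : Fin (n + 1) → Chains k A M (n + 1) := fun p =>
    wordChain P (retr X) m (interpolation X a' p) (h ⊗ₜ[k] l)
  have hrange : ∀ (p : Fin (n + 1)) (i : Fin (n + 1)) c,
      interpolation X a' p i.castSucc.succ c ∈ (inclA X).range := by
    intro p i c
    have h1 : (i : ℕ) ≠ n + 1 := by omega
    simp only [interpolation, Fin.val_succ, Fin.val_castSucc]
    rw [if_neg (by omega), if_neg (by omega)]
    split_ifs
    · exact ⟨_, rfl⟩
    · exact ⟨_, rfl⟩
    · exact ⟨_, rfl⟩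
  have hface : ∀ p j, face (P.restrict (inclA X)) j (W p) =
      wordChain P (retr X) m (contract j (interpolation X a' p)) (h ⊗ₜ[k] l) := fun p j =>
    face_wordChain P (inclA X) (retr X) (retr_inclA X) m _ (hrange p) j _
  have hstep : ∀ p, mk (P.restrict (inclA X)) S n (face (P.restrict (inclA X)) p.castSucc (W p)) =
      mk (P.restrict (inclA X)) S n (face (P.restrict (inclA X)) p.succ (W p)) := by
    intro p
    rw [← sub_eq_zero, ← map_sub, mk_eq_zero]
    refine face_sub_face_wordChain_mem P (inclA X) (retr X) m S _ p (fun c => ?_) _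
    rw [hmid, convF_apply, retr_inclA]
    exact hS c
  -- Within word `p` the faces before and after the cocycle agree modulo relations; the face after
  -- it coincides with the face before it in word `p + 1`.
  have hall : ∀ p : Fin (n + 1), mk (P.restrict (inclA X)) S n
      (face (P.restrict (inclA X)) p.castSucc (W p)) = mk (P.restrict (inclA X)) S n
        (wordChain P (retr X) m (letters X a) (h * l)) := by
    intro p
    induction p using Fin.induction with
    | zero => rw [hface, Fin.castSucc_zero, Fin.val_zero, contract_interpolation_zero a' hf a ha',
        ← wordChain_coalgHom P (retr X) m (letters X a)]; rfl
    | succ p ih =>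
      rw [← ih, hstep p.castSucc, hface, hface]
      exact congrArg (fun g => mk (P.restrict (inclA X)) S n (wordChain P (retr X) m g (h ⊗ₜ[k] l)))
        (contract_interpolation a' p hf p.2).symm
  rw [← contract_interpolation_last a' a ha', ← hall (Fin.last n), hstep, hface]
  rfl

/-- The action of `H` on the cyclic tensor products. -/
def act {X : CrossedSystem k A H} (hf : IsUnit (toConv X.f))
    (P : BimoduleData k (CrossedProduct X) M) (S : Subalgebra k A)
    (hstable : ∀ (h : H), ∀ s ∈ S, X.act h s ∈ S) (hfS : ∀ h l : H, X.f (h ⊗ₜ[k] l) ∈ S) (n : ℕ) :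
    H →ₐ[k] Module.End k (RelChains (P.restrict (inclA X)) S n) :=
  AlgHom.ofLinearMap
    { toFun := fun h => (relations (P.restrict (inclA X)) S n).mapQ _ (twist X P n h)
        (twist_relations hf P S hstable n h)
      map_add' := fun h l => by
        refine Submodule.linearMap_qext _ (LinearMap.ext fun x => ?_)
        simp
      map_smul' := fun c h => by
        refine Submodule.linearMap_qext _ (LinearMap.ext fun x => ?_)
        simp }
    (by
      refine Submodule.linearMap_qext _ (LinearMap.ext fun x => ?_)
      simp [twist_one hf])
    (fun h l => by
      refine Submodule.linearMap_qext _ (LinearMap.ext fun x => ?_)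
      exact twist_mul hf P S hfS n h l x)

section

variable {X} (hf : IsUnit (toConv X.f)) (S : Subalgebra k A)
    (hstable : ∀ (h : H), ∀ s ∈ S, X.act h s ∈ S) (hfS : ∀ h l : H, X.f (h ⊗ₜ[k] l) ∈ S)

theorem act_mk (n : ℕ) (h : H) (x : Chains k A M n) :
    act hf P S hstable hfS n h (mk (P.restrict (inclA X)) S n x) =
      mk (P.restrict (inclA X)) S n (twist X P n h x) := rfl

theorem d_act (n : ℕ) (h : H) (x : RelChains (P.restrict (inclA X)) S (n + 1)) :
    d (P.restrict (inclA X)) S n (act hf P S hstable hfS (n + 1) h x) =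
      act hf P S hstable hfS n h (d (P.restrict (inclA X)) S n x) := by
  obtain ⟨x, rfl⟩ := mk_surjective _ _ _ x
  rw [act_mk, d_mk, d_mk, act_mk]
  simp only [boundary, LinearMap.sum_apply, LinearMap.smul_apply, map_sum, map_smul, face_twist hf]

end

end CrossedProduct

/-! ### Free bimodules and syzygies -/

namespace BimoduleData

variable {k B M : Type*} [CommRing k] [Ring B] [Algebra k B] [AddCommGroup M] [Module k M]

/-- The bimodule `B ⊗ M` with `b (x ⊗ m) c = b x ⊗ m c`. -/
def free (P : BimoduleData k B M) : BimoduleData k B (B ⊗[k] M) where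
  l := LinearMap.rTensorHom M ∘ₗ LinearMap.mul k B
  r := LinearMap.lTensorHom B ∘ₗ P.r
  l_one := by ext; simp
  r_one := by ext; simp [P.r_one]
  l_mul b c m := by
    induction m with
    | zero => simp
    | tmul x m => simp [mul_assoc]
    | add x y hx hy => simp only [map_add, hx, hy]
  r_mul b c m := by
    induction m with
    | zero => simp
    | tmul x m => simp [P.r_mul]
    | add x y hx hy => simp only [map_add, hx, hy]
  l_r b c m := by
    induction m with
    | zero => simp
    | tmul x m => simp
    | add x y hx hy => simp only [map_add, hx, hy]

theorem free_l (P : BimoduleData k B M) (b x : B) (m : M) :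
    P.free.l b (x ⊗ₜ m) = (b * x) ⊗ₜ m := rfl

theorem free_r (P : BimoduleData k B M) (b x : B) (m : M) :
    P.free.r b (x ⊗ₜ m) = x ⊗ₜ P.r b m := rfl

/-- The bimodule structure of a subbimodule. -/
def sub (P : BimoduleData k B M) (N : Submodule k M) (hl : ∀ b, ∀ m ∈ N, P.l b m ∈ N)
    (hr : ∀ b, ∀ m ∈ N, P.r b m ∈ N) : BimoduleData k B N where
  l := LinearMap.mk₂ k (fun b m => ⟨P.l b m, hl b m m.2⟩)
    (fun b c m => Subtype.ext (by simp)) (fun c b m => Subtype.ext (by simp))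
    (fun b m m' => Subtype.ext (by simp)) (fun c b m => Subtype.ext (by simp))
  r := LinearMap.mk₂ k (fun b m => ⟨P.r b m, hr b m m.2⟩)
    (fun b c m => Subtype.ext (by simp)) (fun c b m => Subtype.ext (by simp))
    (fun b m m' => Subtype.ext (by simp)) (fun c b m => Subtype.ext (by simp))
  l_one := LinearMap.ext fun m => Subtype.ext (by simp [P.l_one])
  r_one := LinearMap.ext fun m => Subtype.ext (by simp [P.r_one])
  l_mul b c m := Subtype.ext (P.l_mul b c m)
  r_mul b c m := Subtype.ext (P.r_mul b c m)
  l_r b c m := Subtype.ext (P.l_r b c m)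

/-- The multiplication `B ⊗ M → M`. -/
def mulMap (P : BimoduleData k B M) : B ⊗[k] M →ₗ[k] M := TensorProduct.lift P.l

theorem mulMap_tmul (P : BimoduleData k B M) (b : B) (m : M) : P.mulMap (b ⊗ₜ m) = P.l b m := rfl

theorem mulMap_l (P : BimoduleData k B M) (b : B) (x : B ⊗[k] M) :
    P.mulMap (P.free.l b x) = P.l b (P.mulMap x) := by
  induction x with
  | zero => simp
  | tmul x m => simp [mulMap_tmul, free_l, P.l_mul]
  | add x y hx hy => simp only [map_add, hx, hy]

theorem mulMap_r (P : BimoduleData k B M) (b : B) (x : B ⊗[k] M) :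
    P.mulMap (P.free.r b x) = P.r b (P.mulMap x) := by
  induction x with
  | zero => simp
  | tmul x m => simp [mulMap_tmul, free_r, P.l_r]
  | add x y hx hy => simp only [map_add, hx, hy]

/-- The kernel of the multiplication `B ⊗ M → M` as a bimodule. -/
def syzygy (P : BimoduleData k B M) : BimoduleData k B (LinearMap.ker P.mulMap) :=
  P.free.sub _ (fun b m hm => by rw [LinearMap.mem_ker, mulMap_l, LinearMap.mem_ker.1 hm, map_zero])
    (fun b m hm => by rw [LinearMap.mem_ker, mulMap_r, LinearMap.mem_ker.1 hm, map_zero])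

/-- The span of the commutators `b m - m b`. -/
def commutators (P : BimoduleData k B M) : Submodule k M :=
  Submodule.span k {x | ∃ b m, x = P.l b m - P.r b m}

theorem commutator_mem (P : BimoduleData k B M) (b : B) (m : M) :
    P.l b m - P.r b m ∈ P.commutators := Submodule.subset_span ⟨b, m, rfl⟩

end BimoduleData

/-! ### Homology in degree zero -/

namespace RelChains

variable {k B M : Type*} [CommRing k] [Ring B] [Algebra k B] [AddCommGroup M] [Module k M]

/-- The free bimodule `B ⊗ M` is left free. -/
def leftFreeFree (P : BimoduleData k B M) : LeftFree P.free P.r where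
  e := LinearEquiv.refl k _
  l _ _ _ := rfl
  r _ _ _ := rfl
  mul := P.r_mul
  one w := by rw [P.r_one]; rfl

/-- Coefficients as chains of degree zero. -/
def ofCoeff (P : BimoduleData k B M) (S : Subalgebra k B) : M →ₗ[k] RelChains P S 0 :=
  mk P S 0 ∘ₗ (chainsZero k B M).symm.toLinearMap

theorem ofCoeff_apply (P : BimoduleData k B M) (S : Subalgebra k B) (m : M) (a : Fin 0 → B) :
    ofCoeff P S m = mk P S 0 (elem m a) := by
  rw [ofCoeff, LinearMap.comp_apply]
  congr 1
  rw [LinearEquiv.coe_coe, LinearEquiv.symm_apply_eq, chainsZero_elem]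

theorem ofCoeff_surjective (P : BimoduleData k B M) (S : Subalgebra k B) :
    Function.Surjective (ofCoeff P S) :=
  (mk_surjective P S 0).comp (chainsZero k B M).symm.surjective

theorem d_zero_mk (P : BimoduleData k B M) (S : Subalgebra k B) (m : M) (a : Fin 1 → B) :
    d P S 0 (mk P S 1 (elem m a)) = ofCoeff P S (P.r (a 0) m) - ofCoeff P S (P.l (a 0) m) := by
  rw [d_mk, boundary_zero, map_sub, ofCoeff_apply P S _ Fin.elim0, ofCoeff_apply P S _ Fin.elim0]

theorem mapS_ofCoeff {M' : Type*} [AddCommGroup M'] [Module k M'] {P : BimoduleData k B M}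
    {P' : BimoduleData k B M'} {S : Subalgebra k B} {φ : M →ₗ[k] M'} (h : IsBilinear P P' S φ)
    (m : M) : mapS h 0 (ofCoeff P S m) = ofCoeff P' S (φ m) := by
  rw [ofCoeff_apply P S m Fin.elim0, ofCoeff_apply P' S _ Fin.elim0, mapS_mk_elem]

/-- A linear map on `M` which vanishes on commutators with `S` factors through chains of degree
zero. -/
def liftCoeff (P : BimoduleData k B M) (S : Subalgebra k B) {N : Type*} [AddCommGroup N]
    [Module k N] (φ : M →ₗ[k] N) (h : ∀ s ∈ S, ∀ m, φ (P.l s m) = φ (P.r s m)) :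
    RelChains P S 0 →ₗ[k] N :=
  (relations P S 0).liftQ (φ ∘ₗ (chainsZero k B M).toLinearMap) <| by
    refine Submodule.span_le.2 ?_
    rintro z (⟨⟨j, hj⟩, s, m, a, rfl⟩ | ⟨m, a, ⟨p, hp⟩, rfl⟩)
    · obtain rfl : j = 0 := by omega
      simp [chainsZero_elem, afterEnd, beforeEnd, h s s.2]
    · exact p.elim0

theorem liftCoeff_ofCoeff (P : BimoduleData k B M) (S : Subalgebra k B) {N : Type*}
    [AddCommGroup N] [Module k N] (φ : M →ₗ[k] N) (h : ∀ s ∈ S, ∀ m, φ (P.l s m) = φ (P.r s m))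
    (m : M) : liftCoeff P S φ h (ofCoeff P S m) = φ m :=
  congrArg φ ((chainsZero k B M).apply_symm_apply m)

/-- Balancing over `S` only imposes commutators with `S`, and the boundary from degree one imposes
those with all of `B`. The quotient is therefore independent of `S`. -/
theorem presents (P : BimoduleData k B M) (S : Subalgebra k B) :
    SeqHomology.Presents (d P S) P.commutators (ofCoeff P S) where
  surj c := by
    obtain ⟨m, rfl⟩ := ofCoeff_surjective P S c
    exact ⟨m, by rw [sub_self]; exact Submodule.zero_mem _⟩
  ker m := by
    constructor
    · rintro ⟨x, hx⟩
      have hφ : ∀ b m, P.commutators.mkQ (P.l b m) = P.commutators.mkQ (P.r b m) := fun b m => by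
        rw [← sub_eq_zero, ← map_sub]
        exact (Submodule.Quotient.mk_eq_zero _).2 (P.commutator_mem b m)
      let φ := liftCoeff P S P.commutators.mkQ fun s _ m => hφ s m
      have h : φ ∘ₗ d P S 0 = 0 := hom_ext fun m a => by
        rw [LinearMap.comp_apply, d_zero_mk, map_sub, liftCoeff_ofCoeff, liftCoeff_ofCoeff, hφ,
          sub_self]
        rfl
      have h2 := LinearMap.congr_fun h x
      rw [LinearMap.comp_apply, hx, liftCoeff_ofCoeff] at h2
      exact (Submodule.Quotient.mk_eq_zero _).1 h2
    · intro hm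
      refine Submodule.span_induction (p := fun m _ => ofCoeff P S m ∈ LinearMap.range (d P S 0))
        ?_ ?_ ?_ ?_ hm
      · rintro x ⟨b, m, rfl⟩
        refine ⟨-mk P S 1 (elem m fun _ => b), ?_⟩
        rw [map_neg, d_zero_mk, map_sub, neg_sub]
      · rw [map_zero]; exact Submodule.zero_mem _
      · intro x y _ _ hx hy
        rw [map_add]; exact Submodule.add_mem _ hx hy
      · intro c x _ hx
        rw [map_smul]; exact Submodule.smul_mem _ c hx

end RelChains

/-! ### The double complex for the homology of `H` -/

namespace HopfComplex

open RelChains DoubleComplex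

variable {k H : Type*} [CommRing k] [Ring H] [Bialgebra k H]
  {C : ℕ → Type*} [∀ r, AddCommGroup (C r)] [∀ r, Module k (C r)]
  {C' : ℕ → Type*} [∀ r, AddCommGroup (C' r)] [∀ r, Module k (C' r)]
  {C'' : ℕ → Type*} [∀ r, AddCommGroup (C'' r)] [∀ r, Module k (C'' r)]
  (a : ∀ r, H →ₐ[k] Module.End k (C r)) (a' : ∀ r, H →ₐ[k] Module.End k (C' r))
  (a'' : ∀ r, H →ₐ[k] Module.End k (C'' r))

/-- The double complex `C_r ⊗ (H/k)^s`. -/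
abbrev Bi (r s : ℕ) := RelChains (BimoduleData.ofAction (a r)) (⊥ : Subalgebra k H) s

section coeffMap

variable {V V' V'' : Type*} [AddCommGroup V] [Module k V] [AddCommGroup V'] [Module k V']
  [AddCommGroup V''] [Module k V''] (ρ : H →ₐ[k] Module.End k V) (ρ' : H →ₐ[k] Module.End k V')
  (ρ'' : H →ₐ[k] Module.End k V'')

/-- The map of complexes `V ⊗ (H/k)^s → V' ⊗ (H/k)^s` induced by a linear map. -/
def coeffMap (φ : V →ₗ[k] V') (s : ℕ) : RelChains (BimoduleData.ofAction ρ) ⊥ s →ₗ[k]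
    RelChains (BimoduleData.ofAction ρ') ⊥ s := mapS (isBilinear_bot _ _ φ) s

variable {ρ ρ' ρ''}

/-- The `H`-words are normalized over `k` only, so arbitrary linear maps induce maps of the modules
`V ⊗ (H/k)^s`. This is essential for contracting homotopies and sections, which need not be
`H`-linear; equivariance enters only in `coeffMap_d`. -/
theorem coeffMap_coeffMap {φ : V →ₗ[k] V'} {ψ : V' →ₗ[k] V''} {χ : V →ₗ[k] V''}
    (h : ∀ c, ψ (φ c) = χ c) (s : ℕ) (x : RelChains (BimoduleData.ofAction ρ) ⊥ s) :
    coeffMap ρ' ρ'' ψ s (coeffMap ρ ρ' φ s x) = coeffMap ρ ρ'' χ s x :=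
  mapS_mapS _ _ _ h _ _

theorem coeffMap_id {φ : V →ₗ[k] V} (h : ∀ c, φ c = c) (s : ℕ)
    (x : RelChains (BimoduleData.ofAction ρ) ⊥ s) : coeffMap ρ ρ φ s x = x := by
  obtain rfl : φ = LinearMap.id := LinearMap.ext h
  exact mapS_id _ (isBilinear_bot _ _ _) _

theorem coeffMap_zero {φ : V →ₗ[k] V'} (h : ∀ c, φ c = 0) (s : ℕ)
    (x : RelChains (BimoduleData.ofAction ρ) ⊥ s) : coeffMap ρ ρ' φ s x = 0 :=
  mapS_zero _ h _ _

theorem coeffMap_add {φ ψ χ : V →ₗ[k] V'} (h : ∀ c, φ c + ψ c = χ c) (s : ℕ)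
    (x : RelChains (BimoduleData.ofAction ρ) ⊥ s) :
    coeffMap ρ ρ' φ s x + coeffMap ρ ρ' ψ s x = coeffMap ρ ρ' χ s x :=
  mapS_add _ _ _ h _ _

theorem coeffMap_ofCoeff (φ : V →ₗ[k] V') (c : V) :
    coeffMap ρ ρ' φ 0 (ofCoeff _ ⊥ c) = ofCoeff (BimoduleData.ofAction ρ') ⊥ (φ c) :=
  mapS_ofCoeff _ _

theorem coeffMap_d {φ : V →ₗ[k] V'} (h : ∀ x c, φ (ρ x c) = ρ' x (φ c)) (s : ℕ)
    (x : RelChains (BimoduleData.ofAction ρ) ⊥ (s + 1)) :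
    coeffMap ρ ρ' φ s (d _ ⊥ s x) = d (BimoduleData.ofAction ρ') ⊥ s (coeffMap ρ ρ' φ (s + 1) x) :=
  mapS_d _ (fun b _ m => ⟨h b m, by simp [BimoduleData.ofAction]⟩) _ _

end coeffMap

/-- The differential of the double complex induced by that of `C`. -/
def dh (dC : ∀ r, C (r + 1) →ₗ[k] C r) (r s : ℕ) : Bi a (r + 1) s →ₗ[k] Bi a r s :=
  coeffMap (a (r + 1)) (a r) (dC r) s

/-- The differential of the double complex which computes the homology of `H`. -/
def dv (r s : ℕ) : Bi a r (s + 1) →ₗ[k] Bi a r s := d (BimoduleData.ofAction (a r)) ⊥ s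

/-- The map of total complexes induced by a map of coefficients. -/
def totalMap (φ : ∀ r, C r →ₗ[k] C' r) (n : ℕ) : Total (Bi a) n →ₗ[k] Total (Bi a') n :=
  LinearMap.pi fun p => coeffMap (a p.1.1) (a' p.1.1) (φ p.1.1) p.1.2 ∘ₗ LinearMap.proj p

theorem totalMap_apply (φ : ∀ r, C r →ₗ[k] C' r) (n : ℕ) (x : Total (Bi a) n)
    (p : {p : ℕ × ℕ // p.1 + p.2 = n}) :
    totalMap a a' φ n x p = coeffMap (a p.1.1) (a' p.1.1) (φ p.1.1) p.1.2 (x p) := rfl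

variable {a a' a''}

theorem totalMap_totalMap {φ : ∀ r, C r →ₗ[k] C' r} {ψ : ∀ r, C' r →ₗ[k] C'' r}
    {χ : ∀ r, C r →ₗ[k] C'' r} (h : ∀ r c, ψ r (φ r c) = χ r c) (n : ℕ) (x : Total (Bi a) n) :
    totalMap a' a'' ψ n (totalMap a a' φ n x) = totalMap a a'' χ n x :=
  funext fun _ => coeffMap_coeffMap (h _) _ _

theorem totalMap_id {φ : ∀ r, C r →ₗ[k] C r} (h : ∀ r c, φ r c = c) (n : ℕ)
    (x : Total (Bi a) n) : totalMap a a φ n x = x :=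
  funext fun _ => coeffMap_id (h _) _ _

theorem totalMap_zero {φ : ∀ r, C r →ₗ[k] C' r} (h : ∀ r c, φ r c = 0) (n : ℕ)
    (x : Total (Bi a) n) : totalMap a a' φ n x = 0 :=
  funext fun _ => coeffMap_zero (h _) _ _

theorem totalMap_add {φ ψ χ : ∀ r, C r →ₗ[k] C' r} (h : ∀ r c, φ r c + ψ r c = χ r c) (n : ℕ)
    (x : Total (Bi a) n) : totalMap a a' φ n x + totalMap a a' ψ n x = totalMap a a' χ n x :=
  funext fun _ => coeffMap_add (h _) _ _

variable {dC : ∀ r, C (r + 1) →ₗ[k] C r} {dC' : ∀ r, C' (r + 1) →ₗ[k] C' r}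

theorem totalMap_totalD {φ : ∀ r, C r →ₗ[k] C' r} (h : ∀ r x c, φ r (a r x c) = a' r x (φ r c))
    (hd : ∀ r c, φ r (dC r c) = dC' r (φ (r + 1) c)) (n : ℕ) (x : Total (Bi a) (n + 1)) :
    totalMap a a' φ n (totalD (dh a dC) (dv a) n x) =
      totalD (dh a' dC') (dv a') n (totalMap a a' φ (n + 1) x) := by
  funext ⟨⟨r, s⟩, hp⟩
  rw [totalMap_apply, totalD_apply, totalD_apply, map_add, map_smul]
  refine congrArg₂ (· + ·) ?_ (congrArg _ (coeffMap_d (h r) s _))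
  exact (coeffMap_coeffMap (χ := φ r ∘ₗ dC r) (fun _ => rfl) _ _).trans
    (coeffMap_coeffMap (fun c => (hd r c).symm) _ _).symm

theorem totalD_totalD (h : ∀ r x c, dC r (a (r + 1) x c) = a r x (dC r c))
    (hd : ∀ r c, dC r (dC (r + 1) c) = 0) (n : ℕ) (x : Total (Bi a) (n + 2)) :
    totalD (dh a dC) (dv a) n (totalD (dh a dC) (dv a) (n + 1) x) = 0 := by
  funext ⟨⟨r, s⟩, hp⟩
  have hh : ∀ x, dh a dC r s (dh a dC (r + 1) s x) = 0 := fun x =>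
    (coeffMap_coeffMap (χ := 0) (hd r) _ _).trans (coeffMap_zero (fun _ => rfl) _ _)
  have vv : ∀ x, dv a r s (dv a r (s + 1) x) = 0 := fun x => d_d _ _ _ _
  have hv : ∀ x, dh a dC r s (dv a (r + 1) s x) = dv a r s (dh a dC r (s + 1) x) := fun x =>
    coeffMap_d (h r) _ _
  rw [totalD_apply, totalD_apply, totalD_apply, map_add, map_add, map_smul, map_smul, hh, vv, hv,
    pow_succ]
  simp

/-- A coefficient as an element of degree zero of the total complex. -/
def ofCoeffTotal (a : ∀ r, H →ₐ[k] Module.End k (C r)) : C 0 →ₗ[k] Total (Bi a) 0 :=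
  LinearMap.single k (fun p : {p : ℕ × ℕ // p.1 + p.2 = 0} => Bi a p.1.1 p.1.2) ⟨(0, 0), rfl⟩ ∘ₗ
    ofCoeff (BimoduleData.ofAction (a 0)) ⊥

theorem ofCoeffTotal_apply (c : C 0) (h : 0 + 0 = 0) :
    ofCoeffTotal a c ⟨(0, 0), h⟩ = ofCoeff (BimoduleData.ofAction (a 0)) ⊥ c :=
  Pi.single_eq_same (M := fun p : {p : ℕ × ℕ // p.1 + p.2 = 0} => Bi a p.1.1 p.1.2) ⟨(0, 0), h⟩ _

theorem total_zero_ext {x y : Total (Bi a) 0} (h : x ⟨(0, 0), rfl⟩ = y ⟨(0, 0), rfl⟩) : x = y := by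
  funext ⟨⟨r, s⟩, hp⟩
  obtain rfl : r = 0 := by simp only at hp; omega
  obtain rfl : s = 0 := by simp only at hp; omega
  exact h

theorem ofCoeffTotal_surjective : Function.Surjective (ofCoeffTotal a) := by
  intro x
  obtain ⟨c, hc⟩ := ofCoeff_surjective _ _ (x ⟨(0, 0), rfl⟩)
  exact ⟨c, total_zero_ext ((ofCoeffTotal_apply c rfl).trans hc)⟩

theorem totalMap_ofCoeffTotal {φ : ∀ r, C r →ₗ[k] C' r} (c : C 0) :
    totalMap a a' φ 0 (ofCoeffTotal a c) = ofCoeffTotal a' (φ 0 c) := by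
  refine total_zero_ext ?_
  rw [totalMap_apply, ofCoeffTotal_apply, ofCoeffTotal_apply]
  exact coeffMap_ofCoeff _ _

/-- Boundaries in degree zero come from position `(1, 0)`, giving `dC 0 c`, and from `(0, 1)`,
giving `ε(x) c - x c`. The hypotheses characterize `N` as the least submodule containing these. -/
theorem ofCoeffTotal_mem_range (N : Submodule k (C 0)) (hN : ∀ c, dC 0 c ∈ N)
    (hN' : ∀ x c, a 0 x c - Coalgebra.counit (R := k) x • c ∈ N)
    (hle : ∀ N' : Submodule k (C 0), (∀ c, dC 0 c ∈ N') →
      (∀ x c, a 0 x c - Coalgebra.counit (R := k) x • c ∈ N') → N ≤ N') (c : C 0) :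
    ofCoeffTotal a c ∈ LinearMap.range (totalD (dh a dC) (dv a) 0) ↔ c ∈ N := by
  have hr : ∀ x c, (BimoduleData.ofAction (a 0)).r x c = Coalgebra.counit (R := k) x • c :=
    fun x c => by simp [BimoduleData.ofAction]
  constructor
  · rintro ⟨x, hx⟩
    have hφ : ∀ x c, N.mkQ (a 0 x c) = N.mkQ (Coalgebra.counit (R := k) x • c) := fun x c => by
      rw [← sub_eq_zero, ← map_sub]
      exact (Submodule.Quotient.mk_eq_zero _).2 (hN' x c)
    let φ := liftCoeff (BimoduleData.ofAction (a 0)) ⊥ N.mkQ fun s _ m => by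
      rw [hr]; exact hφ s m
    have h1 : φ ∘ₗ dh a dC 0 0 = 0 := by
      refine LinearMap.ext fun y => ?_
      obtain ⟨y, rfl⟩ := ofCoeff_surjective _ _ y
      rw [LinearMap.comp_apply, dh, coeffMap_ofCoeff, liftCoeff_ofCoeff]
      exact (Submodule.Quotient.mk_eq_zero _).2 (hN y)
    have h2 : φ ∘ₗ dv a 0 0 = 0 := hom_ext fun m b => by
      rw [LinearMap.comp_apply, dv, d_zero_mk, map_sub, liftCoeff_ofCoeff, liftCoeff_ofCoeff, hr,
        ← hφ]
      exact sub_self _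
    have h3 := congrArg φ (congrFun hx ⟨(0, 0), rfl⟩)
    rw [totalD_apply, ofCoeffTotal_apply, liftCoeff_ofCoeff, map_add, map_smul] at h3
    rw [← LinearMap.comp_apply, ← LinearMap.comp_apply, h1, h2] at h3
    refine (Submodule.Quotient.mk_eq_zero _).1 (h3.symm.trans ?_)
    simp
  · suffices h : N ≤ (LinearMap.range (totalD (dh a dC) (dv a) 0)).comap (ofCoeffTotal a) from
      fun hc => h hc
    refine hle _ (fun c => ?_) (fun x c => ?_)
    · refine ⟨Pi.single ⟨(1, 0), rfl⟩ (ofCoeff (BimoduleData.ofAction (a 1)) ⊥ c), total_zero_ext ?_⟩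
      rw [totalD_apply, ofCoeffTotal_apply, Pi.single_eq_same, Pi.single_eq_of_ne (by simp), map_zero,
        smul_zero]
      exact (add_zero _).trans (coeffMap_ofCoeff _ _)
    · refine ⟨Pi.single ⟨(0, 1), rfl⟩ (-mk (BimoduleData.ofAction (a 0)) ⊥ 1 (elem c fun _ => x)),
        total_zero_ext ?_⟩
      rw [totalD_apply, ofCoeffTotal_apply, Pi.single_eq_same, Pi.single_eq_of_ne (by simp), map_zero,
        map_neg, dv, d_zero_mk, hr, map_sub, neg_sub, pow_zero, one_smul]
      exact zero_add _

end HopfComplex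

/-! ### Acyclicity of the total complex for `E ⊗ M` -/

namespace CrossedProduct

open Coalgebra WithConv Convolution IterComul RelChains HopfComplex

variable {k A H M M' : Type*} [CommRing k] [Ring A] [Algebra k A] [Ring H] [HopfAlgebra k H]
  {X : CrossedSystem k A H} [AddCommGroup M] [Module k M] (P : BimoduleData k (CrossedProduct X) M)
  [AddCommGroup M'] [Module k M'] (P' : BimoduleData k (CrossedProduct X) M')

omit [Ring A] [Algebra k A] in
theorem eval_one_factor (Φ : MultilinearMap k (fun _ : Fin 1 => H) M) (c : H) :
    eval Φ c = Φ fun _ => c := by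
  have h : ∀ x : H, Φ (fun _ => x) = Φ.toLinearMap (fun _ => 0) 0 x := fun x => by
    rw [MultilinearMap.toLinearMap_apply]
    congr 1
    funext i
    obtain rfl := Subsingleton.elim i 0
    rw [Function.update_self]
  rw [eval_succ Φ (ℛ k c), h, map_eq_sum_right]
  refine Finset.sum_congr rfl fun i _ => ?_
  rw [eval_zero, MultilinearMap.curryLeft_apply, ← h]
  congr 2
  funext i
  obtain rfl : i = 0 := Subsingleton.elim (α := Fin 1) _ _
  rfl

theorem twist_zero_elem (h : H) (m : M) (a : Fin 0 → A) : twist X P 0 h (elem m a) =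
    ∑ i ∈ (ℛ k h).index, elem (P.l (inclH X ((ℛ k h).right i))
      (P.r (inclHInv X ((ℛ k h).left i)) m)) a := by
  rw [twist_elem, wordChain, word, eval_succ _ (ℛ k h)]
  refine Finset.sum_congr rfl fun i _ => ?_
  rw [eval_one_factor, MultilinearMap.curryLeft_apply, MultilinearMap.compLinearMap_apply,
    chainWord_apply]
  refine congrArg₂ elem ?_ (Subsingleton.elim _ _)
  rfl

theorem isBilinear_restrict {P : BimoduleData k (CrossedProduct X) M}
    {P' : BimoduleData k (CrossedProduct X) M'} {φ : M →ₗ[k] M'} (h : IsBilinear P P' ⊤ φ)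
    (S : Subalgebra k A) : IsBilinear (P.restrict (inclA X)) (P'.restrict (inclA X)) S φ :=
  fun _ _ _ => h _ trivial _

section

variable (hf : IsUnit (toConv X.f)) (S : Subalgebra k A)
  (hstable : ∀ (h : H), ∀ s ∈ S, X.act h s ∈ S) (hfS : ∀ h l : H, X.f (h ⊗ₜ[k] l) ∈ S)

-- The action touches the coefficient only through left and right multiplication by elements of `E`,
-- so maps of `E`-bimodules induce `H`-linear maps.
variable {P P'} in
theorem mapS_act {φ : M →ₗ[k] M'} (hφ : IsBilinear P P' ⊤ φ)
    (hS : IsBilinear (P.restrict (inclA X)) (P'.restrict (inclA X)) S φ) (n : ℕ) (h : H)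
    (c : RelChains (P.restrict (inclA X)) S n) :
    mapS hS n (act hf P S hstable hfS n h c) = act hf P' S hstable hfS n h (mapS hS n c) := by
  refine LinearMap.congr_fun (hom_ext (φ := mapS hS n ∘ₗ act hf P S hstable hfS n h)
    (ψ := act hf P' S hstable hfS n h ∘ₗ mapS hS n) fun m a => ?_) c
  rw [LinearMap.comp_apply, LinearMap.comp_apply, act_mk, mapS_mk_elem, act_mk, twist_elem,
    twist_elem]
  refine congrArg (RelChains.mk _ S n) ((map_eval (φ.rTensor _) _ h).trans ?_)
  refine LinearMap.congr_fun (eval_ext fun c => ?_) h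
  refine Eq.trans (b := elem (φ (P.l (letters X a (Fin.last _) (c (Fin.last _)))
    (P.r (letters X a 0 (c 0)) m))) _) rfl ?_
  rw [(hφ _ trivial _).1, (hφ _ trivial _).2]
  rfl

/-- The total complex which computes the homology of `H` with coefficients in the cyclic tensor
products. -/
abbrev HopfTotal (n : ℕ) := DoubleComplex.Total (Bi fun r => act hf P S hstable hfS r) n

/-- The differential of the total complex which computes the homology of `H` with coefficients in
the cyclic tensor products. -/
def hopfD (n : ℕ) : HopfTotal P hf S hstable hfS (n + 1) →ₗ[k] HopfTotal P hf S hstable hfS n :=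
  DoubleComplex.totalD (dh (fun r => act hf P S hstable hfS r) (d (P.restrict (inclA X)) S))
    (dv fun r => act hf P S hstable hfS r) n

theorem hopfD_hopfD (n : ℕ) (x : HopfTotal P hf S hstable hfS (n + 2)) :
    hopfD P hf S hstable hfS n (hopfD P hf S hstable hfS (n + 1) x) = 0 :=
  totalD_totalD (a := fun r => act hf P S hstable hfS r) (fun r h c => d_act P hf S hstable hfS r h c) (fun r c => d_d _ S r c) n x

theorem act_ofCoeff (h : H) (m : M) :
    act hf P S hstable hfS 0 h (ofCoeff _ S m) = ∑ i ∈ (ℛ k h).index,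
      ofCoeff (P.restrict (inclA X)) S (P.l (inclH X ((ℛ k h).right i))
        (P.r (inclHInv X ((ℛ k h).left i)) m)) := by
  simp only [ofCoeff_apply _ S _ Fin.elim0]
  rw [act_mk, twist_zero_elem, map_sum]

end

/-- `x ⊗ h ↦ (m ↦ h ⊗ m x)`. -/
def pairRight : CrossedProduct X ⊗[k] H →ₗ[k] M →ₗ[k] H ⊗[k] M :=
  TensorProduct.lift (LinearMap.mk₂ k (fun x h => TensorProduct.mk k H M h ∘ₗ P.r x)
    (fun x x' h => by ext; simp [TensorProduct.tmul_add]) (fun c x h => by ext; simp)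
    (fun x h h' => by ext; simp)
    (fun c x h => by ext; simp [TensorProduct.smul_tmul']))

theorem pairRight_tmul (x : CrossedProduct X) (h : H) (m : M) :
    pairRight P (x ⊗ₜ h) m = h ⊗ₜ P.r x m := rfl

/-- The action of `H` on `H ⊗ M` by multiplication from the left. -/
def leftAct (k H M : Type*) [CommRing k] [Ring H] [HopfAlgebra k H] [AddCommGroup M] [Module k M] :
    H →ₐ[k] Module.End k (H ⊗[k] M) :=
  AlgHom.ofLinearMap (LinearMap.rTensorHom M ∘ₗ LinearMap.mul k H)
    (by ext; simp) (fun h l => by ext; simp [mul_assoc])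

theorem leftAct_tmul (h l : H) (m : M) : leftAct k H M h (l ⊗ₜ m) = (h * l) ⊗ₜ m := rfl

theorem pairRight_mul (c : CrossedProduct X ⊗[k] H) (y : CrossedProduct X) (h : H) (m : M) :
    pairRight P ((y ⊗ₜ h) * c) m = leftAct k H M h (pairRight P c (P.r y m)) := by
  induction c with
  | zero => simp
  | add c c' hc hc' => rw [mul_add, map_add, LinearMap.add_apply, hc, hc', map_add,
      LinearMap.add_apply, map_add]
  | tmul x l =>
    rw [Algebra.TensorProduct.tmul_mul_tmul, pairRight_tmul, pairRight_tmul, leftAct_tmul, P.r_mul]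

/-- `l ⊗ m ↦ l⁽²⁾ ⊗ m w(l⁽¹⁾)`. -/
def transl (w : WithConv (H →ₗ[k] CrossedProduct X)) : H ⊗[k] M →ₗ[k] H ⊗[k] M :=
  TensorProduct.lift (pairRight P ∘ₗ w.ofConv.rTensor H ∘ₗ comul)

theorem transl_tmul (w : WithConv (H →ₗ[k] CrossedProduct X)) (l : H) (m : M) :
    transl P w (l ⊗ₜ m) =
      ∑ i ∈ (ℛ k l).index, (ℛ k l).right i ⊗ₜ[k] P.r (w ((ℛ k l).left i)) m := by
  rw [transl, TensorProduct.lift.tmul, LinearMap.comp_apply, LinearMap.comp_apply]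
  conv_lhs => rw [← (ℛ k l).eq]
  simp only [map_sum, LinearMap.sum_apply]
  rfl

theorem transl_one (x : H ⊗[k] M) : transl P 1 x = x := by
  induction x with
  | zero => simp
  | add x y hx hy => rw [map_add, hx, hy]
  | tmul l m =>
    have h1 : ∀ x, P.r ((1 : WithConv (H →ₗ[k] CrossedProduct X)) x) m = counit (R := k) x • m :=
      fun x => r_algebraMap P _ m
    rw [transl_tmul]
    simp only [h1, ← TensorProduct.smul_tmul, ← TensorProduct.sum_tmul]
    rw [sum_counit_smul]

/-- Composition of translations is convolution in reversed order, so translation by `convH` is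
invertible with inverse translation by `convHInv`. -/
theorem transl_transl (w w' : WithConv (H →ₗ[k] CrossedProduct X)) (x : H ⊗[k] M) :
    transl P w (transl P w' x) = transl P (w' * w) x := by
  induction x with
  | zero => simp
  | add x y hx hy => rw [map_add, map_add, hx, hy, map_add]
  | tmul l m =>
    let t : H →ₗ[k] H →ₗ[k] H →ₗ[k] H ⊗[k] M := LinearMap.mk₂ k
      (fun a b => (TensorProduct.mk k H M).flip (P.r (w b) (P.r (w' a) m)))
      (fun a a' b => by ext; simp) (fun c a b => by ext; simp)
      (fun a b b' => by ext; simp) (fun c a b => by ext; simp)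
    have ht : ∀ a b c, t a b c = c ⊗ₜ P.r (w b) (P.r (w' a) m) := fun _ _ _ => rfl
    have h3 := sum_trilinear t (ℛ k l)
    simp only [ht] at h3
    rw [transl_tmul, map_sum, transl_tmul]
    simp only [transl_tmul]
    refine h3.symm.trans (Finset.sum_congr rfl fun i _ => ?_)
    rw [(ℛ k ((ℛ k l).left i)).convMul_apply, map_sum, LinearMap.sum_apply, TensorProduct.tmul_sum]
    exact Finset.sum_congr rfl fun j _ => by rw [P.r_mul]

/-- `(x # l) ⊗ m ↦ l⁽²⁾ ⊗ m (x # l⁽¹⁾)`. -/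
def coactMap : CrossedProduct X ⊗[k] M →ₗ[k] H ⊗[k] M := TensorProduct.lift (pairRight P ∘ₗ coact X)

theorem coactMap_tmul (x : CrossedProduct X) (m : M) :
    coactMap P (x ⊗ₜ m) = pairRight P (coact X x) m := rfl

theorem coact_inclH {l : H} {ι : Type*} (R : Repr k l ι) :
    coact X (inclH X l) = ∑ i ∈ R.index, inclH X (R.left i) ⊗ₜ[k] R.right i := coact_tmul X 1 R

theorem coactMap_inclA_mul_inclH (x : A) (l : H) (m : M) :
    coactMap P ((inclA X x * inclH X l) ⊗ₜ m) = transl P (convH X) (l ⊗ₜ P.r (inclA X x) m) := by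
  rw [coactMap_tmul, coact_inclA_mul, pairRight_mul, map_one, transl_tmul, coact_inclH (ℛ k l),
    map_sum, LinearMap.sum_apply]
  rfl

/-- If the coaction sends `e` to `e⁽⁰⁾ ⊗ e⁽¹⁾`, the image of `h · (e ⊗ m)` is `h⁽³⁾ e⁽¹⁾ ⊗ m (1 #
h⁽¹⁾)⁻¹ (1 # h⁽²⁾) e⁽⁰⁾`. The two middle factors cancel and leave left multiplication by `h`. -/
theorem coactMap_twist (hf : IsUnit (toConv X.f)) (h : H) (z : CrossedProduct X ⊗[k] M) :
    coactMap P (∑ i ∈ (ℛ k h).index, P.free.l (inclH X ((ℛ k h).right i))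
        (P.free.r (inclHInv X ((ℛ k h).left i)) z)) = leftAct k H M h (coactMap P z) := by
  induction z with
  | zero => simp
  | add x y hx hy =>
    simp only [map_add, Finset.sum_add_distrib] at hx hy ⊢
    rw [hx, hy]
  | tmul e m =>
    let t : H →ₗ[k] H →ₗ[k] H →ₗ[k] H ⊗[k] M := LinearMap.mk₂ k
      (fun a b => (leftAct k H M).toLinearMap.flip
        (pairRight P (coact X e) (P.r (inclH X b) (P.r (inclHInv X a) m))))
      (fun a a' b => by ext; simp) (fun c a b => by ext; simp)
      (fun a b b' => by ext; simp) (fun c a b => by ext; simp)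
    have ht : ∀ a b c, t a b c = leftAct k H M c (pairRight P (coact X e)
      (P.r (inclH X b) (P.r (inclHInv X a) m))) := fun _ _ _ => rfl
    have h3 := sum_trilinear t (ℛ k h)
    simp only [ht] at h3
    simp only [BimoduleData.free_r, BimoduleData.free_l, map_sum, coactMap_tmul, coact_mul]
    refine Eq.trans ?_ (h3.symm.trans ?_)
    · refine Finset.sum_congr rfl fun i _ => ?_
      rw [coact_inclH (ℛ k ((ℛ k h).right i)), Finset.sum_mul, map_sum, LinearMap.sum_apply]
      exact Finset.sum_congr rfl fun j _ => pairRight_mul P _ _ _ _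
    · have h4 := map_eq_sum_left ((leftAct k H M).toLinearMap.flip (pairRight P (coact X e) m)) h
      refine Eq.trans (Finset.sum_congr rfl fun i _ => ?_) h4.symm
      have h5 : P.r ((convHInv X * convH X) ((ℛ k h).left i)) m =
          counit (R := k) ((ℛ k h).left i) • m := by
        rw [convHInv_mul_convH hf]
        exact r_algebraMap P _ m
      rw [(ℛ k ((ℛ k h).left i)).convMul_apply, map_sum, LinearMap.sum_apply] at h5
      simp only [← map_sum]
      simp only [P.r_mul] at h5
      exact (congrArg (fun y => leftAct k H M ((ℛ k h).right i) (pairRight P (coact X e) y)) h5).trans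
        (by rw [map_smul, map_smul]; rfl)

/-- The associativity isomorphism `A ⊗ (H ⊗ M) ≃ E ⊗ M`. -/
def freeAssoc (X : CrossedSystem k A H) (M : Type*) [AddCommGroup M] [Module k M] :
    A ⊗[k] (H ⊗[k] M) ≃ₗ[k] CrossedProduct X ⊗[k] M := (TensorProduct.assoc k A H M).symm

theorem freeAssoc_tmul (x : A) (l : H) (m : M) :
    freeAssoc X M (x ⊗ₜ (l ⊗ₜ m)) = (inclA X x * inclH X l) ⊗ₜ[k] m := by
  rw [← tmul_eq]
  rfl

/-- The free bimodule is left free over `A`. -/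
def leftFreeInclA : LeftFree (P.free.restrict (inclA X)) (LinearMap.lTensorHom H ∘ₗ P.r ∘ₗ
    (inclA X).toLinearMap) where
  e := freeAssoc X M
  l b x w := by
    induction w with
    | zero => simp
    | add w w' hw hw' => simp only [TensorProduct.tmul_add, map_add, hw, hw']
    | tmul l m =>
      rw [freeAssoc_tmul, freeAssoc_tmul, map_mul, mul_assoc]
      rfl
  r b x w := by
    induction w with
    | zero => simp
    | add w w' hw hw' => simp only [TensorProduct.tmul_add, map_add, hw, hw']
    | tmul l m => rfl
  mul b c w := by
    induction w with
    | zero => simp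
    | add w w' hw hw' => simp only [map_add, hw, hw']
    | tmul l m => simp [P.r_mul]
  one w := by
    induction w with
    | zero => simp
    | add w w' hw hw' => simp only [map_add, hw, hw']
    | tmul l m => simp [P.r_one]

/-- The augmentation sends `(x # l) ⊗ m` to `l ⊗ m x`; translating by `1 # l⁽¹⁾` completes `x` to `x
# l⁽¹⁾`. This compares the degree zero homology of a row with the map that is easily seen to be
`H`-linear. -/
theorem transl_aug (S : Subalgebra k A) (z : CrossedProduct X ⊗[k] M) :
    transl P (convH X) ((leftFreeInclA P).aug S (ofCoeff _ S z)) = coactMap P z := by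
  obtain ⟨z, rfl⟩ := (freeAssoc X M).surjective z
  induction z with
  | zero => simp
  | add z z' hz hz' => simp only [map_add, hz, hz']
  | tmul x w =>
    rw [ofCoeff_apply _ S _ Fin.elim0]
    rw [show freeAssoc X M = (leftFreeInclA P).e from rfl, LeftFree.aug_mk]
    induction w with
    | zero => simp
    | add w w' hw hw' => simp only [TensorProduct.tmul_add, map_add, hw, hw']
    | tmul l m =>
      rw [show (leftFreeInclA P).e = freeAssoc X M from rfl, freeAssoc_tmul,
        coactMap_inclA_mul_inclH]
      rfl

/-- `H ⊗ M` with the action of `H` from the left is left free over `H`. -/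
def leftFreeLeftAct (k H M : Type*) [CommRing k] [Ring H] [HopfAlgebra k H] [AddCommGroup M]
    [Module k M] : LeftFree (BimoduleData.ofAction (leftAct k H M))
      ((Algebra.linearMap k (Module.End k M)) ∘ₗ Coalgebra.counit) where
  e := LinearEquiv.refl k _
  l _ _ _ := rfl
  r b x w := by simp [BimoduleData.ofAction]
  mul b c w := by simp [smul_comm (counit (R := k) b)]
  one w := by simp

/-- The rows are resolutions by left freeness over `A`. The complex they resolve computes the
homology of `H` with coefficients in `H ⊗ M` under left multiplication, and it is exact by left
freeness over `H`. -/
theorem acyclic_hopfD_free (hf : IsUnit (toConv X.f)) (S : Subalgebra k A)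
    (hstable : ∀ (h : H), ∀ s ∈ S, X.act h s ∈ S) (hfS : ∀ h l : H, X.f (h ⊗ₜ[k] l) ∈ S) :
    SeqHomology.Acyclic (k := k) (C := HopfTotal P.free hf S hstable hfS) (hopfD P.free hf S hstable hfS) := by
  let F := leftFreeInclA P
  let a := fun r => act hf P.free S hstable hfS r
  have huv : ∀ w : H ⊗[k] M, transl P (convH X) (transl P (convHInv X) w) = w := fun w => by
    rw [transl_transl, convHInv_mul_convH hf, transl_one]
  have hvu : ∀ w : H ⊗[k] M, transl P (convHInv X) (transl P (convH X) w) = w := fun w => by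
    rw [transl_transl, convH_mul_convHInv hf, transl_one]
  let q : RelChains (P.free.restrict (inclA X)) S 0 →ₗ[k] H ⊗[k] M :=
    transl P (convH X) ∘ₗ F.aug S
  let σ : H ⊗[k] M →ₗ[k] RelChains (P.free.restrict (inclA X)) S 0 :=
    F.unit S ∘ₗ transl P (convHInv X)
  have hqσ : ∀ w, q (σ w) = w := fun w =>
    (congrArg (transl P (convH X)) (F.aug_unit S _)).trans (huv w)
  have hq : ∀ h c, q (a 0 h c) = leftAct k H M h (q c) := by
    intro h c
    obtain ⟨z, rfl⟩ := ofCoeff_surjective _ S c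
    refine (congrArg q (act_ofCoeff P.free hf S hstable hfS h z)).trans ?_
    rw [← map_sum]
    refine (transl_aug P S _).trans ((coactMap_twist P hf h z).trans ?_)
    exact congrArg _ (transl_aug P S z).symm
  refine DoubleComplex.acyclic_of_rows
    (Q := fun s => RelChains (BimoduleData.ofAction (leftAct k H M)) (⊥ : Subalgebra k H) s)
    (dQ := d (BimoduleData.ofAction (leftAct k H M)) ⊥) (fun s => coeffMap (a 0) (leftAct k H M) q s)
    (hopfD_hopfD P.free hf S hstable hfS) (fun r s x hx => ?_) (fun s x hx => ?_) (fun s y => ?_)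
    (fun s x => ?_) (fun s x => ?_) ((leftFreeLeftAct k H M).acyclic ⊥)
  -- With sign `(-1) ^ r` the homotopy satisfies `s d + id = d s` in degree `r + 1`, so a cycle `x`
  -- is `d (s x)`.
  · have h := coeffMap_add (ρ := a (r + 1)) (ρ' := a (r + 1))
      (φ := ((-1 : k) ^ r • F.homotopy S r) ∘ₗ d _ S r) (ψ := LinearMap.id)
      (χ := d _ S (r + 1) ∘ₗ ((-1 : k) ^ r • F.homotopy S (r + 1))) (fun c => by
        simp only [LinearMap.comp_apply, LinearMap.smul_apply, map_smul, F.d_homotopy, smul_add,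
          smul_smul, ← mul_pow]
        simp) s x
    rw [coeffMap_id (φ := LinearMap.id) fun _ => rfl,
      ← coeffMap_coeffMap (ρ' := a r) (φ := d _ S r) (ψ := (-1 : k) ^ r • F.homotopy S r)
        fun _ => rfl,
      ← coeffMap_coeffMap (ρ' := a (r + 2)) (φ := (-1 : k) ^ r • F.homotopy S (r + 1))
        (ψ := d _ S (r + 1)) fun _ => rfl] at h
    refine ⟨_, h.symm.trans ?_⟩
    rw [show coeffMap (a (r + 1)) (a r) (d _ S r) s x = 0 from hx, map_zero, zero_add]
  -- In degree zero `d (-s) + σ q = id`, so the kernel of `q` consists of boundaries.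
  · have h := coeffMap_add (ρ := a 0) (ρ' := a 0) (φ := d _ S 0 ∘ₗ (-F.homotopy S 0))
      (ψ := σ ∘ₗ q) (χ := LinearMap.id) (fun c => by
        have h1 : σ (q c) = F.unit S (F.aug S c) := congrArg (F.unit S) (hvu _)
        rw [LinearMap.comp_apply, LinearMap.comp_apply, h1, LinearMap.neg_apply, map_neg,
          F.d_homotopy_zero]
        simp) s x
    rw [coeffMap_id (φ := LinearMap.id) fun _ => rfl,
      ← coeffMap_coeffMap (ρ' := a 1) (φ := -F.homotopy S 0) (ψ := d _ S 0) fun _ => rfl,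
      ← coeffMap_coeffMap (ρ' := leftAct k H M) (φ := q) (ψ := σ) fun _ => rfl, hx, map_zero,
      add_zero] at h
    exact ⟨_, h⟩
  · exact ⟨coeffMap _ (a 0) σ s y, (coeffMap_coeffMap (χ := LinearMap.id) hqσ _ _).trans
      (coeffMap_id (fun _ => rfl) _ _)⟩
  · refine (coeffMap_coeffMap (χ := 0) (fun c => ?_) _ _).trans (coeffMap_zero (fun _ => rfl) _ _)
    exact (congrArg (transl P (convH X)) (F.aug_d S c)).trans (map_zero _)
  · exact coeffMap_d hq _ _

end CrossedProduct

/-! ### Separability and the split sequence of Hochschild complexes -/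

namespace BimoduleData

open RelChains

variable {k A B M : Type*} [CommRing k] [Ring A] [Algebra k A] [Ring B] [Algebra k B]
  [AddCommGroup M] [Module k M] (P : BimoduleData k B M)

theorem commutators_restrict_le (φ : A →ₐ[k] B) : (P.restrict φ).commutators ≤ P.commutators := by
  refine Submodule.span_le.2 ?_
  rintro _ ⟨b, m, rfl⟩
  exact P.commutator_mem _ _

theorem isBilinear_mulMap : IsBilinear P.free P ⊤ P.mulMap :=
  fun b _ x => ⟨P.mulMap_l b x, P.mulMap_r b x⟩

theorem isBilinear_subtype : IsBilinear P.syzygy P.free ⊤ (LinearMap.ker P.mulMap).subtype :=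
  fun _ _ _ => ⟨rfl, rfl⟩

/-- Over a separable subalgebra the multiplication `B ⊗ M → M` has a bilinear section. -/
theorem exists_section (φ : A →ₐ[k] B) (S : Subalgebra k A) (hS : IsSeparableAlgebra k S) :
    ∃ σ : M →ₗ[k] B ⊗[k] M, IsBilinear (P.restrict φ) (P.free.restrict φ) S σ ∧
      ∀ m, P.mulMap (σ m) = m := by
  obtain ⟨e, he, hse⟩ := hS
  -- Evaluated at the separability idempotent, `x ⊗ y ↦ (m ↦ x ⊗ y m)` is the section.
  let t : S ⊗[k] S →ₗ[k] M →ₗ[k] B ⊗[k] M := TensorProduct.lift (LinearMap.mk₂ k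
    (fun x y => TensorProduct.mk k B M (φ x) ∘ₗ P.l (φ y))
    (fun x x' y => by ext; simp)
    (fun c x y => by ext; simp [TensorProduct.smul_tmul'])
    (fun x y y' => by ext; simp [TensorProduct.tmul_add]) (fun c x y => by ext; simp))
  have ht : ∀ x y m, t (x ⊗ₜ y) m = φ x ⊗ₜ P.l (φ y) m := fun _ _ _ => rfl
  have h1 : ∀ (z : S ⊗[k] S) m, P.mulMap (t z m) = P.l (φ (LinearMap.mul' k S z : S)) m := by
    intro z m
    induction z with
    | zero => simp
    | tmul x y => rw [ht, mulMap_tmul, ← P.l_mul, ← map_mul]; rfl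
    | add x y hx hy => simp only [map_add, LinearMap.add_apply, hx, hy, Subalgebra.coe_add]
  have h2 : ∀ (s : S) (z : S ⊗[k] S) m,
      P.free.l (φ s) (t z m) = t ((LinearMap.mulLeft k s).rTensor S z) m := by
    intro s z m
    induction z with
    | zero => simp
    | tmul x y => rw [LinearMap.rTensor_tmul, ht, ht, free_l, ← map_mul]; rfl
    | add x y hx hy => simp only [map_add, LinearMap.add_apply, hx, hy]
  have h3 : ∀ (s : S) (z : S ⊗[k] S) m,
      t z (P.l (φ s) m) = t ((LinearMap.mulRight k s).lTensor S z) m := by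
    intro s z m
    induction z with
    | zero => simp
    | tmul x y => rw [LinearMap.lTensor_tmul, ht, ht, ← P.l_mul, ← map_mul]; rfl
    | add x y hx hy => simp only [map_add, LinearMap.add_apply, hx, hy]
  have h4 : ∀ (b : B) (z : S ⊗[k] S) m, t z (P.r b m) = P.free.r b (t z m) := by
    intro b z m
    induction z with
    | zero => simp
    | tmul x y => rw [ht, ht, free_r, P.l_r]
    | add x y hx hy => simp only [map_add, LinearMap.add_apply, hx, hy]
  refine ⟨t e, fun b hb m => ⟨?_, h4 _ e m⟩, fun m => ?_⟩
  -- Left linearity is `s e = e s`: moving `s` into `m` multiplies the second leg of `e` on the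
  -- right, while acting on `E ⊗ M` multiplies the first leg on the left.
  · exact (h3 ⟨b, hb⟩ e m).trans ((congrArg (fun z => t z m) (hse ⟨b, hb⟩).symm).trans
      (h2 ⟨b, hb⟩ e m).symm)
  · rw [h1, he, Subalgebra.coe_one, map_one, P.l_one, LinearMap.id_apply]

section

variable {P} {σ : M →ₗ[k] B ⊗[k] M} (hσ : ∀ m, P.mulMap (σ m) = m)

/-- The projection onto the kernel of the multiplication defined by a section. -/
def toSyzygy : B ⊗[k] M →ₗ[k] LinearMap.ker P.mulMap :=
  LinearMap.codRestrict _ (LinearMap.id - σ ∘ₗ P.mulMap) fun x => by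
    rw [LinearMap.mem_ker, LinearMap.sub_apply, map_sub, LinearMap.comp_apply, hσ]
    exact sub_self _

theorem coe_toSyzygy (x : B ⊗[k] M) : (toSyzygy hσ x : B ⊗[k] M) = x - σ (P.mulMap x) := rfl

theorem toSyzygy_coe (x : LinearMap.ker P.mulMap) : toSyzygy hσ x = x :=
  Subtype.ext (by rw [coe_toSyzygy, LinearMap.mem_ker.1 x.2, map_zero, sub_zero])

/-- The projection `x ↦ x - σ (mul x)` inherits linearity over `S` from the section, which also
splits the inclusion of the syzygy after passing to cyclic tensor products over `S`. -/
theorem isBilinear_toSyzygy {φ : A →ₐ[k] B} {S : Subalgebra k A}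
    (h : IsBilinear (P.restrict φ) (P.free.restrict φ) S σ) :
    IsBilinear (P.free.restrict φ) (P.syzygy.restrict φ) S (toSyzygy hσ) := by
  intro b hb x
  constructor
  · refine Subtype.ext ?_
    change P.free.l (φ b) x - σ (P.mulMap (P.free.l (φ b) x)) =
      P.free.l (φ b) (x - σ (P.mulMap x))
    rw [mulMap_l, map_sub]
    exact congrArg _ (h b hb _).1
  · refine Subtype.ext ?_
    change P.free.r (φ b) x - σ (P.mulMap (P.free.r (φ b) x)) =
      P.free.r (φ b) (x - σ (P.mulMap x))
    rw [mulMap_r, map_sub]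
    exact congrArg _ (h b hb _).2

/-- The split exact sequence of Hochschild complexes given by `0 → K → B ⊗ M → M → 0`. -/
def splitExact : SeqHomology.SplitExact (d P.syzygy ⊥) (d P.free ⊥) (d P ⊥) where
  ι := mapS (isBilinear_bot _ _ (LinearMap.ker P.mulMap).subtype)
  π := mapS (isBilinear_bot _ _ P.mulMap)
  τ := mapS (isBilinear_bot _ _ (toSyzygy hσ))
  σ := mapS (isBilinear_bot _ _ σ)
  ι_d := mapS_d _ P.isBilinear_subtype
  π_d := mapS_d _ P.isBilinear_mulMap
  τ_ι n x := (mapS_mapS _ _ (isBilinear_bot _ _ LinearMap.id) (fun c => toSyzygy_coe hσ c) n x).trans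
    (mapS_id _ _ _)
  π_ι n x := (mapS_mapS _ _ (isBilinear_bot _ _ 0) (fun c => c.2) n x).trans
    (mapS_zero _ (fun _ => rfl) _ _)
  π_σ n x := (mapS_mapS _ _ (isBilinear_bot _ _ LinearMap.id) hσ n x).trans (mapS_id _ _ _)
  add n x := by
    rw [mapS_mapS _ _ (isBilinear_bot _ _ (LinearMap.id - σ ∘ₗ P.mulMap)) (fun _ => rfl),
      mapS_mapS _ _ (isBilinear_bot _ _ (σ ∘ₗ P.mulMap)) (fun _ => rfl)]
    exact (mapS_add _ _ (isBilinear_bot _ _ LinearMap.id) (by simp) n x).trans (mapS_id _ _ _)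
  dB_dB := d_d _ _

end

end BimoduleData

/-! ### The split sequence of total complexes -/

namespace CrossedProduct

open Coalgebra WithConv Convolution IterComul RelChains HopfComplex BimoduleData

variable {k A H M : Type*} [CommRing k] [Ring A] [Algebra k A] [Ring H] [HopfAlgebra k H]
  {X : CrossedSystem k A H} [AddCommGroup M] [Module k M] {P : BimoduleData k (CrossedProduct X) M}
  (hf : IsUnit (toConv X.f)) (S : Subalgebra k A)
  (hstable : ∀ (h : H), ∀ s ∈ S, X.act h s ∈ S) (hfS : ∀ h l : H, X.f (h ⊗ₜ[k] l) ∈ S)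

/-- The split exact sequence of total complexes given by `0 → K → E ⊗ M → M → 0`. -/
def splitExactHopf {σ : M →ₗ[k] CrossedProduct X ⊗[k] M} (hσ : ∀ m, P.mulMap (σ m) = m)
    (h : IsBilinear (P.restrict (inclA X)) (P.free.restrict (inclA X)) S σ) :
    SeqHomology.SplitExact (k := k) (A := HopfTotal P.syzygy hf S hstable hfS)
      (B := HopfTotal P.free hf S hstable hfS) (C := HopfTotal P hf S hstable hfS)
      (hopfD P.syzygy hf S hstable hfS) (hopfD P.free hf S hstable hfS)
      (hopfD P hf S hstable hfS) where
  ι := totalMap _ _ (mapS (isBilinear_restrict P.isBilinear_subtype S))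
  π := totalMap _ _ (mapS (isBilinear_restrict P.isBilinear_mulMap S))
  τ := totalMap _ _ (mapS (isBilinear_toSyzygy hσ h))
  σ := totalMap _ _ (mapS h)
  ι_d := totalMap_totalD (fun r x c => mapS_act hf S hstable hfS P.isBilinear_subtype _ r x c)
    (mapS_d _ (isBilinear_restrict P.isBilinear_subtype ⊤))
  π_d := totalMap_totalD (fun r x c => mapS_act hf S hstable hfS P.isBilinear_mulMap _ r x c)
    (mapS_d _ (isBilinear_restrict P.isBilinear_mulMap ⊤))
  τ_ι n x := (totalMap_totalMap (χ := fun _ => LinearMap.id) (fun r c =>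
    (mapS_mapS _ _ .id (fun c => toSyzygy_coe hσ c) r c).trans (mapS_id _ _ _)) n x).trans
      (totalMap_id (fun _ _ => rfl) n x)
  π_ι n x := (totalMap_totalMap (χ := fun _ => 0) (fun r c =>
    (mapS_mapS _ _ (φ := (LinearMap.ker P.mulMap).subtype)
      (fun _ _ _ => by simp : IsBilinear _ _ S 0) (fun c => c.2) r c).trans
      (mapS_zero _ (fun _ => rfl) _ _)) n x).trans (totalMap_zero (fun _ _ => rfl) n x)
  π_σ n x := (totalMap_totalMap (χ := fun _ => LinearMap.id) (fun r c =>
    (mapS_mapS _ _ .id hσ r c).trans (mapS_id _ _ _)) n x).trans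
      (totalMap_id (fun _ _ => rfl) n x)
  add n x := by
    have h1 := isBilinear_restrict P.isBilinear_subtype S
    have h2 := isBilinear_restrict P.isBilinear_mulMap S
    rw [totalMap_totalMap (χ := fun r => mapS (h1.comp (isBilinear_toSyzygy hσ h)) r)
        (fun r c => mapS_mapS _ _ _ (fun _ => rfl) r c),
      totalMap_totalMap (χ := fun r => mapS (h.comp h2) r)
        (fun r c => mapS_mapS _ _ _ (fun _ => rfl) r c)]
    refine (totalMap_add (χ := fun _ => LinearMap.id) (fun r c => ?_) n x).trans
      (totalMap_id (fun _ _ => rfl) n x)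
    exact (mapS_add _ _ .id (fun z => sub_add_cancel _ _) r c).trans (mapS_id _ _ _)
  dB_dB := hopfD_hopfD P.free hf S hstable hfS

end CrossedProduct

/-! ### Comparison of the two theories -/

namespace CrossedProduct

open Coalgebra WithConv Convolution IterComul RelChains HopfComplex BimoduleData SeqHomology

section

variable {k A H M : Type*} [CommRing k] [Ring A] [Algebra k A] [Ring H] [HopfAlgebra k H]
  {X : CrossedSystem k A H} [AddCommGroup M] [Module k M] (P : BimoduleData k (CrossedProduct X) M)
  (hf : IsUnit (toConv X.f)) (S : Subalgebra k A)
  (hstable : ∀ (h : H), ∀ s ∈ S, X.act h s ∈ S) (hfS : ∀ h l : H, X.f (h ⊗ₜ[k] l) ∈ S)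

/-- A coefficient as an element of degree zero of the total complex. -/
def toHopfTotal : M →ₗ[k] HopfTotal P hf S hstable hfS 0 :=
  ofCoeffTotal (fun r => act hf P S hstable hfS r) ∘ₗ ofCoeff (P.restrict (inclA X)) S

/-- Modulo commutators `1 # h⁽²⁾` may be moved to the right of `m (1 # h⁽¹⁾)⁻¹`, where it cancels
the inverse. -/
theorem sum_conj_sub_mem (hf : IsUnit (toConv X.f)) (h : H) (m : M) :
    ∑ i ∈ (ℛ k h).index, P.l (inclH X ((ℛ k h).right i)) (P.r (inclHInv X ((ℛ k h).left i)) m) -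
      counit (R := k) h • m ∈ P.commutators := by
  have h1 : P.r ((convHInv X * convH X) h) m = counit (R := k) h • m := by
    rw [convHInv_mul_convH hf]
    exact r_algebraMap P _ m
  rw [(ℛ k h).convMul_apply, map_sum, LinearMap.sum_apply] at h1
  rw [← h1, ← Finset.sum_sub_distrib]
  refine Submodule.sum_mem _ fun i _ => ?_
  rw [P.r_mul]
  exact P.commutator_mem _ _

/-- Acting with `h⁽²⁾` on `m (1 # h⁽¹⁾)` cancels the right factor and leaves `(1 # h) m`. The
coinvariance relations thereby recover the commutators with `1 # h`. -/
theorem sum_conj_r_inclH (hf : IsUnit (toConv X.f)) (h : H) (m : M) :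
    ∑ i ∈ (ℛ k h).index, ∑ j ∈ (ℛ k ((ℛ k h).right i)).index,
      P.l (inclH X ((ℛ k ((ℛ k h).right i)).right j))
        (P.r (inclHInv X ((ℛ k ((ℛ k h).right i)).left j))
          (P.r (inclH X ((ℛ k h).left i)) m)) = P.l (inclH X h) m := by
  let t : H →ₗ[k] H →ₗ[k] H →ₗ[k] M := LinearMap.mk₂ k
    (fun a b => (P.l ∘ₗ inclH X).flip (P.r (inclHInv X b) (P.r (inclH X a) m)))
    (fun a a' b => by ext; simp) (fun c a b => by ext; simp)
    (fun a b b' => by ext; simp) (fun c a b => by ext; simp)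
  refine (sum_trilinear t (ℛ k h)).symm.trans ?_
  refine Eq.trans (Finset.sum_congr rfl fun i _ => ?_)
    (map_eq_sum_left ((P.l ∘ₗ inclH X).flip m) h).symm
  have h1 : P.r ((convH X * convHInv X) ((ℛ k h).left i)) m =
      counit (R := k) ((ℛ k h).left i) • m := by
    rw [convH_mul_convHInv hf]
    exact r_algebraMap P _ m
  rw [(ℛ k ((ℛ k h).left i)).convMul_apply, map_sum, LinearMap.sum_apply] at h1
  simp only [P.r_mul] at h1
  refine Eq.trans ?_ ((congrArg (P.l (inclH X ((ℛ k h).right i))) h1).trans (map_smul _ _ _))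
  rw [map_sum]
  rfl

/-- Since `E` is spanned by products `a (1 # h)`, a commutator with such a product splits as one
with `a` plus one with `1 # h`. -/
theorem commutators_le {N : Submodule k M} (hA : ∀ a m, P.l (inclA X a) m - P.r (inclA X a) m ∈ N)
    (hH : ∀ h m, P.l (inclH X h) m - P.r (inclH X h) m ∈ N) : P.commutators ≤ N := by
  refine Submodule.span_le.2 ?_
  rintro _ ⟨b, m, rfl⟩
  induction b using CrossedProduct.induction with
  | h0 => simp
  | h1 a h =>
    have h1 := N.add_mem (hA a (P.l (inclH X h) m)) (hH h (P.r (inclA X a) m))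
    rw [P.l_r, sub_add_sub_cancel] at h1
    rw [P.l_mul, P.r_mul]
    exact h1
  | h2 x y hx hy =>
    rw [map_add, map_add, LinearMap.add_apply, LinearMap.add_apply, add_sub_add_comm]
    exact N.add_mem hx hy

/-- The homology of `H` with coefficients in the cyclic tensor products. -/
abbrev HopfTotalHomology (n : ℕ) :=
  Homology (k := k) (C := HopfTotal P hf S hstable hfS) (hopfD P hf S hstable hfS) n

/-- The quotient by boundaries of the cyclic complex is `M / [A, M]`, and coinvariants under `H`
then impose the commutators with `1 # h`. Together these give `M / [E, M]`. -/
theorem presents_hopfD : Presents (C := HopfTotal P hf S hstable hfS) (hopfD P hf S hstable hfS)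
    P.commutators (toHopfTotal P hf S hstable hfS) where
  surj c := by
    obtain ⟨c, rfl⟩ := ofCoeffTotal_surjective c
    obtain ⟨m, rfl⟩ := ofCoeff_surjective _ _ c
    refine ⟨m, ?_⟩
    rw [toHopfTotal, LinearMap.comp_apply, sub_self]
    exact Submodule.zero_mem _
  ker m := by
    have hle : ∀ {m}, ofCoeff (P.restrict (inclA X)) S m ∈
        LinearMap.range (d (P.restrict (inclA X)) S 0) → m ∈ P.commutators := fun h =>
      commutators_restrict_le P _ (((presents _ S).ker _).1 h)
    refine (ofCoeffTotal_mem_range (P.commutators.map (ofCoeff (P.restrict (inclA X)) S))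
      (fun c => ?_) (fun h c => ?_) (fun N' h1 h2 => ?_) _).trans ?_
    · obtain ⟨m, hm⟩ := ofCoeff_surjective (P.restrict (inclA X)) S
        (d (P.restrict (inclA X)) S 0 c)
      exact ⟨m, hle ⟨c, hm.symm⟩, hm⟩
    · obtain ⟨m, rfl⟩ := ofCoeff_surjective _ _ c
      refine ⟨_, sum_conj_sub_mem P hf h m, ?_⟩
      rw [map_sub, map_sum, map_smul, act_ofCoeff]
    · rw [Submodule.map_le_iff_le_comap]
      refine commutators_le P (fun a m => ?_) (fun h m => ?_)
      · have h3 := N'.neg_mem (h1 (mk _ S 1 (elem m fun _ => a)))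
        rw [d_zero_mk, neg_sub, ← map_sub] at h3
        exact h3
      -- The coinvariance relation for `h⁽²⁾` is applied to `m (1 # h⁽¹⁾)` and summed: the first
      -- terms add up to `(1 # h) m`, the counit terms to `m (1 # h)`.
      · have h3 : ∑ i ∈ (ℛ k h).index, (act hf P S hstable hfS 0 ((ℛ k h).right i)
            (ofCoeff _ S (P.r (inclH X ((ℛ k h).left i)) m)) -
            counit (R := k) ((ℛ k h).right i) •
              ofCoeff _ S (P.r (inclH X ((ℛ k h).left i)) m)) ∈ N' :=
          N'.sum_mem fun i _ => h2 _ _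
        rw [Finset.sum_sub_distrib] at h3
        simp only [act_ofCoeff, ← map_sum,
          ← LinearMap.map_smul (ofCoeff (P.restrict (inclA X)) S)] at h3
        rw [sum_conj_r_inclH P hf, ← map_sub] at h3
        have h4 := map_eq_sum_right (P.r.flip m ∘ₗ inclH X) h
        simp only [LinearMap.comp_apply, LinearMap.flip_apply] at h4
        rw [← h4] at h3
        exact h3
    · constructor
      · rintro ⟨m', hm', h⟩
        have h3 : m - m' ∈ P.commutators := hle (by
          rw [map_sub, h, sub_self]; exact Submodule.zero_mem _)
        rw [← sub_add_cancel m m']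
        exact Submodule.add_mem _ h3 hm'
      · exact fun hm => ⟨m, hm, rfl⟩

theorem nonempty_homology_zero_equiv :
    Nonempty (Homology (d P ⊥) 0 ≃ₗ[k]
      HopfTotalHomology P hf S hstable hfS 0) := by
  obtain ⟨e⟩ := (presents P ⊥).nonempty_equiv
  obtain ⟨e'⟩ := (presents_hopfD P hf S hstable hfS).nonempty_equiv
  exact ⟨e.trans e'.symm⟩

/-- Both theories present `H_0` of the syzygy and of `E ⊗ M` by the same commutator submodules,
compatibly with the inclusion. The kernels which compute `H_1` are therefore the same quotient. -/
theorem nonempty_homology_one_equiv (hS : IsSeparableAlgebra k S) :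
    Nonempty (Homology (d P ⊥) 1 ≃ₗ[k]
      HopfTotalHomology P hf S hstable hfS 1) := by
  obtain ⟨σ, hb, hσ⟩ := P.exists_section (inclA X) S hS
  obtain ⟨e⟩ := (splitExact hσ).nonempty_equiv_one ((leftFreeFree P).acyclic ⊥)
    (presents P.syzygy ⊥) (presents P.free ⊥) (LinearMap.ker P.mulMap).subtype
    fun x => mapS_ofCoeff (isBilinear_bot _ _ _) x
  obtain ⟨e'⟩ := (splitExactHopf hf S hstable hfS hσ hb).nonempty_equiv_one
    (acyclic_hopfD_free P hf S hstable hfS) (presents_hopfD P.syzygy hf S hstable hfS)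
    (presents_hopfD P.free hf S hstable hfS) (LinearMap.ker P.mulMap).subtype
    fun x => (totalMap_ofCoeffTotal _).trans (congrArg _ (mapS_ofCoeff _ x))
  exact ⟨e.trans e'.symm⟩

theorem nonempty_homology_succ_equiv (hS : IsSeparableAlgebra k S) (n : ℕ)
    (h : Nonempty (Homology (d P.syzygy ⊥) (n + 1) ≃ₗ[k]
      HopfTotalHomology P.syzygy hf S hstable hfS
        (n + 1))) :
    Nonempty (Homology (d P ⊥) (n + 2) ≃ₗ[k]
      HopfTotalHomology P hf S hstable hfS (n + 2)) := by
  obtain ⟨σ, hb, hσ⟩ := P.exists_section (inclA X) S hS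
  obtain ⟨e⟩ := (splitExact hσ).nonempty_equiv_succ ((leftFreeFree P).acyclic ⊥) n
  obtain ⟨e'⟩ := (splitExactHopf hf S hstable hfS hσ hb).nonempty_equiv_succ
    (acyclic_hopfD_free P hf S hstable hfS) n
  obtain ⟨e''⟩ := h
  exact ⟨(e.trans e'').trans e'.symm⟩

end

section

universe uk uA uH uM

variable {k : Type uk} {A : Type uA} {H : Type uH} [CommRing k] [Ring A] [Algebra k A] [Ring H]
  [HopfAlgebra k H] {X : CrossedSystem k A H} (hf : IsUnit (toConv X.f)) (S : Subalgebra k A)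
  (hS : IsSeparableAlgebra k S)
  (hstable : ∀ (h : H), ∀ s ∈ S, X.act h s ∈ S) (hfS : ∀ h l : H, X.f (h ⊗ₜ[k] l) ∈ S)

include hS

/-- The syzygy lies in `E ⊗ M`, whose universe is larger than that of `M` in general. The induction
takes place in a universe closed under syzygies; an arbitrary `M` then needs one further shift. -/
theorem nonempty_homology_succ_equiv_of_universe (n : ℕ) :
    ∀ {M : Type (max uA uH uM)} [AddCommGroup M] [Module k M]
      (P : BimoduleData k (CrossedProduct X) M),
      Nonempty (Homology (d P ⊥) (n + 1) ≃ₗ[k]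
        HopfTotalHomology P hf S hstable hfS (n + 1)) := by
  induction n with
  | zero => exact fun P => nonempty_homology_one_equiv P hf S hstable hfS hS
  | succ n ih =>
    exact fun P => nonempty_homology_succ_equiv P hf S hstable hfS hS n (ih P.syzygy)

/-- The Hochschild homology of a crossed product in terms of the homology of `H`. -/
theorem nonempty_homology_equiv_hopf {M : Type uM} [AddCommGroup M] [Module k M]
    (P : BimoduleData k (CrossedProduct X) M) (n : ℕ) :
    Nonempty (Homology (d P ⊥) n ≃ₗ[k]
      HopfTotalHomology P hf S hstable hfS n) :=
  match n with
  | 0 => nonempty_homology_zero_equiv P hf S hstable hfS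
  | 1 => nonempty_homology_one_equiv P hf S hstable hfS hS
  | n + 2 => nonempty_homology_succ_equiv P hf S hstable hfS hS n
      (nonempty_homology_succ_equiv_of_universe.{uk, uA, uH, uM} hf S hS hstable hfS n P.syzygy)

end

end CrossedProduct

/-! ### Transfer to categorical chain complexes -/

namespace HopfHomology

open HopfComplex SeqHomology CategoryTheory

theorem nonempty_hopfHomology_equiv {k : Type u} {H : Type v} [CommRing k] [Ring H] [Bialgebra k H]
    {C : ℕ → Type w} [∀ n, AddCommGroup (C n)] [∀ n, Module k (C n)] (d : ∀ n, C (n + 1) →ₗ[k] C n)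
    (sq : ∀ n, ModuleCat.ofHom (d (n + 1)) ≫ ModuleCat.ofHom (d n) = 0)
    (ρ : H →ₐ[k] End (ChainComplex.of (fun n => ModuleCat.of k (C n))
      (fun n => ModuleCat.ofHom (d n)) sq))
    (a : ∀ r, H →ₐ[k] Module.End k (C r)) (ha : ∀ r h (c : C r), ((ρ h).f r).hom c = a r h c)
    (n : ℕ) :
    Nonempty (hopfHomology ρ n ≃ₗ[k]
      Homology (k := k) (C := DoubleComplex.Total (Bi a)) (DoubleComplex.totalD (dh a d) (dv a)) n) := by
  obtain rfl : a = fun r => coeff ρ r :=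
    funext fun r => AlgHom.ext fun h => LinearMap.ext fun c => (ha r h c).symm
  obtain ⟨e⟩ := nonempty_homology_equiv (k := k) (C := Total ρ) (totalD ρ) (fun n => by
    rw [← ModuleCat.ofHom_comp, totalD_comp]
    rfl) n
  -- The differential of `ChainComplex.of` is only propositionally equal to `d`, so the total
  -- differentials are identified by rewriting along this equality.
  have h : (fun r => ((ChainComplex.of (fun n => ModuleCat.of k (C n))
      (fun n => ModuleCat.ofHom (d n)) sq).d (r + 1) r).hom) = d := funext fun r =>
    congrArg ModuleCat.Hom.hom (ChainComplex.of_d (fun n => ModuleCat.of k (C n))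
      (fun n => ModuleCat.ofHom (d n)) r)
  have h2 := congrArg (fun D : ∀ n, C (n + 1) →ₗ[k] C n =>
    DoubleComplex.totalD (dh (fun r => coeff ρ r) D) (dv fun r => coeff ρ r)) h
  rw [← h2]
  exact ⟨e⟩

end HopfHomology

/-! ### The action as an algebra map into the endomorphisms of the complex -/

namespace CrossedProduct

open WithConv RelChains CategoryTheory

variable {k A H M : Type*} [CommRing k] [Ring A] [Algebra k A] [Ring H] [HopfAlgebra k H]
  {X : CrossedSystem k A H} [AddCommGroup M] [Module k M] (P : BimoduleData k (CrossedProduct X) M)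
  (hf : IsUnit (toConv X.f)) (S : Subalgebra k A)
  (hstable : ∀ (h : H), ∀ s ∈ S, X.act h s ∈ S) (hfS : ∀ h l : H, X.f (h ⊗ₜ[k] l) ∈ S)

/-- The action of an element of `H` on the complex of cyclic tensor products. -/
def actHom (h : H) : End (RelChains.complex (P.restrict (inclA X)) S) :=
  ChainComplex.ofHom (fun r => ModuleCat.ofHom (act hf P S hstable hfS r h)) fun r => by
    have hd : (RelChains.complex (P.restrict (inclA X)) S).d (r + 1) r =
        ModuleCat.ofHom (d (P.restrict (inclA X)) S r) :=
      ChainComplex.of_d (fun n => ModuleCat.of k (RelChains (P.restrict (inclA X)) S n))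
        (fun n => ModuleCat.ofHom (d (P.restrict (inclA X)) S n)) r
    rw [hd]
    exact ModuleCat.hom_ext (LinearMap.ext fun c => d_act P hf S hstable hfS r h c)

theorem actHom_f (h : H) (r : ℕ) :
    (actHom P hf S hstable hfS h).f r = ModuleCat.ofHom (act hf P S hstable hfS r h) := rfl

/-- The action of `H` on the complex of cyclic tensor products. -/
def actComplex : H →ₐ[k] End (RelChains.complex (P.restrict (inclA X)) S) :=
  AlgHom.ofLinearMap
    { toFun := actHom P hf S hstable hfS
      map_add' := fun h l => HomologicalComplex.hom_ext _ _ fun r => by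
        rw [HomologicalComplex.add_f_apply, actHom_f, actHom_f, actHom_f, map_add]
        rfl
      map_smul' := fun c h => HomologicalComplex.hom_ext _ _ fun r => by
        rw [actHom_f, map_smul]
        rfl }
    (HomologicalComplex.hom_ext _ _ fun r => by
      change ModuleCat.ofHom (act hf P S hstable hfS r 1) = _
      rw [map_one]
      rfl)
    (fun h l => HomologicalComplex.hom_ext _ _ fun r => by
      change ModuleCat.ofHom (act hf P S hstable hfS r (h * l)) = _
      rw [map_mul]
      rfl)

end CrossedProduct

end

theorem theorem3p1p5p1 {k A H M : Type*} [CommRing k] [Ring A] [Algebra k A]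
    [Ring H] [HopfAlgebra k H]
    -- the crossed product `E = A #_f H`, with convolution invertible `f`
    (X : CrossedSystem k A H) (hf : IsUnit (WithConv.toConv X.f))
    -- a separable subalgebra `S`, stable under the weak action, in which `f` takes its values
    (S : Subalgebra k A) (hS : IsSeparableAlgebra k S)
    (hstable : ∀ (h : H), ∀ s ∈ S, X.act h s ∈ S)
    (hfS : ∀ h l : H, X.f (h ⊗ₜ[k] l) ∈ S)
    -- an `E`-bimodule `M`
    [AddCommGroup M] [Module k M] [Module (CrossedProduct X) M] [Module (CrossedProduct X)ᵐᵒᵖ M]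
    [IsScalarTower k (CrossedProduct X) M] [IsScalarTower k (CrossedProduct X)ᵐᵒᵖ M]
    [SMulCommClass (CrossedProduct X) (CrossedProduct X)ᵐᵒᵖ M] :
    -- the formula for `h · (m ⊗_S a)` defines an action `ρ` of `H` on `(M ⊗_S (A/S)^* ⊗_S, b)`, and
    -- `H_n(E, M)` is the homology of `H` with coefficients in this complex
    ∃ ρ : H →ₐ[k] CategoryTheory.End (CrossedProduct.cyclicComplex X M S),
      (∀ (r : ℕ) (h : H) (x : RelChains.Chains k A M r),
        ((ρ h).f r).hom (RelChains.mk (CrossedProduct.bimodA X M) S r x) =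
          RelChains.mk (CrossedProduct.bimodA X M) S r
            (CrossedProduct.twist X (CrossedProduct.bimod X M) r h x)) ∧
      ∀ n : ℕ, Nonempty
        (hochschildHomology (CrossedProduct.bimod X M) n ≃ₗ[k] hopfHomology ρ n) := by
  refine ⟨CrossedProduct.actComplex (CrossedProduct.bimod X M) hf S hstable hfS, fun r h x => ?_,
    fun n => ?_⟩
  · exact CrossedProduct.act_mk (CrossedProduct.bimod X M) hf S hstable hfS r h x
  · obtain ⟨e⟩ := SeqHomology.nonempty_homology_equiv
      (RelChains.d (CrossedProduct.bimod X M) ⊥) (fun n => by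
        rw [← ModuleCat.ofHom_comp, RelChains.d_comp]
        rfl) n
    obtain ⟨e'⟩ := CrossedProduct.nonempty_homology_equiv_hopf hf S hS hstable hfS
      (CrossedProduct.bimod X M) n
    obtain ⟨e''⟩ := HopfHomology.nonempty_hopfHomology_equiv
      (RelChains.d (CrossedProduct.bimodA X M) S) (fun n => by
        rw [← ModuleCat.ofHom_comp, RelChains.d_comp]
        rfl)
      (CrossedProduct.actComplex (CrossedProduct.bimod X M) hf S hstable hfS)
      (fun r => CrossedProduct.act hf (CrossedProduct.bimod X M) S hstable hfS r)
      (fun _ _ _ => rfl) n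
    exact ⟨e.trans (e'.trans e''.symm)⟩
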